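/- Let $d,m\ge 1$. Assume: - $\Omega\subset\mathbb{R}^d$ is open and bounded with Lipschitz boundary, and $\rho_X$ is a Lipschitz probability density on $\Omega$ with $0<\rho_{\min}\le\rho_X\le\rho_{\max}<\infty$; - $\eta:[0,\infty)\to[0,\infty)$ is nonincreasing with $\eta(0)>0$, $\int_{\mathbb{R}^d}\eta(|z|)\,dz=1$ and $\int_{\mathbb{R}^d}\eta(|z|)|z|^k\,dz<\infty$ for $1\le k\le 4$; - $\sigma:\Omega\to\mathbb{R}$ is continuous with $0<\sigma_{\min}\le\sigma\le\sigma_{\max}<\infty$. For $T:\Omega\to\mathbb{R}^m$, $h>0$ and points $x_1,\dots,x_n\in\Omega$ put $h_i=\sigma(x_i)h$, $\eta_{b}(t)=b^{-d}\eta(t/b)$, $d_i=\sum_{j=1}^n\eta_{h_i}(|x_i-x_j|)$ and $$\mathcal{A}_n[T]=\frac1n\sum_{i=1}^n\frac1{d_i}\sum_{j=1}^n\eta_{h_i}(|x_i-x_j|)\log\bigl(1+h^{-2}|T(x_i)-T(x_j)|^2\bigr).$$ For $s\in(0,\infty]$ put $$\Phi_s(A)=\int_{\mathbb{R}^d}\eta(|z|)\log(s^{-2}+|Az|^2)\,dz,\qquad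 \mathcal{A}[T;\Phi_s]=\int_\Omega\Phi_s(\sigma\,DT)\,\rho_X\,dx,$$ where $s^{-2}=0$ if $s=\infty$ and $\log 0=-\infty$ (so the value $-\infty$ is possible when $s=\infty$). Put $\gamma(r)=\int_{|z|\ge r}\eta(|z|)\,dz$. Let $\mathrm{Lip}(T)$ and $\mathrm{Lip}(DT)$ denote the smallest Lipschitz constants on $\Omega$. (1) There are constants $C\ge 1$ and $0<c\le 1$, depending only on $d,m,\Omega,\rho_X,\eta,\sigma,\sigma_{\min},\sigma_{\max}$, such that the following holds for every differentiable $T:\Omega\to\mathbb{R}^m$ with $T$ and $DT$ Lipschitz on $\Omega$, all $n\ge 2$, $0<h\le c$ with $nh^d\ge C$, all $r\ge h$, $\lambda\ge 0$ with $\lambda^2\le c\,nh^d$, and all $s\in(0,\infty)$. If $x_1,\dots,x_n$ are i.i.d. with density $\rho_X$ on $\Omega$, then with probability at least $1-3n\exp(-\lambda^2)$ $$\bigl|\mathcal{A}_n[sT]-2\log s-\mathcal{A}[T;\Phi_s]\bigr|\le C s^2\bigl(\mathrm{Lip}(T)^2+\mathrm{Lip}(DT)^2\bigr)\left(\frac{\lambda}{\sqrt{nh^d}}+\gamma\Bigl(\frac{r}{h\sigma_{\max}}\Bigr)+r\right).$$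 (2) Let $T$ be as in (1), let $s\in(0,\infty]$, and let $h_n>0$, $s_n>0$ and $r_n\in\mathbb{R}$ be sequences with $h_n\to0$, $r_n\to 0$, $s_n\to s$, $$\frac{nh_n^d}{\log n}\to\infty,\qquad \frac{r_n}{h_n}\to\infty,\qquad s_n^2\left(\sqrt{\frac{\log n}{nh_n^d}}+\gamma\Bigl(\frac{r_n}{h_n\sigma_{\max}}\Bigr)+r_n\right)\to 0 .$$ If $x_1,x_2,\dots$ are i.i.d. with density $\rho_X$ on $\Omega$, then almost surely, with $\mathcal{A}_n$ formed from $x_1,\dots,x_n$ and $h=h_n$, $$\lim_{n\to\infty}\bigl(\mathcal{A}_n[s_nT]-2\log s_n\bigr)=\mathcal{A}[T;\Phi_s]\quad\text{in }[-\infty,\infty].$$ (3) For every $s\in(0,\infty]$, sequences $h_n,r_n,s_n$ satisfying all the conditions in (2) exist. Hence every $\mathcal{A}[T;\Phi_s]$, including $\mathcal{A}[T;\Phi_\infty]$, is such a limit. -/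

import Mathlib

open MeasureTheory ProbabilityTheory Filter Topology
open scoped ENNReal NNReal RealInnerProductSpace

noncomputable section

namespace TSNE

/-- Euclidean space `ℝ^k`. -/
abbrev Eucl (k : ℕ) : Type := EuclideanSpace ℝ (Fin k)

/-- Bounded-domain notion of a Lipschitz boundary: near every boundary point `p` there are a unit
vector `e` and a Lipschitz function `g` of the component orthogonal to `e`, such that in a small
ball around `p` the set is exactly the strict epigraph of `g` in direction `e`. -/
def HasLipschitzBoundary {d : ℕ} (Ω : Set (Eucl d)) : Prop :=
  ∀ p ∈ frontier Ω, ∃ ε > (0 : ℝ), ∃ e : Eucl d, ‖e‖ = 1 ∧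
    ∃ g : Eucl d → ℝ, (∃ L : ℝ≥0, LipschitzWith L g) ∧
      ∀ x ∈ Metric.ball p ε, (x ∈ Ω ↔ g (x - ⟪e, x⟫ • e) < ⟪e, x⟫)

/-- The smallest Lipschitz constant of `f` on `S` (meaningful when `f` is Lipschitz on `S`). -/
def lipConst {α β : Type*} [PseudoMetricSpace α] [PseudoMetricSpace β]
    (f : α → β) (S : Set α) : ℝ :=
  sInf {K : ℝ | 0 ≤ K ∧ ∀ x ∈ S, ∀ y ∈ S, dist (f x) (f y) ≤ K * dist x y}

/-- Assumptions on the domain and the sampling density. -/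
structure DataAssumption {d : ℕ} (Ω : Set (Eucl d)) (ρ : Eucl d → ℝ) : Prop where
  isOpen : IsOpen Ω
  isBounded : Bornology.IsBounded Ω
  lipschitzBoundary : HasLipschitzBoundary Ω
  lipschitz : ∃ L : ℝ≥0, LipschitzOnWith L ρ Ω
  bounds : ∃ ρmin ρmax : ℝ, 0 < ρmin ∧ ∀ x ∈ Ω, ρmin ≤ ρ x ∧ ρ x ≤ ρmax
  unit_mass : ∫ x in Ω, ρ x = 1

/-- Assumptions on the kernel profile `η : [0,∞) → [0,∞)` (only values on `[0,∞)` matter). -/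
structure KernelAssumption (d : ℕ) (η : ℝ → ℝ) : Prop where
  nonneg : ∀ t, 0 ≤ t → 0 ≤ η t
  antitone : AntitoneOn η (Set.Ici 0)
  pos_zero : 0 < η 0
  unit_mass : ∫ z : Eucl d, η ‖z‖ = 1
  moments : ∀ k : ℕ, 1 ≤ k → k ≤ 4 → Integrable (fun z : Eucl d => η ‖z‖ * ‖z‖ ^ k)

/-- Assumptions on the local bandwidth function `σ`. -/
structure BandwidthAssumption {d : ℕ} (Ω : Set (Eucl d)) (σ : Eucl d → ℝ) (σmin σmax : ℝ) :
    Prop where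
  continuousOn : ContinuousOn σ Ω
  min_pos : 0 < σmin
  bounds : ∀ x ∈ Ω, σmin ≤ σ x ∧ σ x ≤ σmax

/-- `T` is differentiable on the (open) set `Ω`, and both `T` and `DT` are Lipschitz on `Ω`. -/
structure LipschitzEmbedding {d m : ℕ} (Ω : Set (Eucl d)) (T : Eucl d → Eucl m) : Prop where
  differentiableAt : ∀ x ∈ Ω, DifferentiableAt ℝ T x
  lipschitz : ∃ K : ℝ≥0, LipschitzOnWith K T Ω
  lipschitz_fderiv : ∃ K : ℝ≥0, LipschitzOnWith K (fderiv ℝ T) Ω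

/-- The measure `ρ dx` on `Ω`. -/
def dataMeasure {d : ℕ} (Ω : Set (Eucl d)) (ρ : Eucl d → ℝ) : Measure (Eucl d) :=
  (volume.restrict Ω).withDensity fun x => ENNReal.ofReal (ρ x)

/-- The measure `η(|z|) dz` on `ℝ^d`. -/
def kernelMeasure (d : ℕ) (η : ℝ → ℝ) : Measure (Eucl d) :=
  volume.withDensity fun z => ENNReal.ofReal (η ‖z‖)

/-- The rescaled kernel `η_b(t) = b^{-d} η(t / b)`. -/
def scaledKernel (d : ℕ) (η : ℝ → ℝ) (b t : ℝ) : ℝ := (b ^ d)⁻¹ * η (t / b)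

/-- The degree `d_i = ∑_j η_{h_i}(|x_i - x_j|)`, with `h_i = σ(x_i) h`. -/
def degree {d n : ℕ} (η : ℝ → ℝ) (σ : Eucl d → ℝ) (h : ℝ) (x : Fin n → Eucl d) (i : Fin n) : ℝ :=
  ∑ j, scaledKernel d η (σ (x i) * h) ‖x i - x j‖

/-- The rescaled discrete attraction `𝒜_n[T]` at the sample `x_1, …, x_n`. -/
def discreteAttraction {d m n : ℕ} (η : ℝ → ℝ) (σ : Eucl d → ℝ) (h : ℝ) (T : Eucl d → Eucl m)
    (x : Fin n → Eucl d) : ℝ :=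
  (1 / (n : ℝ)) * ∑ i, (1 / degree η σ h x i) *
    ∑ j, scaledKernel d η (σ (x i) * h) ‖x i - x j‖ *
      Real.log (1 + (h ^ 2)⁻¹ * ‖T (x i) - T (x j)‖ ^ 2)

/-- The kernel tail `γ(r) = ∫_{|z| ≥ r} η(|z|) dz`. -/
def kernelTail (d : ℕ) (η : ℝ → ℝ) (r : ℝ) : ℝ :=
  ∫ z in {z : Eucl d | r ≤ ‖z‖}, η ‖z‖

/-- The extended-real-valued integral `∫ f⁺ dμ - ∫ f⁻ dμ`. In the uses below the integral of the
positive part is finite, so that no expression `∞ - ∞` occurs. -/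
def eintegral {α : Type*} [MeasurableSpace α] (μ : Measure α) (f : α → EReal) : EReal :=
  ((∫⁻ x, (f x).toENNReal ∂μ : ℝ≥0∞) : EReal) - ((∫⁻ x, (-f x).toENNReal ∂μ : ℝ≥0∞) : EReal)

/-- `Φ_s(A) = ∫ η(|z|) log(s^{-2} + |A z|^2) dz` for `s ∈ (0,∞]`, where `s^{-2} = 0` if `s = ∞`
and `log 0 = -∞`; in particular `Φ_∞(0) = -∞`. -/
def Phi {d m : ℕ} (η : ℝ → ℝ) (s : ℝ≥0∞) (A : Eucl d →L[ℝ] Eucl m) : EReal :=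
  eintegral (kernelMeasure d η) fun z => ENNReal.log (s⁻¹ ^ 2 + ‖A z‖ₑ ^ 2)

/-- The continuum attraction `𝒜[T; Φ_s] = ∫_Ω Φ_s(σ DT) ρ dx ∈ [-∞, ∞]`. -/
def continuumAttraction {d m : ℕ} (Ω : Set (Eucl d)) (ρ : Eucl d → ℝ) (η : ℝ → ℝ)
    (σ : Eucl d → ℝ) (s : ℝ≥0∞) (T : Eucl d → Eucl m) : EReal :=
  eintegral (dataMeasure Ω ρ) fun x => Phi η s (σ x • fderiv ℝ T x)

/-- The error `λ / √(n h^d) + γ(r / (h σmax)) + r`. -/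
def attractionError (d : ℕ) (η : ℝ → ℝ) (σmax : ℝ) (n : ℕ) (h r lam : ℝ) : ℝ :=
  lam / Real.sqrt (n * h ^ d) + kernelTail d η (r / (h * σmax)) + r

/-- The conditions on length scales `h_n`, radii `r_n` and scaling factors `s_n → s` in the
scaling limit. -/
structure AdmissibleScaling (d : ℕ) (η : ℝ → ℝ) (σmax : ℝ) (h r sc : ℕ → ℝ) (s : ℝ≥0∞) :
    Prop where
  h_pos : ∀ n, 0 < h n
  sc_pos : ∀ n, 0 < sc n
  h_tendsto : Tendsto h atTop (𝓝 0)
  r_tendsto : Tendsto r atTop (𝓝 0)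
  sample_size : Tendsto (fun n : ℕ => n * h n ^ d / Real.log n) atTop atTop
  ratio : Tendsto (fun n => r n / h n) atTop atTop
  sc_tendsto : Tendsto (fun n => ENNReal.ofReal (sc n)) atTop (𝓝 s)
  error_tendsto : Tendsto
    (fun n : ℕ => sc n ^ 2 * attractionError d η σmax n (h n) (r n) (Real.sqrt (Real.log n)))
    atTop (𝓝 0)

end TSNE

end

/-!
As `log (1 + u) ≤ u`, all quantities are controlled by `s² (Lip T² + Lip DT²)`, and both sides of
the estimate may be rewritten in microscopic coordinates `x_j = x_i + σ(x_i) h z`. After changing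
`η`, `σ`, `ρ` and `T` outside the sets that matter, so that they are measurable and bounded, the
error splits into a stochastic and a deterministic part.

The discrete attraction is an average of ratios `U_i / W_i` of sums over the sample. Conditionally
on `x_i`, numerator and denominator are sums of independent terms
(`measure_abs_sum_succAbove_gt_le`), whose variance is of order `h⁻ᵈ` by the fourth moment of `η`,
and Bernstein's inequality gives the error `λ / √(n hᵈ)`; see `ratio_concentration` and
`exists_discreteAttraction_concentration`. The denominators stay away from zero because `Ω` satisfies
an interior ball condition (`exists_ball_subset`, `exists_le_integral_density`).

The bias is of order `h` at points farther than `h σ_max |z|` from the boundary, by a first-order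
Taylor expansion. Nearer to the boundary it is only of order one, but the boundary layer has volume
`O(h |z|)`, since a layer over a Lipschitz graph has many disjoint translates in a fixed ball
(`volume_graph_layer_le`, `exists_volume_boundaryLayer_le`). Integrating over `x` before `z`
therefore gives a total bias `O(h)` (`exists_integral_biasWeight_le`, `exists_bias_le`), which is
at most the required `γ(r / (h σ_max)) + r` because `h ≤ r`.

The almost sure limit follows from the Borel–Cantelli lemma with `λ² = 3 log n`
(`ae_tendsto_of_concentration`) and from continuity of `s ↦ 𝒜[T; Φ_s]` on `(0, ∞]`: this function is
nonincreasing while `𝒜[T; Φ_s] + 2 log s` is nondecreasing, which gives continuity at finite `s`,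
and at `s = ∞` monotone convergence applies (`tendsto_continuumAttraction`). When `s = ∞` the scalings
`h_n = 1 / log (n + 3)` and `r_n = √h_n`, with `s_n` a small negative power of the error, are
admissible.
-/

namespace TSNE

/-! ### Concentration for sums and ratios over an i.i.d. sample -/

section Concentration

variable {α : Type*} [MeasurableSpace α] {μ : Measure α} [IsProbabilityMeasure μ]

/-- The moment generating function of a centred bounded variable is at most `exp (θ² V)` as soon
as `θ` times the range is at most one; this is the second-order form that Bernstein's inequality
needs, with the second moment `V` in place of the range. -/
lemma integral_exp_centered_le {f : α → ℝ} (hf : Measurable f) {M V θ : ℝ}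
    (hM : ∀ᵐ x ∂μ, |f x| ≤ M) (hV : ∫ x, f x ^ 2 ∂μ ≤ V) (hθ : |θ| * (2 * M) ≤ 1) :
    Integrable (fun x => Real.exp (θ * (f x - ∫ y, f y ∂μ))) μ ∧
    ∫ x, Real.exp (θ * (f x - ∫ y, f y ∂μ)) ∂μ ≤ Real.exp (θ ^ 2 * V) := by
  set m := ∫ y, f y ∂μ with hm
  have hfi : Integrable f μ := Integrable.of_bound hf.aestronglyMeasurable M
    (by simpa [Real.norm_eq_abs] using hM)
  have hf2 : Integrable (fun x => f x ^ 2) μ := by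
    refine Integrable.of_bound (hf.pow_const 2).aestronglyMeasurable (M ^ 2) ?_
    filter_upwards [hM] with x hx
    rw [Real.norm_eq_abs, abs_pow]
    exact pow_le_pow_left₀ (abs_nonneg _) hx 2
  have hmM : |m| ≤ M := by
    have := norm_integral_le_of_norm_le_const (μ := μ) (f := f) (C := M)
      (by simpa [Real.norm_eq_abs] using hM)
    simpa [Real.norm_eq_abs] using this
  have hu : ∀ᵐ x ∂μ, |θ * (f x - m)| ≤ 1 := by
    filter_upwards [hM] with x hx
    rw [abs_mul]
    refine le_trans (mul_le_mul_of_nonneg_left ?_ (abs_nonneg θ)) hθ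
    calc |f x - m| ≤ |f x| + |m| := abs_sub _ _
      _ ≤ 2 * M := by linarith
  have hint : Integrable (fun x => Real.exp (θ * (f x - m))) μ := by
    refine Integrable.of_bound
      (Real.measurable_exp.comp ((hf.sub_const m).const_mul θ)).aestronglyMeasurable
      (Real.exp 1) ?_
    filter_upwards [hu] with x hx
    rw [Real.norm_eq_abs, abs_of_pos (Real.exp_pos _)]
    exact Real.exp_le_exp.2 (le_trans (le_abs_self _) hx)
  refine ⟨hint, ?_⟩
  have hbd : ∀ᵐ x ∂μ, Real.exp (θ * (f x - m))
      ≤ 1 + θ * (f x - m) + θ ^ 2 * (f x ^ 2 - 2 * m * f x + m ^ 2) := by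
    filter_upwards [hu] with x hx
    have := (abs_le.1 (Real.abs_exp_sub_one_sub_id_le hx)).2
    nlinarith
  have i1 : Integrable (fun x => θ * (f x - m)) μ :=
    (hfi.sub (integrable_const m)).const_mul θ
  have i2 : Integrable (fun x => θ ^ 2 * (f x ^ 2 - 2 * m * f x + m ^ 2)) μ :=
    ((hf2.sub (hfi.const_mul (2 * m))).add (integrable_const (m ^ 2))).const_mul _
  have i4 : Integrable (fun x => f x ^ 2 - 2 * m * f x) μ := hf2.sub (hfi.const_mul (2 * m))
  have i3 : Integrable (fun x => 1 + θ * (f x - m)) μ := (integrable_const 1).add i1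
  have := integral_mono_ae hint (i3.add i2) hbd
  have e1 : ∫ x, (1 + θ * (f x - m) + θ ^ 2 * (f x ^ 2 - 2 * m * f x + m ^ 2)) ∂μ
      = 1 + θ ^ 2 * (∫ x, f x ^ 2 ∂μ - m ^ 2) := by
    rw [integral_add i3 i2, integral_add (integrable_const 1) i1, integral_const_mul,
      integral_const_mul, integral_sub hfi (integrable_const m),
      integral_add i4 (integrable_const _),
      integral_sub hf2 (hfi.const_mul (2 * m)), integral_const_mul]
    simp only [integral_const, probReal_univ, smul_eq_mul, one_mul, ← hm]
    ring
  refine this.trans (le_of_eq_of_le e1 ?_)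
  have h3 : θ ^ 2 * (∫ x, f x ^ 2 ∂μ - m ^ 2) ≤ θ ^ 2 * V :=
    mul_le_mul_of_nonneg_left (by nlinarith [sq_nonneg m]) (sq_nonneg _)
  linarith [Real.add_one_le_exp (θ ^ 2 * V)]

/-- One-sided Bernstein inequality for an i.i.d. sample. -/
lemma measure_sum_gt_le {f : α → ℝ} (hf : Measurable f) {M V t : ℝ}
    (hM : ∀ᵐ x ∂μ, |f x| ≤ M) (hV : ∫ x, f x ^ 2 ∂μ ≤ V) (hV0 : 0 < V) (ht : 0 ≤ t)
    (htM : t * M ≤ V) (k : ℕ) :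
    (Measure.pi fun _ : Fin k => μ).real {x | t * k ≤ ∑ j, (f (x j) - ∫ y, f y ∂μ)}
      ≤ Real.exp (-(k * t ^ 2 / (4 * V))) := by
  set m := ∫ y, f y ∂μ with hm
  set θ := t / (2 * V) with hθ
  have hθ0 : 0 ≤ θ := by positivity
  have hθM : |θ| * (2 * M) ≤ 1 := by
    rw [abs_of_nonneg hθ0, hθ, div_mul_eq_mul_div, div_le_one (by positivity)]
    linarith
  obtain ⟨hint, hle⟩ := integral_exp_centered_le hf hM hV hθM
  have hexp : ∀ x : Fin k → α, Real.exp (θ * ∑ j, (f (x j) - m))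
      = ∏ j, Real.exp (θ * (f (x j) - m)) := by
    intro x
    rw [← Real.exp_sum, Finset.mul_sum]
  have h1 := measure_ge_le_exp_mul_mgf (μ := Measure.pi fun _ : Fin k => μ)
    (X := fun x => ∑ j, (f (x j) - m)) (t * k) hθ0 (by
      simp_rw [hexp]
      exact Integrable.fintype_prod (fun _ => hint))
  refine h1.trans ?_
  have h2 : mgf (fun x : Fin k → α => ∑ j, (f (x j) - m)) (Measure.pi fun _ : Fin k => μ) θ
      = (∫ x, Real.exp (θ * (f x - m)) ∂μ) ^ k := by
    unfold mgf
    simp_rw [hexp]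
    rw [integral_fintype_prod_eq_pow (fun x => Real.exp (θ * (f x - m)))]
    simp
  rw [h2]
  calc Real.exp (-θ * (t * k)) * (∫ x, Real.exp (θ * (f x - m)) ∂μ) ^ k
      ≤ Real.exp (-θ * (t * k)) * Real.exp (θ ^ 2 * V) ^ k := by
        gcongr
    _ = Real.exp (-(k * t ^ 2 / (4 * V))) := by
        rw [← Real.exp_nat_mul, ← Real.exp_add]
        congr 1
        rw [hθ]
        field_simp
        ring

/-- Two-sided Bernstein inequality for an i.i.d. sample, with a free scale `κ ≥ 0` that is
allowed to vanish. -/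
lemma measure_abs_sum_gt_le {f : α → ℝ} (hf : Measurable f) {κ M V t : ℝ} (hκ : 0 ≤ κ)
    (hM : ∀ᵐ x ∂μ, |f x| ≤ κ * M) (hV : ∫ x, f x ^ 2 ∂μ ≤ κ ^ 2 * V) (hV0 : 0 < V) (ht : 0 ≤ t)
    (htM : t * M ≤ V) (k : ℕ) :
    (Measure.pi fun _ : Fin k => μ) {x | κ * (t * k) < |∑ j, f (x j) - k * ∫ y, f y ∂μ|}
      ≤ ENNReal.ofReal (2 * Real.exp (-(k * t ^ 2 / (4 * V)))) := by
  rcases hκ.eq_or_lt with rfl | hκ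
  · have h0 : ∀ᵐ x ∂μ, f x = 0 := by
      filter_upwards [hM] with x hx
      simpa using hx
    have h1 : ∀ᵐ x ∂(Measure.pi fun _ : Fin k => μ), ∀ j, f (x j) = 0 := by
      rw [ae_all_iff]
      intro j
      exact (measurePreserving_eval (fun _ : Fin k => μ) j).quasiMeasurePreserving.ae h0
    have h2 : ∫ y, f y ∂μ = 0 := by
      rw [integral_congr_ae h0]; simp
    refine le_trans (le_of_eq ?_) zero_le
    rw [← nonpos_iff_eq_zero, ← ae_iff.1 h1]
    refine measure_mono fun x hx => ?_
    simp only [Set.mem_ofPred_eq, zero_mul, h2, mul_zero, sub_zero, abs_pos] at hx ⊢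
    intro h
    simp [h] at hx
  · have key : ∀ ε : ℝ, |ε| = 1 →
        (Measure.pi fun _ : Fin k => μ).real
          {x | t * k ≤ ∑ j, (ε / κ * f (x j) - ∫ y, ε / κ * f y ∂μ)}
          ≤ Real.exp (-(k * t ^ 2 / (4 * V))) := by
      intro ε hε
      refine measure_sum_gt_le (f := fun x => ε / κ * f x) (hf.const_mul _) (M := M) ?_ ?_ hV0 ht
        htM k
      · filter_upwards [hM] with x hx
        rw [abs_mul, abs_div, hε, abs_of_pos hκ, div_mul_eq_mul_div, div_le_iff₀ hκ]
        linarith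
      · have h2 : ε ^ 2 = 1 := by rw [← sq_abs, hε]; norm_num
        simp_rw [mul_pow, div_pow, h2]
        rw [integral_const_mul, one_div, inv_mul_le_iff₀ (by positivity)]
        exact hV
    have hsub : {x : Fin k → α | κ * (t * k) < |∑ j, f (x j) - k * ∫ y, f y ∂μ|} ⊆
        {x | t * k ≤ ∑ j, (1 / κ * f (x j) - ∫ y, 1 / κ * f y ∂μ)} ∪
        {x | t * k ≤ ∑ j, (-1 / κ * f (x j) - ∫ y, -1 / κ * f y ∂μ)} := by
      intro x hx
      have e : ∀ ε : ℝ, ∑ j, (ε / κ * f (x j) - ∫ y, ε / κ * f y ∂μ)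
          = ε / κ * (∑ j, f (x j) - k * ∫ y, f y ∂μ) := by
        intro ε
        rw [integral_const_mul, Finset.sum_sub_distrib, ← Finset.mul_sum]
        simp
        ring
      simp only [Set.mem_ofPred_eq, Set.mem_union, e] at hx ⊢
      rcases lt_abs.1 hx with h | h
      · left
        rw [div_mul_eq_mul_div, le_div_iff₀ hκ]
        linarith
      · right
        rw [div_mul_eq_mul_div, le_div_iff₀ hκ]
        linarith
    refine (measure_mono hsub).trans ((measure_union_le _ _).trans ?_)
    have a1 := key 1 (by simp)
    have a2 := key (-1) (by simp)
    rw [two_mul, ENNReal.ofReal_add (Real.exp_pos _).le (Real.exp_pos _).le]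
    refine add_le_add ?_ ?_
    · rw [← ofReal_measureReal]; exact ENNReal.ofReal_le_ofReal a1
    · rw [← ofReal_measureReal]; exact ENNReal.ofReal_le_ofReal a2

/-- Bernstein's inequality conditionally on the `i`-th sample point: the summands may depend on
`x i`, and the sum runs over the other, independent, points. -/
lemma measure_abs_sum_succAbove_gt_le {f : α → α → ℝ} (hf : Measurable (Function.uncurry f))
    {κ M V t : ℝ} (hκ : 0 ≤ κ)
    (hM : ∀ᵐ x ∂μ, ∀ᵐ y ∂μ, |f x y| ≤ κ * M) (hV : ∀ᵐ x ∂μ, ∫ y, f x y ^ 2 ∂μ ≤ κ ^ 2 * V)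
    (hV0 : 0 < V) (ht : 0 ≤ t) (htM : t * M ≤ V) (k : ℕ) (i : Fin (k + 1)) :
    (Measure.pi fun _ : Fin (k + 1) => μ)
      {x | κ * (t * k) < |∑ j : Fin k, f (x i) (x (i.succAbove j)) - k * ∫ y, f (x i) y ∂μ|}
      ≤ ENNReal.ofReal (2 * Real.exp (-(k * t ^ 2 / (4 * V)))) := by
  have hmp := measurePreserving_piFinSuccAbove (fun _ : Fin (k + 1) => μ) i
  set B : Set (α × (Fin k → α)) :=
    {p | κ * (t * k) < |∑ j : Fin k, f p.1 (p.2 j) - k * ∫ y, f p.1 y ∂μ|} with hB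
  have hint : Measurable fun x => ∫ y, f x y ∂μ :=
    (hf.stronglyMeasurable.integral_prod_right (ν := μ)).measurable
  have hBm : MeasurableSet B := by
    refine measurableSet_lt measurable_const ?_
    refine (measurable_norm (α := ℝ)).comp (f := fun p : α × (Fin k → α) =>
      ∑ j : Fin k, f p.1 (p.2 j) - k * ∫ y, f p.1 y ∂μ) ?_
    refine (Finset.measurable_sum _ fun j _ => ?_).sub
      ((hint.comp measurable_fst).const_mul _)
    exact hf.comp (measurable_fst.prodMk ((measurable_pi_apply j).comp measurable_snd))
  have e : {x : Fin (k + 1) → α | κ * (t * k) <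
      |∑ j : Fin k, f (x i) (x (i.succAbove j)) - k * ∫ y, f (x i) y ∂μ|}
      = MeasurableEquiv.piFinSuccAbove (fun _ => α) i ⁻¹' B := by
    ext x
    rfl
  rw [e, hmp.measure_preimage hBm.nullMeasurableSet, Measure.prod_apply hBm]
  calc _ ≤ ∫⁻ _, ENNReal.ofReal (2 * Real.exp (-(k * t ^ 2 / (4 * V)))) ∂μ := by
        refine lintegral_mono_ae ?_
        filter_upwards [hM, hV] with x hx1 hx2
        exact measure_abs_sum_gt_le (f := f x) (hf.comp measurable_prodMk_left) hκ hx1 hx2 hV0 ht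
          htM k
    _ = _ := by simp

/-- Stability of a quotient `U / W` around `N / D`, where `U ≈ k N` and `W ≈ k D`. -/
lemma abs_div_sub_div_le {U W N D k t κ A c₀ : ℝ} (hc₀ : 0 < c₀) (hk : 0 < k) (hκ : 0 ≤ κ)
    (hA : 0 ≤ A)
    (hD : c₀ ≤ D) (hN0 : 0 ≤ N) (hN : N ≤ κ * A) (hU : |U - k * N| ≤ κ * (t * k))
    (hWlow : k * (c₀ / 2) ≤ W) (hW : |W - k * D| ≤ (1 + 2 * A) * (t * k)) :
    |U / W - N / D| ≤ κ * t * (2 / c₀ * (1 + A * (1 + 2 * A) / c₀)) := by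
  have hD0 : 0 < D := hc₀.trans_le hD
  have hW0 : 0 < W := lt_of_lt_of_le (by positivity) hWlow
  have ht : 0 ≤ (1 + 2 * A) * (t * k) := (abs_nonneg _).trans hW
  have ht0 : 0 ≤ t := by
    have h1 : 0 ≤ t * k := nonneg_of_mul_nonneg_right ht (by linarith)
    exact nonneg_of_mul_nonneg_left h1 hk
  have e : U / W - N / D = ((U - k * N) - (W - k * D) * (N / D)) / W := by
    field_simp
    ring
  have hND : N / D ≤ κ * A / c₀ := div_le_div₀ (by positivity) hN hc₀ hD
  have hND0 : 0 ≤ N / D := by positivity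
  rw [e, abs_div, abs_of_pos hW0, div_le_iff₀ hW0]
  calc |(U - k * N) - (W - k * D) * (N / D)|
      ≤ |U - k * N| + |W - k * D| * (N / D) := by
        refine (abs_sub _ _).trans ?_
        rw [abs_mul, abs_of_nonneg hND0]
    _ ≤ κ * (t * k) + (1 + 2 * A) * (t * k) * (κ * A / c₀) := by gcongr
    _ = κ * t * (2 / c₀ * (1 + A * (1 + 2 * A) / c₀)) * (k * (c₀ / 2)) := by
        field_simp
    _ ≤ _ := by gcongr

/-- `abs_div_sub_div_le` for a denominator that splits into a diagonal term `w₀` of lower order and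
a sum `W` close to `k D`. -/
lemma abs_div_add_sub_div_le {U W w₀ N D k t κ A c₀ : ℝ} (hc₀ : 0 < c₀) (hk : 0 < k) (hκ : 0 ≤ κ)
    (hA : 0 ≤ A) (hD : c₀ ≤ D) (hN0 : 0 ≤ N) (hN : N ≤ κ * A) (hU : |U - k * N| ≤ κ * (t * k))
    (hw0 : 0 ≤ w₀) (hw : w₀ ≤ 2 * A * (t * k)) (htc : t ≤ c₀ / 2) (hW : |W - k * D| ≤ t * k) :
    |U / (w₀ + W) - N / D| ≤ κ * t * (2 / c₀ * (1 + A * (1 + 2 * A) / c₀)) := by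
  obtain ⟨h1, h2⟩ := abs_le.1 hW
  refine abs_div_sub_div_le hc₀ hk hκ hA hD hN0 hN hU ?_ ?_
  · have h3 : t * k ≤ c₀ / 2 * k := mul_le_mul_of_nonneg_right htc hk.le
    have h4 : c₀ * k ≤ D * k := mul_le_mul_of_nonneg_right hD hk.le
    linarith
  · rw [abs_le]
    constructor <;> linarith

/-- Replacing `2n + 1` events of probability `2 exp(-2λ²)` by one bound `3 n exp(-λ²)`, which is
possible whenever the latter is below one. -/
lemma union_prob_le {n : ℕ} (hn : 2 ≤ n) {lam : ℝ} (h : 3 * n * Real.exp (-lam ^ 2) < 1) :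
    n * (2 * Real.exp (-(2 * lam ^ 2)) + 2 * Real.exp (-(2 * lam ^ 2)))
      + 2 * Real.exp (-(2 * lam ^ 2)) ≤ 3 * n * Real.exp (-lam ^ 2) := by
  have e : Real.exp (-(2 * lam ^ 2)) = Real.exp (-lam ^ 2) * Real.exp (-lam ^ 2) := by
    rw [← Real.exp_add]; ring_nf
  rw [e]
  set q := Real.exp (-lam ^ 2)
  have hq : 0 < q := Real.exp_pos _
  have hn' : (2 : ℝ) ≤ n := by exact_mod_cast hn
  have h2 : n * q ≤ 1 / 3 := by linarith
  nlinarith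

/-- **Concentration of averaged ratios.** If `W_i = ∑_j w(x_i, x_j)` and `U_i = ∑_j u(x_i, x_j)`
over an i.i.d. sample, then `n⁻¹ ∑ U_i / W_i` is close to `∫ N / D`, where `D` and `N` are the
partial integrals of `w` and `u`. The size `H` of the kernels plays the role of `h⁻ᵈ`, and `κ` is
the scale of `u`. -/
theorem ratio_concentration {A c₀ : ℝ} (hA : 1 ≤ A) (hc₀ : 0 < c₀) :
    ∃ C c : ℝ, 1 ≤ C ∧ 0 < c ∧ c ≤ 1 ∧
    ∀ {α : Type*} [MeasurableSpace α] (μ : Measure α) [IsProbabilityMeasure μ]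
      (w u : α → α → ℝ) (κ H lam : ℝ) (n : ℕ),
      Measurable (Function.uncurry w) → Measurable (Function.uncurry u) → 0 ≤ κ → 1 ≤ H →
      2 ≤ n → 0 ≤ lam → H ≤ n → lam ^ 2 * H ≤ c * n →
      (∀ x, u x x = 0) →
      (∀ᵐ x ∂μ, 0 ≤ w x x ∧ w x x ≤ A * H) →
      (∀ᵐ x ∂μ, ∀ᵐ y ∂μ, |w x y| ≤ A * H) →
      (∀ᵐ x ∂μ, ∫ y, w x y ^ 2 ∂μ ≤ A * H) →
      (∀ᵐ x ∂μ, ∀ᵐ y ∂μ, |u x y| ≤ κ * (A * H)) →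
      (∀ᵐ x ∂μ, ∫ y, u x y ^ 2 ∂μ ≤ κ ^ 2 * (A * H)) →
      (∀ᵐ x ∂μ, c₀ ≤ ∫ y, w x y ∂μ) →
      (∀ᵐ x ∂μ, 0 ≤ ∫ y, u x y ∂μ ∧ ∫ y, u x y ∂μ ≤ κ * A) →
      (Measure.pi fun _ : Fin n => μ) {x | C * κ * (lam * Real.sqrt (H / n)) <
          |1 / (n : ℝ) * ∑ i, (∑ j, u (x i) (x j)) / (∑ j, w (x i) (x j))
            - ∫ x, (∫ y, u x y ∂μ) / (∫ y, w x y ∂μ) ∂μ|}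
        ≤ ENNReal.ofReal (3 * n * Real.exp (-lam ^ 2)) := by
  -- `A'` bounds the limiting ratio; `K` makes every Bernstein exponent at least `2 λ²`.
  set A' := 1 + A / c₀ with hA'
  have hA'1 : 1 ≤ A' := by
    have : 0 ≤ A / c₀ := by positivity
    linarith
  set K := 4 * A + 4 * A' with hK
  have hK1 : 1 ≤ K := by linarith
  have hK16 : 16 * A ≤ K ^ 2 := by nlinarith
  have hK8 : 8 * A' ^ 2 ≤ K ^ 2 := by nlinarith
  set C₁ := 2 / c₀ * (1 + A * (1 + 2 * A) / c₀) with hC₁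
  have hC₁0 : 0 < C₁ := by positivity
  set m := min (1 / 2) (c₀ / 2) with hm
  have hm0 : 0 < m := by positivity
  refine ⟨1 + K * (C₁ + 1), min 1 ((m / K) ^ 2), ?_, by positivity, min_le_left _ _, ?_⟩
  · have : 0 ≤ K * (C₁ + 1) := by positivity
    linarith
  intro α _ μ _ w u κ H lam n hw hu hκ hH hn hlam hHn hsmall hdiag hwd hwM hwV huM huV hD hN
  rcases le_or_gt 1 (3 * n * Real.exp (-lam ^ 2)) with htriv | hprob
  · refine prob_le_one.trans ?_
    rw [← ENNReal.ofReal_one]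
    exact ENNReal.ofReal_le_ofReal htriv
  have hn' : (2 : ℝ) ≤ n := by exact_mod_cast hn
  have hn0 : (0 : ℝ) < n := by linarith
  have hlam1 : 1 ≤ lam := by
    by_contra hlt
    push Not at hlt
    have h1 : -1 ≤ -lam ^ 2 := neg_le_neg (pow_le_one₀ hlam hlt.le)
    have h2 : Real.exp (-1) ≤ Real.exp (-lam ^ 2) := Real.exp_le_exp.2 h1
    have h3 := Real.exp_neg_one_gt_d9
    have h4 : 3 * 2 * Real.exp (-1) ≤ 3 * n * Real.exp (-lam ^ 2) := by gcongr
    linarith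
  set δ := Real.sqrt (H / n) with hδ
  have hδ0 : 0 ≤ δ := Real.sqrt_nonneg _
  have hδ2 : δ ^ 2 = H / n := Real.sq_sqrt (by positivity)
  have hδ1 : δ ≤ 1 := by
    exact Real.sqrt_le_one.2 ((div_le_one hn0).2 hHn)
  set t := K * (lam * δ) with ht
  have ht0 : 0 ≤ t := by positivity
  have hlδ : lam * δ ≤ m / K := by
    refine (sq_le_sq₀ (by positivity) (by positivity)).1 ?_
    rw [mul_pow, hδ2, mul_div_assoc', div_le_iff₀ hn0]
    refine hsmall.trans ?_
    gcongr
    exact min_le_right _ _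
  have htm : t ≤ m := by
    have := mul_le_mul_of_nonneg_left hlδ (by linarith : 0 ≤ K)
    rwa [mul_div_cancel₀ _ (by linarith : K ≠ 0)] at this
  have ht1 : t ≤ 1 := htm.trans ((min_le_left _ _).trans (by norm_num))
  have htc : t ≤ c₀ / 2 := htm.trans (min_le_right _ _)
  obtain ⟨k, rfl⟩ : ∃ k, n = k + 1 := ⟨n - 1, by omega⟩
  have hk1 : 1 ≤ k := by omega
  have hk : (1 : ℝ) ≤ k := by exact_mod_cast hk1
  have hnk : ((k + 1 : ℕ) : ℝ) ≤ 2 * k := by push_cast; linarith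
  set D := fun x => ∫ y, w x y ∂μ with hDdef
  set N := fun x => ∫ y, u x y ∂μ with hNdef
  have hDm : Measurable D := (hw.stronglyMeasurable.integral_prod_right (ν := μ)).measurable
  have hNm : Measurable N := (hu.stronglyMeasurable.integral_prod_right (ν := μ)).measurable
  have hRm : Measurable fun x => N x / D x := hNm.div hDm
  have hAH : 0 < A * H := by positivity
  -- the choice of `K` makes each Bernstein exponent at least `2 λ²`
  have ex1 : 2 * lam ^ 2 ≤ k * t ^ 2 / (4 * (A * H)) := by
    rw [le_div_iff₀ (by positivity), ht, mul_pow, mul_pow, hδ2]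
    have h2 : (1 : ℝ) / 2 ≤ k / ((k + 1 : ℕ) : ℝ) := by
      rw [div_le_div_iff₀ (by norm_num) hn0]; linarith
    calc 2 * lam ^ 2 * (4 * (A * H)) = (1 / 2) * (16 * A) * (lam ^ 2 * H) := by ring
      _ ≤ (k / ((k + 1 : ℕ) : ℝ)) * K ^ 2 * (lam ^ 2 * H) := by gcongr
      _ = _ := by ring
  have ex2 : 2 * lam ^ 2 ≤ ((k + 1 : ℕ) : ℝ) * t ^ 2 / (4 * A' ^ 2) := by
    rw [le_div_iff₀ (by positivity), ht, mul_pow, mul_pow, hδ2]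
    calc 2 * lam ^ 2 * (4 * A' ^ 2) = 8 * A' ^ 2 * lam ^ 2 * 1 := by ring
      _ ≤ K ^ 2 * lam ^ 2 * H := by gcongr
      _ = _ := by field_simp
  set q := 2 * Real.exp (-(2 * lam ^ 2)) with hq
  have hq0 : 0 ≤ q := by positivity
  have hexpq : ∀ {a : ℝ}, 2 * lam ^ 2 ≤ a →
      ENNReal.ofReal (2 * Real.exp (-a)) ≤ ENNReal.ofReal q := by
    intro a ha
    refine ENNReal.ofReal_le_ofReal (mul_le_mul_of_nonneg_left ?_ (by norm_num))
    exact Real.exp_le_exp.2 (neg_le_neg ha)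
  -- exceptional events for denominators, numerators and the average of the limiting ratios
  set Bw : Fin (k + 1) → Set (Fin (k + 1) → α) := fun i =>
    {x | 1 * (t * k) < |∑ j : Fin k, w (x i) (x (i.succAbove j)) - k * D (x i)|} with hBw
  set Bu : Fin (k + 1) → Set (Fin (k + 1) → α) := fun i =>
    {x | κ * (t * k) < |∑ j : Fin k, u (x i) (x (i.succAbove j)) - k * N (x i)|} with hBu
  set Bo : Set (Fin (k + 1) → α) :=
    {x | κ * (t * (k + 1 : ℕ)) < |∑ i, N (x i) / D (x i)
      - (k + 1 : ℕ) * ∫ y, N y / D y ∂μ|} with hBo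
  set P := Measure.pi fun _ : Fin (k + 1) => μ with hP
  have pw : ∀ i, P (Bw i) ≤ ENNReal.ofReal q := by
    intro i
    refine (measure_abs_sum_succAbove_gt_le (κ := 1) (M := A * H) (V := A * H) hw zero_le_one
      (by simpa using hwM) (by simpa using hwV) hAH ht0 (mul_le_of_le_one_left hAH.le ht1) k i).trans (hexpq ex1)
  have pu : ∀ i, P (Bu i) ≤ ENNReal.ofReal q := by
    intro i
    refine (measure_abs_sum_succAbove_gt_le (M := A * H) (V := A * H) hu hκ
      huM huV hAH ht0 (mul_le_of_le_one_left hAH.le ht1) k i).trans (hexpq ex1)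
  have hRb : ∀ᵐ x ∂μ, |N x / D x| ≤ κ * A' := by
    filter_upwards [hD, hN] with x hx1 hx2
    have hDx : 0 < D x := hc₀.trans_le hx1
    rw [abs_of_nonneg (div_nonneg hx2.1 hDx.le)]
    calc N x / D x ≤ κ * A / c₀ := div_le_div₀ (by positivity) hx2.2 hc₀ hx1
      _ = κ * (A / c₀) := by ring
      _ ≤ κ * A' := by gcongr; linarith
  have po : P Bo ≤ ENNReal.ofReal q := by
    refine (measure_abs_sum_gt_le (M := A') (V := A' ^ 2) hRm hκ hRb ?_ (by positivity) ht0
      (by rw [sq]; gcongr; linarith) (k + 1)).trans ?_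
    · have : ∀ᵐ x ∂μ, ‖(N x / D x) ^ 2‖ ≤ κ ^ 2 * A' ^ 2 := by
        filter_upwards [hRb] with x hx
        rw [Real.norm_eq_abs, abs_pow, ← mul_pow]
        exact pow_le_pow_left₀ (abs_nonneg _) hx 2
      have h := norm_integral_le_of_norm_le_const this
      rw [probReal_univ, mul_one] at h
      exact (le_abs_self _).trans h
    · exact hexpq ex2
  have hk0 : (0 : ℝ) < k := by linarith
  have hA0 : 0 ≤ A := by linarith
  -- the diagonal term is of lower order, as `H ≤ n δ²` and `δ ≤ 1 ≤ λ`
  have hAHt : A * H ≤ 2 * A * (t * k) := by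
    have h1 : H = δ ^ 2 * (k + 1 : ℕ) := by rw [hδ2]; field_simp
    have h2 : δ ^ 2 ≤ t := by
      calc δ ^ 2 = δ * δ := sq δ
        _ ≤ 1 * δ := mul_le_mul_of_nonneg_right hδ1 hδ0
        _ = 1 * (1 * δ) := by ring
        _ ≤ K * (lam * δ) := by gcongr
    calc A * H = A * (δ ^ 2 * (k + 1 : ℕ)) := by rw [← h1]
      _ ≤ A * (t * (2 * k)) := by gcongr
      _ = _ := by ring
  have hgood : ∀ᵐ x ∂μ, (0 ≤ w x x ∧ w x x ≤ A * H) ∧ c₀ ≤ D x ∧ 0 ≤ N x ∧ N x ≤ κ * A := by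
    filter_upwards [hwd, hD, hN] with x h1 h2 h3
    exact ⟨h1, h2, h3⟩
  have hgoodP : ∀ᵐ x ∂P, ∀ i, (0 ≤ w (x i) (x i) ∧ w (x i) (x i) ≤ A * H) ∧
      c₀ ≤ D (x i) ∧ 0 ≤ N (x i) ∧ N (x i) ≤ κ * A := by
    rw [ae_all_iff]
    intro i
    exact (measurePreserving_eval (fun _ : Fin (k + 1) => μ) i).quasiMeasurePreserving.ae hgood
  have hsub : ∀ᵐ x ∂P, x ∈ {x : Fin (k + 1) → α | (1 + K * (C₁ + 1)) * κ * (lam * δ) <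
          |1 / ((k + 1 : ℕ) : ℝ) * ∑ i, (∑ j, u (x i) (x j)) / (∑ j, w (x i) (x j))
            - ∫ x, (∫ y, u x y ∂μ) / (∫ y, w x y ∂μ) ∂μ|} →
      x ∈ (⋃ i, (Bw i ∪ Bu i)) ∪ Bo := by
    filter_upwards [hgoodP] with x hx hbad
    by_contra hnot
    simp only [Set.mem_union, Set.mem_iUnion, not_or, not_exists] at hnot
    obtain ⟨hwu, ho⟩ := hnot
    have hi : ∀ i, |(∑ j, u (x i) (x j)) / (∑ j, w (x i) (x j)) - N (x i) / D (x i)|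
        ≤ κ * t * C₁ := by
      intro i
      obtain ⟨⟨hw0, hwA⟩, hDi, hNi0, hNi⟩ := hx i
      have hwi := (hwu i).1
      have hui := (hwu i).2
      simp only [hBw, hBu, Set.mem_ofPred_eq, not_lt, one_mul] at hwi hui
      have eU : ∑ j, u (x i) (x j) = ∑ j : Fin k, u (x i) (x (i.succAbove j)) := by
        rw [Fin.sum_univ_succAbove _ i, hdiag, zero_add]
      have eW : ∑ j, w (x i) (x j) = w (x i) (x i) + ∑ j : Fin k, w (x i) (x (i.succAbove j)) :=
        Fin.sum_univ_succAbove _ i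
      rw [eU, eW]
      exact abs_div_add_sub_div_le hc₀ hk0 hκ hA0 hDi hNi0 hNi hui hw0 (hwA.trans hAHt) htc hwi
    simp only [hBo, Set.mem_ofPred_eq, not_lt] at ho
    have hsum : |∑ i, (∑ j, u (x i) (x j)) / (∑ j, w (x i) (x j)) - ∑ i, N (x i) / D (x i)|
        ≤ (k + 1 : ℕ) * (κ * t * C₁) := by
      rw [← Finset.sum_sub_distrib]
      refine (Finset.abs_sum_le_sum_abs _ _).trans ?_
      refine (Finset.sum_le_sum fun i _ => hi i).trans ?_
      simp
    have hfin : |1 / ((k + 1 : ℕ) : ℝ) * ∑ i, (∑ j, u (x i) (x j)) / (∑ j, w (x i) (x j))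
            - ∫ y, N y / D y ∂μ| ≤ κ * t * (C₁ + 1) := by
      set Q := ∑ i, (∑ j, u (x i) (x j)) / (∑ j, w (x i) (x j))
      set I := ∫ y, N y / D y ∂μ
      have e : 1 / ((k + 1 : ℕ) : ℝ) * Q - I
          = ((Q - ∑ i, N (x i) / D (x i)) + (∑ i, N (x i) / D (x i) - (k + 1 : ℕ) * I))
            / (k + 1 : ℕ) := by
        field_simp
        ring
      rw [e, abs_div, abs_of_pos hn0, div_le_iff₀ hn0]
      refine (abs_add_le _ _).trans ?_
      linarith
    refine absurd hbad (not_lt.2 (hfin.trans ?_))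
    rw [ht]
    have : 0 ≤ κ * (lam * δ) := by positivity
    linarith
  refine (measure_mono_ae hsub).trans ?_
  refine (measure_union_le _ _).trans ?_
  refine le_trans ?_ (ENNReal.ofReal_le_ofReal (union_prob_le hn hprob))
  rw [ENNReal.ofReal_add (by positivity) hq0, ENNReal.ofReal_mul (by positivity),
    ENNReal.ofReal_add hq0 hq0, ENNReal.ofReal_natCast]
  refine add_le_add ?_ po
  refine (measure_iUnion_fintype_le _ _).trans ?_
  refine (Finset.sum_le_sum fun i _ => (measure_union_le _ _).trans
    (add_le_add (pw i) (pu i))).trans ?_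
  simp [mul_add]

end Concentration

/-! ### Lipschitz domains: boundary layers and interior balls -/

section Domain

variable {d : ℕ}

lemma inner_add_smul_self {e : Eucl d} (he : ‖e‖ = 1) (x : Eucl d) (t : ℝ) :
    ⟪e, x + t • e⟫ = ⟪e, x⟫ + t := by
  rw [inner_add_right, real_inner_smul_right, real_inner_self_eq_norm_sq, he]; ring

lemma orthogonal_part_add_smul {e : Eucl d} (he : ‖e‖ = 1) (x : Eucl d) (t : ℝ) :
    x + t • e - ⟪e, x + t • e⟫ • e = x - ⟪e, x⟫ • e := by
  rw [inner_add_smul_self he, add_smul]; abel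

lemma abs_inner_sub_le {e : Eucl d} (he : ‖e‖ = 1) (x y : Eucl d) :
    |⟪e, x⟫ - ⟪e, y⟫| ≤ dist x y := by
  rw [← inner_sub_right, dist_eq_norm]
  simpa [he] using abs_real_inner_le_norm e (x - y)

lemma abs_comp_orthogonal_part_sub_le {e : Eucl d} (he : ‖e‖ = 1) {g : Eucl d → ℝ} {L : ℝ≥0}
    (hg : LipschitzWith L g) (x y : Eucl d) :
    |g (x - ⟪e, x⟫ • e) - g (y - ⟪e, y⟫ • e)| ≤ 2 * L * dist x y := by
  have h1 := hg.dist_le_mul (x - ⟪e, x⟫ • e) (y - ⟪e, y⟫ • e)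
  rw [Real.dist_eq] at h1
  have h2 : dist (x - ⟪e, x⟫ • e) (y - ⟪e, y⟫ • e) ≤ 2 * dist x y := by
    have e1 : x - ⟪e, x⟫ • e - (y - ⟪e, y⟫ • e) = (x - y) - (⟪e, x⟫ - ⟪e, y⟫) • e := by
      rw [sub_smul]; abel
    rw [dist_eq_norm, e1]
    refine (norm_sub_le _ _).trans ?_
    rw [norm_smul, he, mul_one, Real.norm_eq_abs, ← dist_eq_norm]
    linarith [abs_inner_sub_le he x y]
  calc _ ≤ L * dist (x - ⟪e, x⟫ • e) (y - ⟪e, y⟫ • e) := h1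
    _ ≤ L * (2 * dist x y) := by gcongr
    _ = _ := by ring

/-- A layer of height `K` above a graph has volume `O(K)`: about `1 / K` of its translates along
the vertical direction are disjoint and fit into a fixed ball. -/
lemma volume_graph_layer_le {e : Eucl d} (he : ‖e‖ = 1) {g : Eucl d → ℝ} (hg : Continuous g)
    (p : Eucl d) (ε : ℝ) {K : ℝ} (hK0 : 0 < K) (hK1 : K ≤ 1) :
    volume {x ∈ Metric.ball p ε |
        g (x - ⟪e, x⟫ • e) < ⟪e, x⟫ ∧ ⟪e, x⟫ ≤ g (x - ⟪e, x⟫ • e) + K}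
      ≤ ENNReal.ofReal (2 * K) * volume (Metric.ball p (ε + 1)) := by
  set A := {x ∈ Metric.ball p ε |
        g (x - ⟪e, x⟫ • e) < ⟪e, x⟫ ∧ ⟪e, x⟫ ≤ g (x - ⟪e, x⟫ • e) + K} with hA
  have hc : Continuous fun x : Eucl d => g (x - ⟪e, x⟫ • e) := by fun_prop
  have hAm : MeasurableSet A := by
    refine Metric.isOpen_ball.measurableSet.inter ?_
    exact (measurableSet_lt hc.measurable (by fun_prop)).inter
      (measurableSet_le (by fun_prop) (hc.add continuous_const).measurable)
  set N := ⌊1 / K⌋₊ with hN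
  have hNK : N * K ≤ 1 := by
    have := Nat.floor_le (a := 1 / K) (by positivity)
    rwa [← hN, le_div_iff₀ hK0] at this
  have hN2 : 1 ≤ 2 * K * N := by
    have h1 := Nat.lt_floor_add_one (1 / K)
    rw [← hN, div_lt_iff₀ hK0] at h1
    have h2 : (1 : ℝ) ≤ N := by
      have : 1 ≤ N := by
        rw [hN, Nat.one_le_floor_iff, le_div_iff₀ hK0]; linarith
      exact_mod_cast this
    nlinarith
  set B : ℕ → Set (Eucl d) := fun j => (fun x => x + (-(j * K)) • e) ⁻¹' A with hB
  have hBv : ∀ j, volume (B j) = volume A := fun j => measure_preimage_add_right _ _ _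
  have hBm : ∀ j, MeasurableSet (B j) := fun j => (measurable_add_const _) hAm
  have hmem : ∀ j x, x ∈ B j → dist x p < ε + j * K ∧
      g (x - ⟪e, x⟫ • e) + j * K < ⟪e, x⟫ ∧ ⟪e, x⟫ ≤ g (x - ⟪e, x⟫ • e) + (j + 1) * K := by
    intro j x hx
    obtain ⟨h1, h2, h3⟩ : x + (-(j * K)) • e ∈ A := hx
    rw [orthogonal_part_add_smul he, inner_add_smul_self he] at h2 h3
    refine ⟨?_, by linarith, by linarith⟩
    have h4 : dist x (x + (-(j * K)) • e) = j * K := by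
      rw [dist_eq_norm]
      simp [norm_smul, he, abs_of_pos hK0]
    calc dist x p ≤ dist x (x + (-(j * K)) • e) + dist (x + (-(j * K)) • e) p :=
          dist_triangle _ _ _
      _ < ε + j * K := by rw [h4]; linarith [Metric.mem_ball.1 h1]
  have hdisj : ((Finset.range N : Finset ℕ) : Set ℕ).PairwiseDisjoint B := by
    intro i _ j _ hij
    refine Set.disjoint_left.2 fun x hxi hxj => hij ?_
    obtain ⟨_, a1, a2⟩ := hmem i x hxi
    obtain ⟨_, b1, b2⟩ := hmem j x hxj
    have h1 : (i : ℝ) < j + 1 := lt_of_mul_lt_mul_right (by linarith) hK0.le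
    have h2 : (j : ℝ) < i + 1 := lt_of_mul_lt_mul_right (by linarith) hK0.le
    have h1' : i < j + 1 := by exact_mod_cast h1
    have h2' : j < i + 1 := by exact_mod_cast h2
    omega
  have hsum : (N : ℝ≥0∞) * volume A ≤ volume (Metric.ball p (ε + 1)) := by
    have h := measure_biUnion_finset (μ := volume) hdisj fun j _ => hBm j
    simp only [hBv, Finset.sum_const, Finset.card_range, nsmul_eq_mul] at h
    rw [← h]
    refine measure_mono fun x hx => ?_
    simp only [Finset.mem_range, Set.mem_iUnion] at hx
    obtain ⟨j, hj, hxj⟩ := hx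
    have h1 := (hmem j x hxj).1
    have h2 : (j : ℝ) * K ≤ N * K := by
      have : (j : ℝ) ≤ N := by exact_mod_cast hj.le
      gcongr
    exact Metric.mem_ball.2 (by linarith)
  calc volume A = 1 * volume A := (one_mul _).symm
    _ ≤ ENNReal.ofReal (2 * K * N) * volume A := by
        gcongr
        rw [← ENNReal.ofReal_one]
        exact ENNReal.ofReal_le_ofReal hN2
    _ = ENNReal.ofReal (2 * K) * (N * volume A) := by
        rw [ENNReal.ofReal_mul (by positivity), ENNReal.ofReal_natCast, mul_assoc]
    _ ≤ _ := by gcongr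

/-- The part of `Ω` within distance `t` of its complement. -/
def boundaryLayer (Ω : Set (Eucl d)) (t : ℝ) : Set (Eucl d) := {x ∈ Ω | Metric.infDist x Ωᶜ ≤ t}

lemma ne_univ_of_isBounded (hd : 1 ≤ d) {Ω : Set (Eucl d)} (hb : Bornology.IsBounded Ω) :
    Ω ≠ Set.univ := by
  rintro rfl
  have : Nonempty (Fin d) := ⟨⟨0, hd⟩⟩
  exact NoncompactSpace.noncompact_univ (X := Eucl d)
    (Metric.isCompact_of_isClosed_isBounded isClosed_univ hb)

lemma isCompact_frontier_of_isBounded {Ω : Set (Eucl d)} (hb : Bornology.IsBounded Ω) :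
    IsCompact (frontier Ω) :=
  hb.isCompact_closure.of_isClosed_subset isClosed_frontier frontier_subset_closure

/-- The boundary layer of width `t` of a bounded Lipschitz domain has volume `O(t)`. -/
theorem exists_volume_boundaryLayer_le (hd : 1 ≤ d) {Ω : Set (Eucl d)} (ho : IsOpen Ω)
    (hb : Bornology.IsBounded Ω) (hL : HasLipschitzBoundary Ω) :
    ∃ C : ℝ, 0 ≤ C ∧ ∀ t, 0 ≤ t → volume (boundaryLayer Ω t) ≤ ENNReal.ofReal (C * t) := by
  have key : ∃ δ > (0 : ℝ), ∃ C : ℝ, 0 ≤ C ∧ ∀ t, 0 < t → t ≤ δ →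
      volume {x ∈ Ω | ∃ q ∈ frontier Ω, q ∈ frontier Ω ∧ dist x q ≤ t}
        ≤ ENNReal.ofReal (C * t) := by
    refine (isCompact_frontier_of_isBounded hb).induction_on
      (p := fun S => ∃ δ > (0 : ℝ), ∃ C : ℝ, 0 ≤ C ∧ ∀ t, 0 < t → t ≤ δ →
      volume {x ∈ Ω | ∃ q ∈ S, q ∈ frontier Ω ∧ dist x q ≤ t} ≤ ENNReal.ofReal (C * t)) ?_ ?_ ?_ ?_
    · exact ⟨1, one_pos, 0, le_rfl, fun t _ _ => by simp⟩
    · rintro S S' hSS ⟨δ, hδ, C, hC, h⟩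
      refine ⟨δ, hδ, C, hC, fun t ht htδ => (measure_mono ?_).trans (h t ht htδ)⟩
      rintro x ⟨hx, q, hq, hqx⟩
      exact ⟨hx, q, hSS hq, hqx⟩
    · rintro S S' ⟨δ, hδ, C, hC, h⟩ ⟨δ', hδ', C', hC', h'⟩
      refine ⟨min δ δ', lt_min hδ hδ', C + C', add_nonneg hC hC', fun t ht htδ => ?_⟩
      rw [add_mul, ENNReal.ofReal_add (by positivity) (by positivity)]
      refine le_trans ?_ (add_le_add (h t ht (htδ.trans (min_le_left _ _)))
        (h' t ht (htδ.trans (min_le_right _ _))))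
      refine (measure_mono ?_).trans (measure_union_le _ _)
      rintro x ⟨hx, q, hq | hq, hqx⟩
      · exact Or.inl ⟨hx, q, hq, hqx⟩
      · exact Or.inr ⟨hx, q, hq, hqx⟩
    · intro p hp
      obtain ⟨ε, hε, e, he, g, ⟨L, hg⟩, hloc⟩ := hL p hp
      refine ⟨_, mem_nhdsWithin_of_mem_nhds (Metric.ball_mem_nhds p (half_pos hε)),
        min (ε / 2) (1 / (1 + 2 * L)), by positivity,
        2 * (1 + 2 * L) * (volume (Metric.ball p (ε + 1))).toReal, by positivity, ?_⟩
      intro t ht htδ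
      have ht1 : t ≤ ε / 2 := htδ.trans (min_le_left _ _)
      have ht2 : (1 + 2 * L) * t ≤ 1 := by
        have := htδ.trans (min_le_right _ _)
        rwa [le_div_iff₀ (by positivity), mul_comm] at this
      refine (measure_mono ?_).trans ((volume_graph_layer_le he hg.continuous p ε
        (K := (1 + 2 * L) * t) (by positivity) ht2).trans (le_of_eq ?_))
      · rintro x ⟨hx, q, hq, hqf, hxq⟩
        have hqp : dist q p < ε / 2 := hq
        have hxp : x ∈ Metric.ball p ε := by
          rw [Metric.mem_ball]
          linarith [dist_triangle x q p]
        have hqp' : q ∈ Metric.ball p ε := by rw [Metric.mem_ball]; linarith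
        have hqΩ : q ∉ Ω := fun h => by
          rw [ho.frontier_eq] at hqf
          exact hqf.2 h
        have h1 := (hloc x hxp).1 hx
        have h2 := not_lt.1 (fun h => hqΩ ((hloc q hqp').2 h))
        have h3 := (abs_le.1 (abs_inner_sub_le he x q)).2
        have h4 := (abs_le.1 (abs_comp_orthogonal_part_sub_le he hg x q)).1
        have h5 : 2 * (L : ℝ) * dist x q ≤ 2 * L * t := by gcongr
        exact ⟨hxp, h1, by linarith⟩
      · have : volume (Metric.ball p (ε + 1)) ≠ ∞ := measure_ball_lt_top.ne
        rw [show 2 * (1 + 2 * (L : ℝ)) * (volume (Metric.ball p (ε + 1))).toReal * t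
          = 2 * ((1 + 2 * L) * t) * (volume (Metric.ball p (ε + 1))).toReal by ring,
          ENNReal.ofReal_mul (p := 2 * ((1 + 2 * (L : ℝ)) * t)) (by positivity),
          ENNReal.ofReal_toReal this]
  obtain ⟨δ, hδ, C, hC, h⟩ := key
  have hfin : volume Ω ≠ ∞ := hb.measure_lt_top.ne
  refine ⟨C + (volume Ω).toReal / δ, by positivity, fun t ht => ?_⟩
  have hq : ∀ x ∈ boundaryLayer Ω t, ∃ q ∈ frontier Ω, q ∈ frontier Ω ∧ dist x q ≤ t := by
    rintro x ⟨hx, hxt⟩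
    obtain ⟨q, hqf, hqd⟩ := exists_mem_frontier_infDist_compl_eq_dist hx (ne_univ_of_isBounded hd hb)
    exact ⟨q, hqf, hqf, hqd ▸ hxt⟩
  rcases ht.eq_or_lt with rfl | ht
  · have : boundaryLayer Ω (0 : ℝ) = ∅ := by
      refine Set.eq_empty_of_forall_notMem fun x hx => ?_
      obtain ⟨q, hqf, -, hqd⟩ := hq x hx
      have : x = q := dist_le_zero.1 hqd
      rw [ho.frontier_eq] at hqf
      exact hqf.2 (this ▸ hx.1)
    simp [this]
  rcases le_or_gt t δ with htδ | htδ
  · refine (measure_mono fun x hx => ?_).trans ((h t ht htδ).trans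
      (ENNReal.ofReal_le_ofReal ?_))
    · exact ⟨hx.1, hq x hx⟩
    · gcongr
      exact le_add_of_nonneg_right (by positivity)
  · refine (measure_mono fun x hx => hx.1 : volume (boundaryLayer Ω t) ≤ volume Ω).trans ?_
    refine (ENNReal.ofReal_toReal hfin).symm.le.trans ?_
    refine ENNReal.ofReal_le_ofReal ?_
    have h1 : (volume Ω).toReal ≤ (volume Ω).toReal / δ * t := by
      rw [div_mul_eq_mul_div, le_div_iff₀ hδ]
      gcongr
    nlinarith [mul_nonneg hC ht.le]

/-- Interior ball condition for bounded Lipschitz domains: at all small scales `t`, every point of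
`Ω` has a ball of radius comparable to `t` inside `Ω` within distance `t`. -/
theorem exists_ball_subset (hd : 1 ≤ d) {Ω : Set (Eucl d)}
    (hb : Bornology.IsBounded Ω) (hL : HasLipschitzBoundary Ω) :
    ∃ δ c : ℝ, 0 < δ ∧ 0 < c ∧ ∀ x ∈ Ω, ∀ t, 0 < t → t ≤ δ →
      ∃ y, Metric.ball y (c * t) ⊆ Ω ∩ Metric.closedBall x t := by
  have key : ∃ δ > (0 : ℝ), ∃ c > (0 : ℝ), ∀ x ∈ Ω, (∃ q ∈ frontier Ω, dist x q < δ) →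
      ∀ t, 0 < t → t ≤ δ → ∃ y, Metric.ball y (c * t) ⊆ Ω ∩ Metric.closedBall x t := by
    refine (isCompact_frontier_of_isBounded hb).induction_on
      (p := fun S => ∃ δ > (0 : ℝ), ∃ c > (0 : ℝ), ∀ x ∈ Ω, (∃ q ∈ S, dist x q < δ) →
      ∀ t, 0 < t → t ≤ δ → ∃ y, Metric.ball y (c * t) ⊆ Ω ∩ Metric.closedBall x t) ?_ ?_ ?_ ?_
    · exact ⟨1, one_pos, 1, one_pos, fun x _ ⟨q, hq, _⟩ => absurd hq (Set.notMem_empty q)⟩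
    · rintro S S' hSS ⟨δ, hδ, c, hc, h⟩
      refine ⟨δ, hδ, c, hc, fun x hx ⟨q, hq, hqx⟩ => h x hx ⟨q, hSS hq, hqx⟩⟩
    · rintro S S' ⟨δ, hδ, c, hc, h⟩ ⟨δ', hδ', c', hc', h'⟩
      refine ⟨min δ δ', lt_min hδ hδ', min c c', lt_min hc hc', ?_⟩
      rintro x hx ⟨q, hq, hxq⟩ t ht htδ
      have hd1 : min δ δ' ≤ δ := min_le_left _ _
      have hd2 : min δ δ' ≤ δ' := min_le_right _ _
      rcases hq with hq | hq
      · obtain ⟨y, hy⟩ := h x hx ⟨q, hq, hxq.trans_le hd1⟩ t ht (htδ.trans hd1)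
        exact ⟨y, (Metric.ball_subset_ball (by gcongr; exact min_le_left _ _)).trans hy⟩
      · obtain ⟨y, hy⟩ := h' x hx ⟨q, hq, hxq.trans_le hd2⟩ t ht (htδ.trans hd2)
        exact ⟨y, (Metric.ball_subset_ball (by gcongr; exact min_le_right _ _)).trans hy⟩
    · intro p hp
      obtain ⟨ε, hε, e, he, g, ⟨L, hg⟩, hloc⟩ := hL p hp
      refine ⟨_, mem_nhdsWithin_of_mem_nhds (Metric.ball_mem_nhds p (half_pos hε)),
        ε / 4, by positivity, 1 / (2 * (1 + 2 * L)), by positivity, ?_⟩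
      rintro x hx ⟨q, hq, hxq⟩ t ht htδ
      set c : ℝ := 1 / (2 * (1 + 2 * L)) with hc
      have hc2 : c * (1 + 2 * L) = 1 / 2 := by rw [hc]; field_simp
      have hc0 : 0 < c := by positivity
      have hcL : c ≤ 1 / 2 := by
        have : 0 ≤ c * L := by positivity
        linarith
      have hct : c * t ≤ t / 2 := by nlinarith
      have hqp : dist q p < ε / 2 := hq
      have hxp : x ∈ Metric.ball p ε := by
        rw [Metric.mem_ball]
        linarith [dist_triangle x q p]
      refine ⟨x + (t / 2) • e, fun y hy => ?_⟩
      rw [Metric.mem_ball] at hy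
      have hx' : dist (x + (t / 2) • e) x = t / 2 := by
        simp [dist_eq_norm, norm_smul, he, abs_of_pos ht]
      have hyx : dist y x ≤ t := by
        linarith [dist_triangle y (x + (t / 2) • e) x]
      refine ⟨?_, hyx⟩
      have hyp : y ∈ Metric.ball p ε := by
        rw [Metric.mem_ball]
        linarith [dist_triangle y x p, dist_triangle x q p]
      refine (hloc y hyp).2 ?_
      have h1 := (hloc x hxp).1 hx
      have h3 := (abs_le.1 (abs_inner_sub_le he y (x + (t / 2) • e))).1
      have h4 := (abs_le.1 (abs_comp_orthogonal_part_sub_le he hg y (x + (t / 2) • e))).2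
      rw [orthogonal_part_add_smul he] at h4
      rw [inner_add_smul_self he] at h3
      have h5 : (1 + 2 * (L : ℝ)) * dist y (x + (t / 2) • e) ≤ (1 + 2 * L) * (c * t) := by gcongr
      have h6 : (1 + 2 * (L : ℝ)) * (c * t) = t / 2 := by
        rw [← mul_assoc, mul_comm _ c, hc2]; ring
      linarith
  obtain ⟨δ, hδ, c, hc, h⟩ := key
  refine ⟨δ, min c 1, hδ, lt_min hc one_pos, fun x hx t ht htδ => ?_⟩
  rcases lt_or_ge (Metric.infDist x Ωᶜ) δ with hlt | hge
  · obtain ⟨q, hqf, hqd⟩ := exists_mem_frontier_infDist_compl_eq_dist hx (ne_univ_of_isBounded hd hb)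
    obtain ⟨y, hy⟩ := h x hx ⟨q, hqf, hqd ▸ hlt⟩ t ht htδ
    exact ⟨y, (Metric.ball_subset_ball (by gcongr; exact min_le_left _ _)).trans hy⟩
  · refine ⟨x, fun y hy => ?_⟩
    have hyt : dist y x < t := by
      refine lt_of_lt_of_le hy ?_
      exact mul_le_of_le_one_left ht.le (min_le_right _ _)
    exact ⟨Metric.ball_infDist_compl_subset (Metric.mem_ball.2 (by linarith)), hyt.le⟩

end Domain

/-! ### The kernel measure -/

section Kernel

variable {d : ℕ} {η : ℝ → ℝ}

/-- The kernel assumptions for a profile that is antitone on all of `ℝ`; only the values on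
`[0, ∞)` enter the problem, so nothing is lost. -/
structure RegularKernel (d : ℕ) (η : ℝ → ℝ) : Prop extends KernelAssumption d η where
  antitone_univ : Antitone η

namespace RegularKernel

lemma measurable (hη : RegularKernel d η) : Measurable η := hη.antitone_univ.measurable

lemma nonneg' (hη : RegularKernel d η) (t : ℝ) : 0 ≤ η t :=
  (hη.nonneg (max t 0) (le_max_right _ _)).trans (hη.antitone_univ (le_max_left _ _))

lemma measurable_norm (hη : RegularKernel d η) : Measurable fun z : Eucl d => η ‖z‖ :=
  hη.measurable.comp _root_.measurable_norm

lemma integrable (hη : RegularKernel d η) : Integrable fun z : Eucl d => η ‖z‖ := by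
  by_contra h
  have := hη.unit_mass
  rw [integral_undef h] at this
  exact zero_ne_one this

lemma isProbabilityMeasure (hη : RegularKernel d η) :
    IsProbabilityMeasure (kernelMeasure d η) := by
  constructor
  rw [kernelMeasure, withDensity_apply _ MeasurableSet.univ, Measure.restrict_univ,
    ← ofReal_integral_eq_lintegral_ofReal hη.integrable (ae_of_all _ fun z => hη.nonneg' _),
    hη.unit_mass, ENNReal.ofReal_one]

lemma integral_kernelMeasure (hη : RegularKernel d η) (f : Eucl d → ℝ) :
    ∫ z, f z ∂kernelMeasure d η = ∫ z, η ‖z‖ * f z := by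
  rw [kernelMeasure, integral_withDensity_eq_integral_toReal_smul
    hη.measurable_norm.ennreal_ofReal (ae_of_all _ fun _ => ENNReal.ofReal_lt_top)]
  simp only [ENNReal.toReal_ofReal (hη.nonneg' _), smul_eq_mul]

lemma integrable_kernelMeasure_iff (hη : RegularKernel d η) (f : Eucl d → ℝ) :
    Integrable f (kernelMeasure d η) ↔ Integrable fun z => η ‖z‖ * f z := by
  rw [kernelMeasure, integrable_withDensity_iff_integrable_smul'
    hη.measurable_norm.ennreal_ofReal (ae_of_all _ fun _ => ENNReal.ofReal_lt_top)]
  simp only [ENNReal.toReal_ofReal (hη.nonneg' _), smul_eq_mul]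

/-- The fourth moment is finite, in a form that dominates all moments of order at most four. -/
lemma integrable_weight (hη : RegularKernel d η) :
    Integrable (fun z : Eucl d => (1 + ‖z‖) ^ 4) (kernelMeasure d η) := by
  have := hη.isProbabilityMeasure
  have h4 : Integrable (fun z : Eucl d => ‖z‖ ^ 4) (kernelMeasure d η) :=
    (hη.integrable_kernelMeasure_iff _).2 (hη.moments 4 (by norm_num) le_rfl)
  refine (((integrable_const (1 : ℝ)).add h4).const_mul 8).mono'
    (by fun_prop) (ae_of_all _ fun z => ?_)
  rw [Real.norm_eq_abs, abs_of_nonneg (by positivity)]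
  have h := norm_nonneg z
  simp only [Pi.add_apply]
  nlinarith [sq_nonneg (‖z‖ - 1), sq_nonneg (‖z‖ ^ 2 - 1), sq_nonneg (‖z‖ * (‖z‖ - 1)),
    mul_nonneg h (sq_nonneg (‖z‖ - 1))]

lemma integrable_of_bound (hη : RegularKernel d η) {f : Eucl d → ℝ} (hf : Measurable f) {c : ℝ}
    (h : ∀ z, |f z| ≤ c * (1 + ‖z‖) ^ 4) : Integrable f (kernelMeasure d η) :=
  (hη.integrable_weight.const_mul c).mono' hf.aestronglyMeasurable (ae_of_all _ h)

lemma one_le_integral_weight (hη : RegularKernel d η) :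
    1 ≤ ∫ z : Eucl d, (1 + ‖z‖) ^ 4 ∂kernelMeasure d η := by
  have := hη.isProbabilityMeasure
  calc (1 : ℝ) = ∫ _ : Eucl d, (1 : ℝ) ∂kernelMeasure d η := by simp
    _ ≤ _ := by
      refine integral_mono (integrable_const _) hη.integrable_weight fun z => ?_
      exact one_le_pow₀ (by linarith [norm_nonneg z])

/-- Integrals against the kernel are bounded by the constant in a bound by `(1 + |z|)⁴`. -/
lemma abs_integral_le (hη : RegularKernel d η) {f : Eucl d → ℝ} {c : ℝ}
    (h : ∀ z, |f z| ≤ c * (1 + ‖z‖) ^ 4) :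
    |∫ z, f z ∂kernelMeasure d η| ≤ c * ∫ z : Eucl d, (1 + ‖z‖) ^ 4 ∂kernelMeasure d η := by
  rw [← integral_const_mul]
  exact norm_integral_le_of_norm_le (f := f) (hη.integrable_weight.const_mul c) (ae_of_all _ h)

lemma exists_pos (hd : 1 ≤ d) (hη : RegularKernel d η) : ∃ t > 0, 0 < η t := by
  by_contra! h
  have : Nonempty (Fin d) := ⟨⟨0, hd⟩⟩
  have h0 : (fun z : Eucl d => η ‖z‖) =ᵐ[volume] 0 := by
    have h1 : ∀ᵐ z : Eucl d, z ≠ 0 := by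
      rw [ae_iff]; simp
    filter_upwards [h1] with z hz
    exact le_antisymm (h _ (norm_pos_iff.2 hz)) (hη.nonneg' _)
  have := hη.unit_mass
  rw [integral_congr_ae h0] at this
  simp at this

/-- A nonincreasing profile with finite second moment decays at least like `t⁻²`. -/
lemma exists_mul_sq_le (hd : 1 ≤ d) (hη : RegularKernel d η) :
    ∃ A : ℝ, ∀ t, 0 ≤ t → η t * t ^ 2 ≤ A := by
  set v := (volume (Metric.ball (0 : Eucl d) (1 / 4))).toReal with hv
  have hv0 : 0 < v := ENNReal.toReal_pos (Metric.measure_ball_pos _ _ (by norm_num)).ne'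
    measure_ball_lt_top.ne
  set m := ∫ z : Eucl d, η ‖z‖ * ‖z‖ ^ 2 with hm
  have hm0 : 0 ≤ m := integral_nonneg fun z => mul_nonneg (hη.nonneg' _) (by positivity)
  refine ⟨η 0 + 4 * m / v, fun t ht => ?_⟩
  rcases le_or_gt t 1 with ht1 | ht1
  · have h1 : η t ≤ η 0 := hη.antitone_univ ht
    have h2 : t ^ 2 ≤ 1 := pow_le_one₀ ht ht1
    have h3 : 0 ≤ 4 * m / v := by positivity
    nlinarith [hη.nonneg' t]
  · -- the ball of radius `1 / 4` around a point of norm `3 t / 4` lies in `t / 2 ≤ |z| ≤ t`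
    set e : Eucl d := EuclideanSpace.single ⟨0, hd⟩ (1 : ℝ) with he
    have hen : ‖e‖ = 1 := by simp [he]
    set B := Metric.ball ((3 / 4 * t) • e) (1 / 4) with hB
    have hBv : volume.real B = v := by
      rw [hv, Measure.real, hB, Measure.addHaar_ball_center]
    have hin : ∀ z ∈ B, t / 2 ≤ ‖z‖ ∧ ‖z‖ ≤ t := by
      intro z hz
      have h1 : ‖z - (3 / 4 * t) • e‖ < 1 / 4 := by
        rw [← dist_eq_norm]; exact hz
      have h2 : ‖(3 / 4 * t) • e‖ = 3 / 4 * t := by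
        rw [norm_smul, hen, mul_one, Real.norm_eq_abs, abs_of_pos (by linarith)]
      have h3 := abs_le.1 (abs_norm_sub_norm_le z ((3 / 4 * t) • e))
      constructor <;> linarith [h3.1, h3.2]
    have hi := hη.moments 2 (by norm_num) (by norm_num)
    have h1 : ∫ z in B, η t * (t / 2) ^ 2 ≤ ∫ z in B, η ‖z‖ * ‖z‖ ^ 2 := by
      refine setIntegral_mono_on ?_ hi.integrableOn Metric.isOpen_ball.measurableSet ?_
      · exact integrableOn_const (by exact measure_ball_lt_top.ne)
      · intro z hz
        obtain ⟨a, b⟩ := hin z hz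
        exact mul_le_mul (hη.antitone_univ b) (pow_le_pow_left₀ (by linarith) a 2) (by positivity)
          (hη.nonneg' _)
    have h2 : ∫ z in B, η ‖z‖ * ‖z‖ ^ 2 ≤ m :=
      setIntegral_le_integral hi (ae_of_all _ fun z => mul_nonneg (hη.nonneg' _) (by positivity))
    rw [setIntegral_const, hBv, smul_eq_mul] at h1
    have h3 : η t * t ^ 2 ≤ 4 * m / v := by
      rw [le_div_iff₀ hv0]; nlinarith
    linarith [hη.nonneg' 0]

/-- The mass that the kernel gives to a ball inside `|z| ≤ t`. -/
lemma mul_volume_ball_le (hη : RegularKernel d η) {y : Eucl d} {r t : ℝ}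
    (h : Metric.ball y r ⊆ Metric.closedBall 0 t) :
    η t * volume.real (Metric.ball (0 : Eucl d) r)
      ≤ (kernelMeasure d η).real (Metric.ball y r) := by
  have := hη.isProbabilityMeasure
  have e1 : (kernelMeasure d η).real (Metric.ball y r) = ∫ z in Metric.ball y r, η ‖z‖ := by
    have := hη.integral_kernelMeasure ((Metric.ball y r).indicator fun _ => 1)
    rw [integral_indicator Metric.isOpen_ball.measurableSet] at this
    simp only [integral_const, smul_eq_mul, mul_one, measureReal_restrict_apply_univ] at this
    rw [this, ← integral_indicator Metric.isOpen_ball.measurableSet]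
    congr 1
    ext z
    by_cases hz : z ∈ Metric.ball y r <;> simp [hz]
  have e2 : volume.real (Metric.ball (0 : Eucl d) r) = volume.real (Metric.ball y r) := by
    simp only [Measure.real]; rw [Measure.addHaar_ball_center volume y]
  rw [e1, e2]
  calc _ = ∫ z in Metric.ball y r, η t := by rw [setIntegral_const, smul_eq_mul, mul_comm]
    _ ≤ _ := by
      refine setIntegral_mono_on (integrableOn_const (by exact measure_ball_lt_top.ne))
        hη.integrable.integrableOn Metric.isOpen_ball.measurableSet fun z hz => ?_
      refine hη.antitone_univ ?_
      simpa using h hz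

end RegularKernel

end Kernel

/-! ### Local averages over the data distribution -/

section Data

variable {d : ℕ} {η : ℝ → ℝ} {Ω : Set (Eucl d)} {ρ σ : Eucl d → ℝ} {σmin σmax : ℝ}

/-- Data and bandwidth with conventions off `Ω` that make everything measurable: the density
vanishes there and the bandwidth satisfies its bounds everywhere. -/
structure RegularData (Ω : Set (Eucl d)) (ρ σ : Eucl d → ℝ) (σmin σmax : ℝ) : Prop
    extends DataAssumption Ω ρ where
  measurable_density : Measurable ρ
  density_eq_zero : ∀ x, x ∉ Ω → ρ x = 0
  measurable_bandwidth : Measurable σ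
  min_pos : 0 < σmin
  bandwidth_bounds : ∀ x, σmin ≤ σ x ∧ σ x ≤ σmax

namespace RegularData

lemma exists_bounds (h : RegularData Ω ρ σ σmin σmax) : ∃ a b : ℝ, 0 < a ∧ 1 ≤ b ∧
    (∀ x ∈ Ω, a ≤ ρ x) ∧ ∀ x, 0 ≤ ρ x ∧ ρ x ≤ b := by
  obtain ⟨a, b, ha, hab⟩ := h.bounds
  refine ⟨a, max b 1, ha, le_max_right _ _, fun x hx => (hab x hx).1, fun x => ?_⟩
  by_cases hx : x ∈ Ω
  · exact ⟨ha.le.trans (hab x hx).1, (hab x hx).2.trans (le_max_left _ _)⟩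
  · rw [h.density_eq_zero x hx]
    exact ⟨le_rfl, zero_le_one.trans (le_max_right _ _)⟩

lemma density_nonneg (h : RegularData Ω ρ σ σmin σmax) (x : Eucl d) : 0 ≤ ρ x := by
  obtain ⟨_, _, _, _, _, hb⟩ := h.exists_bounds
  exact (hb x).1

lemma bandwidth_pos (h : RegularData Ω ρ σ σmin σmax) (x : Eucl d) : 0 < σ x :=
  h.min_pos.trans_le (h.bandwidth_bounds x).1

lemma max_pos (h : RegularData Ω ρ σ σmin σmax) : 0 < σmax :=
  (h.bandwidth_pos 0).trans_le (h.bandwidth_bounds 0).2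

lemma integral_dataMeasure (h : RegularData Ω ρ σ σmin σmax) (f : Eucl d → ℝ) :
    ∫ x, f x ∂dataMeasure Ω ρ = ∫ x, ρ x * f x := by
  rw [dataMeasure, integral_withDensity_eq_integral_toReal_smul
    h.measurable_density.ennreal_ofReal (ae_of_all _ fun _ => ENNReal.ofReal_lt_top)]
  simp only [ENNReal.toReal_ofReal (h.density_nonneg _), smul_eq_mul]
  refine setIntegral_eq_integral_of_forall_compl_eq_zero fun x hx => ?_
  rw [h.density_eq_zero x hx, zero_mul]

lemma isProbabilityMeasure (h : RegularData Ω ρ σ σmin σmax) :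
    IsProbabilityMeasure (dataMeasure Ω ρ) := by
  constructor
  have hi : Integrable ρ (volume.restrict Ω) := by
    by_contra hi
    have := h.unit_mass
    rw [integral_undef hi] at this
    exact zero_ne_one this
  rw [dataMeasure, withDensity_apply _ MeasurableSet.univ, Measure.restrict_univ,
    ← ofReal_integral_eq_lintegral_ofReal hi (ae_of_all _ fun z => h.density_nonneg _),
    h.unit_mass, ENNReal.ofReal_one]

lemma ae_mem (h : DataAssumption Ω ρ) : ∀ᵐ x ∂dataMeasure Ω ρ, x ∈ Ω :=
  (withDensity_absolutelyContinuous _ _).ae_le (ae_restrict_mem h.isOpen.measurableSet)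

/-- Integrals of the rescaled kernel in microscopic coordinates `y = x + b z`. -/
lemma integral_scaledKernel_mul (h : RegularData Ω ρ σ σmin σmax) (hη : RegularKernel d η)
    {b : ℝ} (hb : 0 < b) (x : Eucl d) (F : Eucl d → ℝ) :
    ∫ y, scaledKernel d η b ‖x - y‖ * F y ∂dataMeasure Ω ρ
      = ∫ z, F (x + b • z) * ρ (x + b • z) ∂kernelMeasure d η := by
  rw [h.integral_dataMeasure, hη.integral_kernelMeasure,
    ← integral_add_left_eq_self (fun y => ρ y * (scaledKernel d η b ‖x - y‖ * F y)) x]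
  have h1 := Measure.integral_comp_smul volume
    (fun y => ρ (x + y) * (scaledKernel d η b ‖x - (x + y)‖ * F (x + y))) b
  have hbd : 0 < b ^ d := pow_pos hb d
  rw [finrank_euclideanSpace_fin, abs_of_pos (inv_pos.2 hbd), smul_eq_mul] at h1
  have h2 : ∫ y, ρ (x + y) * (scaledKernel d η b ‖x - (x + y)‖ * F (x + y))
      = b ^ d * ∫ z, ρ (x + b • z) * (scaledKernel d η b ‖x - (x + b • z)‖ * F (x + b • z)) := by
    rw [h1, mul_inv_cancel_left₀ hbd.ne']
  rw [h2, ← integral_const_mul]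
  congr 1
  ext z
  have e : ‖x - (x + b • z)‖ / b = ‖z‖ := by
    rw [sub_add_cancel_left, norm_neg, norm_smul, Real.norm_eq_abs, abs_of_pos hb]
    field_simp
  rw [scaledKernel, e]
  field_simp

/-- The mass of the data near a point of the domain, seen at scale `h`, is bounded below. -/
lemma exists_le_integral_density (hd : 1 ≤ d) (h : RegularData Ω ρ σ σmin σmax)
    (hη : RegularKernel d η) :
    ∃ c₀ h₀ : ℝ, 0 < c₀ ∧ 0 < h₀ ∧ ∀ x ∈ Ω, ∀ t, 0 < t → t ≤ h₀ →
      c₀ ≤ ∫ z, ρ (x + (σ x * t) • z) ∂kernelMeasure d η := by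
  have := hη.isProbabilityMeasure
  obtain ⟨a, b, ha, hb1, haρ, hb⟩ := h.exists_bounds
  obtain ⟨t₀, ht₀, hηt⟩ := hη.exists_pos hd
  obtain ⟨δ, c, hδ, hc, hball⟩ := exists_ball_subset hd h.isBounded h.lipschitzBoundary
  have hv : 0 < volume.real (Metric.ball (0 : Eucl d) (c * t₀)) :=
    ENNReal.toReal_pos (Metric.measure_ball_pos _ _ (by positivity)).ne' measure_ball_lt_top.ne
  have hσ := h.max_pos
  refine ⟨a * (η t₀ * volume.real (Metric.ball (0 : Eucl d) (c * t₀))), δ / (t₀ * σmax),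
    by positivity, by positivity, fun x hx t ht hth => ?_⟩
  have hσx := h.bandwidth_pos x
  set s := σ x * t with hs
  have hs0 : 0 < s := by positivity
  have hsδ : s * t₀ ≤ δ := by
    rw [le_div_iff₀ (by positivity)] at hth
    refine le_trans ?_ hth
    have := (h.bandwidth_bounds x).2
    calc s * t₀ = σ x * (t * t₀) := by rw [hs]; ring
      _ ≤ σmax * (t * t₀) := by gcongr
      _ = _ := by ring
  obtain ⟨y, hy⟩ := hball x hx (s * t₀) (by positivity) hsδ
  set y' := s⁻¹ • (y - x) with hy'
  have hmap : ∀ z ∈ Metric.ball y' (c * t₀), x + s • z ∈ Ω ∩ Metric.closedBall x (s * t₀) := by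
    intro z hz
    refine hy ?_
    rw [Metric.mem_ball, dist_eq_norm] at hz ⊢
    have e : x + s • z - y = s • (z - y') := by
      rw [hy', smul_sub, smul_inv_smul₀ hs0.ne']; abel
    rw [e, norm_smul, Real.norm_eq_abs, abs_of_pos hs0]
    calc s * ‖z - y'‖ < s * (c * t₀) := by gcongr
      _ = _ := by ring
  have hsub : Metric.ball y' (c * t₀) ⊆ Metric.closedBall 0 t₀ := by
    intro z hz
    have h1 := (hmap z hz).2
    rw [Metric.mem_closedBall, dist_eq_norm, add_sub_cancel_left, norm_smul, Real.norm_eq_abs,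
      abs_of_pos hs0] at h1
    rw [mem_closedBall_zero_iff]
    exact le_of_mul_le_mul_left h1 hs0
  have hmeas : Measurable fun z : Eucl d => ρ (x + s • z) :=
    h.measurable_density.comp (by fun_prop)
  have hint : Integrable (fun z : Eucl d => ρ (x + s • z)) (kernelMeasure d η) := by
    refine Integrable.of_bound hmeas.aestronglyMeasurable b (ae_of_all _ fun z => ?_)
    rw [Real.norm_eq_abs, abs_of_nonneg (hb _).1]
    exact (hb _).2
  calc _ ≤ a * (kernelMeasure d η).real (Metric.ball y' (c * t₀)) := by
        gcongr
        exact hη.mul_volume_ball_le hsub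
    _ = ∫ z in Metric.ball y' (c * t₀), a ∂kernelMeasure d η := by
        rw [setIntegral_const, smul_eq_mul, mul_comm]
    _ ≤ ∫ z in Metric.ball y' (c * t₀), ρ (x + s • z) ∂kernelMeasure d η := by
        refine setIntegral_mono_on (integrableOn_const (measure_ne_top _ _)) hint.integrableOn
          Metric.isOpen_ball.measurableSet fun z hz => haρ _ (hmap z hz).1
    _ ≤ _ := setIntegral_le_integral hint (ae_of_all _ fun z => (hb _).1)

end RegularData

/-- A measurable map that is differentiable on `Ω` and for which `L` and `M` are Lipschitz
constants of the map and of its derivative on `Ω`. -/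
structure RegularMap {m : ℕ} (Ω : Set (Eucl d)) (T : Eucl d → Eucl m) (L M : ℝ) : Prop where
  measurable : Measurable T
  differentiableAt : ∀ x ∈ Ω, DifferentiableAt ℝ T x
  nonneg : 0 ≤ L
  nonneg_fderiv : 0 ≤ M
  lipschitz : ∀ x ∈ Ω, ∀ y ∈ Ω, ‖T x - T y‖ ≤ L * ‖x - y‖
  lipschitz_fderiv : ∀ x ∈ Ω, ∀ y ∈ Ω, ‖fderiv ℝ T x - fderiv ℝ T y‖ ≤ M * ‖x - y‖

/-- The logarithmic interaction `log (1 + h⁻² |T x - T y|²)`. -/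
noncomputable def logTerm {m : ℕ} (T : Eucl d → Eucl m) (h : ℝ) (x y : Eucl d) : ℝ :=
  Real.log (1 + (h ^ 2)⁻¹ * ‖T x - T y‖ ^ 2)

/-- The localised interaction `log (1 + |σ(x) DT(x) z|²)`. -/
noncomputable def logDeriv {m : ℕ} (σ : Eucl d → ℝ) (T : Eucl d → Eucl m) (x z : Eucl d) : ℝ :=
  Real.log (1 + ‖(σ x • fderiv ℝ T x) z‖ ^ 2)

lemma log_one_add_nonneg {u : ℝ} (hu : 0 ≤ u) : 0 ≤ Real.log (1 + u) :=
  Real.log_nonneg (by linarith)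

lemma log_one_add_le {u : ℝ} (hu : 0 ≤ u) : Real.log (1 + u) ≤ u := by
  have := Real.log_le_sub_one_of_pos (by linarith : 0 < 1 + u)
  linarith

lemma abs_log_one_add_sub_le {u v : ℝ} (hu : 0 ≤ u) (hv : 0 ≤ v) :
    |Real.log (1 + u) - Real.log (1 + v)| ≤ |u - v| := by
  have key : ∀ {a b : ℝ}, 0 ≤ a → 0 ≤ b → Real.log (1 + a) - Real.log (1 + b) ≤ |a - b| := by
    intro a b ha hb
    rw [← Real.log_div (by positivity) (by positivity)]
    refine (Real.log_le_sub_one_of_pos (by positivity)).trans ?_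
    rw [div_sub_one (by positivity), div_le_iff₀ (by positivity)]
    have := le_abs_self (a - b)
    nlinarith [abs_nonneg (a - b)]
  rw [abs_le]
  refine ⟨?_, key hu hv⟩
  have := key hv hu
  rw [abs_sub_comm] at this
  linarith

end Data

/-! ### Concentration of the discrete attraction -/

section Discrete

variable {d m : ℕ} {η : ℝ → ℝ} {Ω : Set (Eucl d)} {ρ σ : Eucl d → ℝ} {σmin σmax : ℝ}
  {T : Eucl d → Eucl m} {L M h : ℝ}

lemma logTerm_nonneg (T : Eucl d → Eucl m) (h : ℝ) (x y : Eucl d) : 0 ≤ logTerm T h x y :=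
  log_one_add_nonneg (by positivity)

lemma logTerm_self (T : Eucl d → Eucl m) (h : ℝ) (x : Eucl d) : logTerm T h x x = 0 := by
  simp [logTerm]

lemma RegularMap.logTerm_le (hT : RegularMap Ω T L M) {x y : Eucl d} (hx : x ∈ Ω) (hy : y ∈ Ω) :
    logTerm T h x y ≤ (h ^ 2)⁻¹ * (L ^ 2 * ‖x - y‖ ^ 2) := by
  refine (log_one_add_le (by positivity)).trans ?_
  rw [← mul_pow]
  gcongr
  exact hT.lipschitz x hx y hy

lemma RegularData.norm_smul_le (hD : RegularData Ω ρ σ σmin σmax) (hh : 0 < h) (x z : Eucl d) :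
    ‖(σ x * h) • z‖ ≤ h * σmax * ‖z‖ := by
  have hb : 0 < σ x * h := mul_pos (hD.bandwidth_pos x) hh
  rw [norm_smul, Real.norm_eq_abs, abs_of_pos hb, mul_comm h]
  have := (hD.bandwidth_bounds x).2
  gcongr

/-- Where the density does not vanish, the interaction is at most quadratic in microscopic
coordinates, uniformly in `h`. -/
lemma RegularMap.logTerm_smul_le (hT : RegularMap Ω T L M) (hD : RegularData Ω ρ σ σmin σmax)
    (hh : 0 < h) {x : Eucl d} (hx : x ∈ Ω) {z : Eucl d} (hz : x + (σ x * h) • z ∈ Ω) :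
    logTerm T h x (x + (σ x * h) • z) ≤ L ^ 2 * (σmax ^ 2 * ‖z‖ ^ 2) := by
  refine (hT.logTerm_le hx hz).trans ?_
  rw [sub_add_cancel_left, norm_neg]
  calc _ ≤ (h ^ 2)⁻¹ * (L ^ 2 * (h * σmax * ‖z‖) ^ 2) := by
        gcongr
        exact hD.norm_smul_le hh x z
    _ = _ := by field_simp

lemma measurable_logTerm (hT : Measurable T) (h : ℝ) :
    Measurable fun p : Eucl d × Eucl d => logTerm T h p.1 p.2 := by
  unfold logTerm
  exact Real.measurable_log.comp (((((hT.comp measurable_fst).sub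
    (hT.comp measurable_snd)).norm.pow_const 2).const_mul _).const_add 1)

lemma RegularData.measurable_scaledKernel (hD : RegularData Ω ρ σ σmin σmax)
    (hη : RegularKernel d η) (h : ℝ) :
    Measurable fun p : Eucl d × Eucl d => scaledKernel d η (σ p.1 * h) ‖p.1 - p.2‖ := by
  have h1 : Measurable fun p : Eucl d × Eucl d => σ p.1 * h :=
    (hD.measurable_bandwidth.comp measurable_fst).mul_const h
  unfold scaledKernel
  exact (h1.pow_const d).inv.mul (hη.measurable.comp ((measurable_fst.sub measurable_snd).norm.div h1))

lemma RegularKernel.scaledKernel_nonneg (hη : RegularKernel d η) {b : ℝ} (hb : 0 < b) (t : ℝ) :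
    0 ≤ scaledKernel d η b t :=
  mul_nonneg (by positivity) (hη.nonneg' _)

lemma RegularData.inv_pow_le (hD : RegularData Ω ρ σ σmin σmax) (hh : 0 < h) (x : Eucl d) :
    ((σ x * h) ^ d)⁻¹ ≤ (σmin ^ d)⁻¹ * (h ^ d)⁻¹ := by
  rw [← mul_inv, ← mul_pow]
  have := (hD.bandwidth_bounds x).1
  have := hD.min_pos
  gcongr

lemma RegularData.scaledKernel_le (hD : RegularData Ω ρ σ σmin σmax) (hη : RegularKernel d η)
    (hh : 0 < h) (x : Eucl d) {t : ℝ} (ht : 0 ≤ t) :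
    scaledKernel d η (σ x * h) t ≤ (σmin ^ d)⁻¹ * η 0 * (h ^ d)⁻¹ := by
  have hb : 0 < σ x * h := mul_pos (hD.bandwidth_pos x) hh
  have := hD.min_pos
  calc _ ≤ (σmin ^ d)⁻¹ * (h ^ d)⁻¹ * η 0 := by
        unfold scaledKernel
        exact mul_le_mul (hD.inv_pow_le hh x) (hη.antitone_univ (by positivity)) (hη.nonneg' _)
          (by positivity)
    _ = _ := by ring

/-- The expected attraction `∫ w(x, ·) log(…) / ∫ w(x, ·)` of a sample point at `x`, in
microscopic coordinates. -/
noncomputable def localAttraction (η : ℝ → ℝ) (ρ σ : Eucl d → ℝ) (T : Eucl d → Eucl m) (h : ℝ)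
    (x : Eucl d) : ℝ :=
  (∫ z, logTerm T h x (x + (σ x * h) • z) * ρ (x + (σ x * h) • z) ∂kernelMeasure d η) /
    ∫ z, ρ (x + (σ x * h) • z) ∂kernelMeasure d η

/-- The stochastic part of the error. -/
theorem exists_discreteAttraction_concentration (hd : 1 ≤ d) (hD : RegularData Ω ρ σ σmin σmax)
    (hη : RegularKernel d η) :
    ∃ C c : ℝ, 1 ≤ C ∧ 0 < c ∧ c ≤ 1 ∧
    ∀ {m : ℕ} (T : Eucl d → Eucl m) (L M : ℝ), RegularMap Ω T L M →
    ∀ (n : ℕ) (h lam : ℝ), 2 ≤ n → 0 < h → h ≤ c → 1 ≤ n * h ^ d → 0 ≤ lam →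
      lam ^ 2 ≤ c * (n * h ^ d) →
      (Measure.pi fun _ : Fin n => dataMeasure Ω ρ)
        {x | C * L ^ 2 * (lam / Real.sqrt (n * h ^ d)) <
          |discreteAttraction η σ h T x
            - ∫ x, localAttraction η ρ σ T h x ∂dataMeasure Ω ρ|}
        ≤ ENNReal.ofReal (3 * n * Real.exp (-lam ^ 2)) := by
  have := hη.isProbabilityMeasure
  have := hD.isProbabilityMeasure
  obtain ⟨a, b, ha, hb1, haρ, hb⟩ := hD.exists_bounds
  obtain ⟨c₀, h₀, hc₀, hh₀, hlow⟩ := hD.exists_le_integral_density hd hη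
  obtain ⟨A₂, hA₂⟩ := hη.exists_mul_sq_le hd
  have hA₂0 : 0 ≤ A₂ := by simpa using hA₂ 0 le_rfl
  set W := ∫ z : Eucl d, (1 + ‖z‖) ^ 4 ∂kernelMeasure d η with hW
  have hW1 : 1 ≤ W := hη.one_le_integral_weight
  have hσ := hD.max_pos
  have hσm := hD.min_pos
  set A₁ := (σmin ^ d)⁻¹ * η 0 with hA₁
  have hA₁0 : 0 ≤ A₁ := mul_nonneg (by positivity) (hη.nonneg' _)
  set A := 1 + A₁ + A₁ * b + (σmin ^ d)⁻¹ * A₂ * σmax ^ 2 + A₁ * σmax ^ 4 * b * W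
    + σmax ^ 2 * b * W with hA
  have p1 : 0 ≤ A₁ * b := by positivity
  have p2 : 0 ≤ (σmin ^ d)⁻¹ * A₂ * σmax ^ 2 := by positivity
  have p3 : 0 ≤ A₁ * σmax ^ 4 * b * W := by positivity
  have p4 : 0 ≤ σmax ^ 2 * b * W := by positivity
  have hA1 : 1 ≤ A := by linarith
  obtain ⟨C, c, hC, hc, hc1, key⟩ := ratio_concentration hA1 hc₀
  refine ⟨C, min c h₀, hC, lt_min hc hh₀, (min_le_left _ _).trans hc1, ?_⟩
  intro m T L M hT n h lam hn hh hhc hnh hlam hlamc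
  have hn0 : (0 : ℝ) < n := by
    have : 0 < n := by omega
    exact_mod_cast this
  have hhd : 0 < h ^ d := pow_pos hh d
  have hbx : ∀ x, 0 < σ x * h := fun x => mul_pos (hD.bandwidth_pos x) hh
  set w : Eucl d → Eucl d → ℝ := fun x y => scaledKernel d η (σ x * h) ‖x - y‖ with hw
  set u : Eucl d → Eucl d → ℝ := fun x y => w x y * logTerm T h x y with hu
  set H := (h ^ d)⁻¹ with hH
  have hH0 : 0 < H := inv_pos.2 hhd
  have hw0 : ∀ x y, 0 ≤ w x y := fun x y => hη.scaledKernel_nonneg (hbx x) _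
  have hwA : ∀ x y, w x y ≤ A₁ * H := fun x y => hD.scaledKernel_le hη hh x (norm_nonneg _)
  have hwA' : ∀ x y, w x y ≤ A * H := fun x y =>
    (hwA x y).trans (mul_le_mul_of_nonneg_right (by linarith) hH0.le)
  have hwm : Measurable (Function.uncurry w) := hD.measurable_scaledKernel hη h
  have hum : Measurable (Function.uncurry u) := hwm.mul (measurable_logTerm hT.measurable h)
  have hmem := RegularData.ae_mem hD.toDataAssumption
  have eD : ∀ x, ∫ y, w x y ∂dataMeasure Ω ρ
      = ∫ z, ρ (x + (σ x * h) • z) ∂kernelMeasure d η := by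
    intro x
    have := hD.integral_scaledKernel_mul hη (hbx x) x (fun _ => 1)
    simpa using this
  have eN : ∀ x, ∫ y, u x y ∂dataMeasure Ω ρ
      = ∫ z, logTerm T h x (x + (σ x * h) • z) * ρ (x + (σ x * h) • z) ∂kernelMeasure d η :=
    fun x => hD.integral_scaledKernel_mul hη (hbx x) x (logTerm T h x)
  have hz4 : ∀ z : Eucl d, ‖z‖ ^ 2 ≤ (1 + ‖z‖) ^ 4 ∧ ‖z‖ ^ 4 ≤ (1 + ‖z‖) ^ 4 := by
    intro z
    have hz := norm_nonneg z
    refine ⟨?_, by gcongr; linarith⟩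
    calc ‖z‖ ^ 2 ≤ (1 + ‖z‖) ^ 2 := by gcongr; linarith
      _ ≤ _ := pow_le_pow_right₀ (by linarith) (by norm_num)
  -- off `Ω` the density vanishes, so that the quadratic bound on the interaction may be used
  have hGρ : ∀ x ∈ Ω, ∀ z, ∀ q : ℕ, q ≠ 0 → 0 ≤ logTerm T h x (x + (σ x * h) • z) ^ q
        * ρ (x + (σ x * h) • z) ∧
      logTerm T h x (x + (σ x * h) • z) ^ q * ρ (x + (σ x * h) • z)
        ≤ (L ^ 2 * (σmax ^ 2 * ‖z‖ ^ 2)) ^ q * b := by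
    intro x hx z q hq
    have h0 := logTerm_nonneg T h x (x + (σ x * h) • z)
    refine ⟨mul_nonneg (by positivity) (hb _).1, ?_⟩
    by_cases hz : x + (σ x * h) • z ∈ Ω
    · have := hT.logTerm_smul_le hD hh hx hz
      have := (hb (x + (σ x * h) • z)).2
      have := (hb (x + (σ x * h) • z)).1
      gcongr
    · rw [hD.density_eq_zero _ hz, mul_zero]
      positivity
  have hmain := key (dataMeasure Ω ρ) w u (L ^ 2) H lam n hwm hum (by positivity)
    (one_le_inv_iff₀.2 ⟨hhd, pow_le_one₀ hh.le ((hhc.trans (min_le_left _ _)).trans hc1)⟩) hn hlam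
    (by rw [hH, inv_le_iff_one_le_mul₀ hhd]; exact hnh)
    (by
      rw [hH, ← div_eq_mul_inv, div_le_iff₀ hhd, mul_assoc]
      refine hlamc.trans ?_
      gcongr
      exact min_le_left _ _)
    (fun x => by simp [hu, logTerm_self])
    (ae_of_all _ fun x => ⟨hw0 x x, hwA' x x⟩)
    (ae_of_all _ fun x => ae_of_all _ fun y => by rw [abs_of_nonneg (hw0 x y)]; exact hwA' x y)
    (ae_of_all _ fun x => by
      simp_rw [sq]
      rw [hD.integral_scaledKernel_mul hη (hbx x) x (w x)]
      have : ∀ z : Eucl d, |w x (x + (σ x * h) • z) * ρ (x + (σ x * h) • z)|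
          ≤ A₁ * H * b := by
        intro z
        rw [abs_of_nonneg (mul_nonneg (hw0 _ _) (hb _).1)]
        exact mul_le_mul (hwA _ _) (hb _).2 (hb _).1 (by positivity)
      have h1 := norm_integral_le_of_norm_le_const (μ := kernelMeasure d η)
        (f := fun z => w x (x + (σ x * h) • z) * ρ (x + (σ x * h) • z)) (ae_of_all _ this)
      rw [probReal_univ, mul_one] at h1
      refine (le_abs_self _).trans (h1.trans ?_)
      calc A₁ * H * b = A₁ * b * H := by ring
        _ ≤ A * H := by gcongr; linarith)
    (by
      filter_upwards [hmem] with x hx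
      filter_upwards [hmem] with y hy
      have hb0 := hbx x
      rw [abs_of_nonneg (mul_nonneg (hw0 x y) (logTerm_nonneg T h x y))]
      have h1 := hA₂ (‖x - y‖ / (σ x * h)) (by positivity)
      have h2 := hD.inv_pow_le hh x
      have h3 := (hD.bandwidth_bounds x).2
      have h4 := hD.bandwidth_pos x
      have h5 := hη.nonneg' (‖x - y‖ / (σ x * h))
      calc u x y ≤ w x y * ((h ^ 2)⁻¹ * (L ^ 2 * ‖x - y‖ ^ 2)) :=
            mul_le_mul_of_nonneg_left (hT.logTerm_le hx hy) (hw0 x y)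
        _ = L ^ 2 * ((((σ x * h) ^ d)⁻¹ *
              (η (‖x - y‖ / (σ x * h)) * (‖x - y‖ / (σ x * h)) ^ 2)) * σ x ^ 2) := by
            simp only [hw, scaledKernel]
            field_simp
        _ ≤ L ^ 2 * ((((σmin ^ d)⁻¹ * H) * A₂) * σmax ^ 2) := by gcongr
        _ = L ^ 2 * ((σmin ^ d)⁻¹ * A₂ * σmax ^ 2 * H) := by ring
        _ ≤ L ^ 2 * (A * H) := by gcongr; linarith)
    (by
      filter_upwards [hmem] with x hx
      have e : ∀ y, u x y ^ 2 = w x y * (w x y * logTerm T h x y ^ 2) := fun y => by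
        simp only [hu]; ring
      simp_rw [e]
      rw [hD.integral_scaledKernel_mul hη (hbx x) x (fun y => w x y * logTerm T h x y ^ 2)]
      refine (le_abs_self _).trans ((hη.abs_integral_le
        (c := A₁ * H * ((L ^ 2 * σmax ^ 2) ^ 2 * b)) fun z => ?_).trans ?_)
      · obtain ⟨g1, g2⟩ := hGρ x hx z 2 (by norm_num)
        have hwz := hw0 x (x + (σ x * h) • z)
        rw [mul_assoc, abs_of_nonneg (mul_nonneg hwz g1), mul_assoc]
        refine mul_le_mul (hwA _ _) (g2.trans ?_) g1 (by positivity)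
        calc (L ^ 2 * (σmax ^ 2 * ‖z‖ ^ 2)) ^ 2 * b
            = (L ^ 2 * σmax ^ 2) ^ 2 * b * ‖z‖ ^ 4 := by ring
          _ ≤ _ := mul_le_mul_of_nonneg_left (hz4 z).2 (by positivity)
      · calc _ = (L ^ 2) ^ 2 * (A₁ * σmax ^ 4 * b * W * H) := by ring
          _ ≤ _ := by gcongr; linarith)
    (by
      filter_upwards [hmem] with x hx
      rw [eD]
      exact hlow x hx h hh (hhc.trans (min_le_right _ _)))
    (by
      filter_upwards [hmem] with x hx
      have g : ∀ z, 0 ≤ logTerm T h x (x + (σ x * h) • z) * ρ (x + (σ x * h) • z) ∧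
          logTerm T h x (x + (σ x * h) • z) * ρ (x + (σ x * h) • z)
            ≤ L ^ 2 * (σmax ^ 2 * ‖z‖ ^ 2) * b := fun z => by
        simpa using hGρ x hx z 1 one_ne_zero
      rw [eN]
      refine ⟨integral_nonneg fun z => (g z).1, ?_⟩
      refine (le_abs_self _).trans ((hη.abs_integral_le
        (c := L ^ 2 * σmax ^ 2 * b) fun z => ?_).trans ?_)
      · rw [abs_of_nonneg (g z).1]
        refine (g z).2.trans ?_
        calc L ^ 2 * (σmax ^ 2 * ‖z‖ ^ 2) * b = L ^ 2 * σmax ^ 2 * b * ‖z‖ ^ 2 := by ring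
          _ ≤ _ := mul_le_mul_of_nonneg_left (hz4 z).1 (by positivity)
      · calc _ = L ^ 2 * (σmax ^ 2 * b * W) := by ring
          _ ≤ _ := by gcongr; linarith)
  have e1 : lam * Real.sqrt (H / n) = lam / Real.sqrt (n * h ^ d) := by
    rw [hH, ← one_div, div_div, mul_comm (h ^ d), Real.sqrt_div zero_le_one, Real.sqrt_one,
      mul_one_div]
  have e2 : ∀ x : Fin n → Eucl d, discreteAttraction η σ h T x
      = 1 / (n : ℝ) * ∑ i, (∑ j, u (x i) (x j)) / ∑ j, w (x i) (x j) := by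
    intro x
    unfold discreteAttraction degree
    congr 1
    refine Finset.sum_congr rfl fun i _ => ?_
    rw [one_div, ← div_eq_inv_mul]
    rfl
  have e3 : ∫ x, localAttraction η ρ σ T h x ∂dataMeasure Ω ρ
      = ∫ x, (∫ y, u x y ∂dataMeasure Ω ρ) / (∫ y, w x y ∂dataMeasure Ω ρ) ∂dataMeasure Ω ρ := by
    refine integral_congr_ae (ae_of_all _ fun x => ?_)
    simp only [localAttraction, eD, eN]
  simp only [e2, e3, ← e1]
  exact hmain

end Discrete

/-! ### The bias of the local attraction -/

section Bias

variable {d m : ℕ} {η : ℝ → ℝ} {Ω : Set (Eucl d)} {ρ σ : Eucl d → ℝ} {σmin σmax : ℝ}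
  {T : Eucl d → Eucl m} {L M h : ℝ}

lemma measurable_fderiv_apply (T : Eucl d → Eucl m) (hσ : Measurable σ) :
    Measurable fun p : Eucl d × Eucl d => (σ p.1 • fderiv ℝ T p.1) p.2 := by
  have e : (fun p : Eucl d × Eucl d => (σ p.1 • fderiv ℝ T p.1) p.2) =
      fun p => σ p.1 • ∑ i, p.2 i • fderiv ℝ T p.1 (EuclideanSpace.single i 1) := by
    ext1 p
    have h1 : p.2 = ∑ i, p.2 i • EuclideanSpace.single i (1 : ℝ) := by
      ext j
      simp [Finset.sum_apply, Pi.single_apply]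
    conv_lhs => rw [h1]
    simp only [map_sum, map_smul, smul_apply, Finset.smul_sum]
    exact Finset.sum_congr rfl fun i _ => smul_comm _ _ _
  rw [e]
  refine (hσ.comp measurable_fst).smul (Finset.measurable_sum _ fun i _ => ?_)
  have hi : Measurable fun p : Eucl d × Eucl d => p.2 i := by fun_prop
  exact hi.smul ((measurable_fderiv_apply_const ℝ T _).comp measurable_fst)

lemma measurable_logDeriv (T : Eucl d → Eucl m) (hσ : Measurable σ) :
    Measurable fun p : Eucl d × Eucl d => logDeriv σ T p.1 p.2 := by
  unfold logDeriv
  exact Real.measurable_log.comp (((measurable_fderiv_apply T hσ).norm.pow_const 2).const_add 1)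

lemma logDeriv_nonneg (σ : Eucl d → ℝ) (T : Eucl d → Eucl m) (x z : Eucl d) :
    0 ≤ logDeriv σ T x z :=
  log_one_add_nonneg (by positivity)

lemma RegularMap.norm_fderiv_le (hT : RegularMap Ω T L M) (ho : IsOpen Ω) {x : Eucl d}
    (hx : x ∈ Ω) : ‖fderiv ℝ T x‖ ≤ L := by
  have hl : LipschitzOnWith ⟨L, hT.nonneg⟩ T Ω := by
    refine LipschitzOnWith.of_dist_le_mul fun a ha b hb => ?_
    rw [dist_eq_norm, dist_eq_norm]
    exact hT.lipschitz a ha b hb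
  exact norm_fderiv_le_of_lipschitzOn ℝ (ho.mem_nhds hx) hl

lemma RegularMap.norm_smul_fderiv_le (hT : RegularMap Ω T L M)
    (hD : RegularData Ω ρ σ σmin σmax) {x : Eucl d} (hx : x ∈ Ω) (z : Eucl d) :
    ‖(σ x • fderiv ℝ T x) z‖ ≤ L * (σmax * ‖z‖) := by
  rw [smul_apply, norm_smul, Real.norm_eq_abs,
    abs_of_pos (hD.bandwidth_pos x)]
  have h1 := (fderiv ℝ T x).le_of_opNorm_le (hT.norm_fderiv_le hD.isOpen hx) z
  have h2 := (hD.bandwidth_bounds x).2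
  have h3 := hT.nonneg
  have h4 := hD.max_pos
  calc σ x * ‖fderiv ℝ T x z‖ ≤ σmax * (L * ‖z‖) := by gcongr
    _ = _ := by ring

lemma RegularMap.logDeriv_le (hT : RegularMap Ω T L M) (hD : RegularData Ω ρ σ σmin σmax)
    {x : Eucl d} (hx : x ∈ Ω) (z : Eucl d) :
    logDeriv σ T x z ≤ L ^ 2 * (σmax ^ 2 * ‖z‖ ^ 2) := by
  refine (log_one_add_le (by positivity)).trans ?_
  calc _ ≤ (L * (σmax * ‖z‖)) ^ 2 := by
        gcongr
        exact hT.norm_smul_fderiv_le hD hx z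
    _ = _ := by ring

lemma closedBall_subset_of_notMem_boundaryLayer {x : Eucl d} (hx : x ∈ Ω) {t : ℝ}
    (h : x ∉ boundaryLayer Ω t) : Metric.closedBall x t ⊆ Ω := by
  intro y hy
  have h1 : t < Metric.infDist x Ωᶜ := by
    by_contra h2
    exact h ⟨hx, not_lt.1 h2⟩
  exact Metric.ball_infDist_compl_subset (Metric.mem_ball.2 (lt_of_le_of_lt hy h1))

/-- Away from the boundary layer the finite difference is close to the derivative. -/
lemma RegularMap.abs_logTerm_sub_logDeriv_le (hT : RegularMap Ω T L M)
    (hD : RegularData Ω ρ σ σmin σmax) (hh : 0 < h) {x z : Eucl d} (hx : x ∈ Ω)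
    (hz : x ∉ boundaryLayer Ω (h * σmax * ‖z‖)) :
    |logTerm T h x (x + (σ x * h) • z) - logDeriv σ T x z|
      ≤ (L ^ 2 + M ^ 2) * (h * (σmax ^ 3 * ‖z‖ ^ 3)) := by
  have hball := closedBall_subset_of_notMem_boundaryLayer hx hz
  set v := (σ x * h) • z with hv
  have hvn : ‖v‖ ≤ h * σmax * ‖z‖ := hD.norm_smul_le hh x z
  have hL := hT.nonneg
  have hM := hT.nonneg_fderiv
  have hσ := hD.max_pos
  have hxv : x + v ∈ Metric.closedBall x ‖v‖ := by simp [dist_eq_norm]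
  have hsub : Metric.closedBall x ‖v‖ ⊆ Ω := (Metric.closedBall_subset_closedBall hvn).trans hball
  have hxvΩ : x + v ∈ Ω := hsub hxv
  have hTay : ‖T (x + v) - T x - fderiv ℝ T x v‖ ≤ M * ‖v‖ * ‖v‖ := by
    have := (convex_closedBall x ‖v‖).norm_image_sub_le_of_norm_fderiv_le' (𝕜 := ℝ) (f := T)
      (φ := fderiv ℝ T x) (C := M * ‖v‖) (fun y hy => hT.differentiableAt y (hsub hy))
      (fun y hy => (hT.lipschitz_fderiv y (hsub hy) x hx).trans (by
        gcongr
        rw [← dist_eq_norm]; exact hy))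
      (Metric.mem_closedBall_self (norm_nonneg v)) hxv
    rwa [add_sub_cancel_left] at this
  have ha : ‖T (x + v) - T x‖ ≤ L * ‖v‖ := by
    have := hT.lipschitz _ hxvΩ x hx
    rwa [add_sub_cancel_left] at this
  have ha' : ‖fderiv ℝ T x v‖ ≤ L * ‖v‖ :=
    (fderiv ℝ T x).le_of_opNorm_le (hT.norm_fderiv_le hD.isOpen hx) v
  have hq : ‖(σ x • fderiv ℝ T x) z‖ ^ 2 = (h ^ 2)⁻¹ * ‖fderiv ℝ T x v‖ ^ 2 := by
    have : fderiv ℝ T x v = h • (σ x • fderiv ℝ T x) z := by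
      rw [hv, map_smul, smul_apply, smul_smul, mul_comm]
    rw [this, norm_smul, Real.norm_eq_abs, abs_of_pos hh]
    field_simp
  unfold logTerm logDeriv
  refine (abs_log_one_add_sub_le (by positivity) (by positivity)).trans ?_
  rw [hq, norm_sub_rev, ← mul_sub, abs_mul, abs_of_pos (by positivity : 0 < (h ^ 2)⁻¹), sq_sub_sq,
    abs_mul, abs_of_nonneg (by positivity : 0 ≤ ‖T (x + v) - T x‖ + ‖fderiv ℝ T x v‖)]
  have h1 := (abs_norm_sub_norm_le (T (x + v) - T x) (fderiv ℝ T x v)).trans hTay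
  calc (h ^ 2)⁻¹ * ((‖T (x + v) - T x‖ + ‖fderiv ℝ T x v‖)
        * |‖T (x + v) - T x‖ - ‖fderiv ℝ T x v‖|)
      ≤ (h ^ 2)⁻¹ * ((L * ‖v‖ + L * ‖v‖) * (M * ‖v‖ * ‖v‖)) := by gcongr
    _ = (h ^ 2)⁻¹ * (2 * L * M * ‖v‖ ^ 3) := by ring
    _ ≤ (h ^ 2)⁻¹ * ((L ^ 2 + M ^ 2) * (h * σmax * ‖z‖) ^ 3) := by
        gcongr
        nlinarith [sq_nonneg (L - M)]
    _ = _ := by field_simp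

/-- Indicator of the pairs `(x, z)` for which `x ∈ Ω` is within `a |z|` of the complement of `Ω`. -/
noncomputable def layerIndicator (Ω : Set (Eucl d)) (a : ℝ) (x z : Eucl d) : ℝ :=
  (boundaryLayer Ω (a * ‖z‖)).indicator 1 x

lemma layerIndicator_nonneg (a : ℝ) (x z : Eucl d) : 0 ≤ layerIndicator Ω a x z :=
  Set.indicator_nonneg (fun _ _ => zero_le_one) _

lemma layerIndicator_le_one (a : ℝ) (x z : Eucl d) : layerIndicator Ω a x z ≤ 1 :=
  Set.indicator_le_self' (fun _ _ => zero_le_one) x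

lemma measurable_layerIndicator (ho : IsOpen Ω) (a : ℝ) :
    Measurable fun p : Eucl d × Eucl d => layerIndicator Ω a p.1 p.2 := by
  have hn : Measurable fun p : Eucl d × Eucl d => a * ‖p.2‖ := by fun_prop
  have hS : MeasurableSet {p : Eucl d × Eucl d | p.1 ∈ Ω ∧ Metric.infDist p.1 Ωᶜ ≤ a * ‖p.2‖} := by
    refine (measurable_fst ho.measurableSet).inter (measurableSet_le ?_ hn)
    exact (Metric.continuous_infDist_pt _).measurable.comp measurable_fst
  have e : (fun p : Eucl d × Eucl d => layerIndicator Ω a p.1 p.2) =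
      {p : Eucl d × Eucl d | p.1 ∈ Ω ∧ Metric.infDist p.1 Ωᶜ ≤ a * ‖p.2‖}.indicator 1 := by
    ext p
    rfl
  rw [e]
  exact measurable_one.indicator hS

/-- Pointwise bound of the bias of numerator and denominator: order `h` away from the boundary,
order one in the boundary layer. -/
noncomputable def biasWeight (Ω : Set (Eucl d)) (σmax h : ℝ) (x z : Eucl d) : ℝ :=
  (1 + ‖z‖) ^ 3 * (h + layerIndicator Ω (h * σmax) x z)

lemma biasWeight_nonneg (hh : 0 < h) (x z : Eucl d) : 0 ≤ biasWeight Ω σmax h x z :=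
  mul_nonneg (by positivity) (add_nonneg hh.le (layerIndicator_nonneg _ _ _))

lemma measurable_biasWeight (ho : IsOpen Ω) (h : ℝ) :
    Measurable fun p : Eucl d × Eucl d => biasWeight Ω σmax h p.1 p.2 := by
  unfold biasWeight
  exact Measurable.mul (by fun_prop) ((measurable_layerIndicator ho _).const_add h)

lemma biasWeight_le (hh : 0 < h) (hh1 : h ≤ 1) (x z : Eucl d) :
    biasWeight Ω σmax h x z ≤ 2 * (1 + ‖z‖) ^ 4 := by
  have h1 : (1 + ‖z‖) ^ 3 ≤ (1 + ‖z‖) ^ 4 :=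
    pow_le_pow_right₀ (by linarith [norm_nonneg z]) (by norm_num)
  have h2 : h + layerIndicator Ω (h * σmax) x z ≤ 2 := by
    linarith [layerIndicator_le_one (Ω := Ω) (h * σmax) x z]
  have h3 : 0 ≤ h + layerIndicator Ω (h * σmax) x z :=
    add_nonneg hh.le (layerIndicator_nonneg _ _ _)
  unfold biasWeight
  calc _ ≤ (1 + ‖z‖) ^ 4 * 2 := by gcongr
    _ = _ := mul_comm _ _

lemma measurableSet_boundaryLayer (ho : IsOpen Ω) (t : ℝ) : MeasurableSet (boundaryLayer Ω t) :=
  ho.measurableSet.inter (measurableSet_le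
    (Metric.continuous_infDist_pt _).measurable measurable_const)

lemma integrable_layerIndicator (ho : IsOpen Ω) (μ : Measure (Eucl d)) [IsFiniteMeasure μ] (a : ℝ)
    (z : Eucl d) : Integrable (fun x => layerIndicator Ω a x z) μ := by
  refine Integrable.of_bound ((measurable_layerIndicator ho _).comp
    measurable_prodMk_right).aestronglyMeasurable 1 (ae_of_all _ fun x => ?_)
  rw [Real.norm_eq_abs]
  exact (abs_of_nonneg (layerIndicator_nonneg _ _ _)).le.trans (layerIndicator_le_one _ _ _)

lemma exists_integral_layerIndicator_le (hd : 1 ≤ d) (hD : RegularData Ω ρ σ σmin σmax) :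
    ∃ C : ℝ, 0 ≤ C ∧ ∀ a, 0 ≤ a → ∀ z,
      ∫ x, layerIndicator Ω a x z ∂dataMeasure Ω ρ ≤ C * (a * ‖z‖) := by
  obtain ⟨_, b, _, hb1, -, hb⟩ := hD.exists_bounds
  obtain ⟨C, hC, hlayer⟩ :=
    exists_volume_boundaryLayer_le hd hD.isOpen hD.isBounded hD.lipschitzBoundary
  refine ⟨b * C, by positivity, fun a ha z => ?_⟩
  have hS := measurableSet_boundaryLayer hD.isOpen (a * ‖z‖)
  have e1 : ∫ x, layerIndicator Ω a x z ∂dataMeasure Ω ρ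
      = (dataMeasure Ω ρ).real (boundaryLayer Ω (a * ‖z‖)) :=
    integral_indicator_one hS
  rw [e1, mul_assoc]
  refine ENNReal.toReal_le_of_le_ofReal (by positivity) ?_
  rw [dataMeasure, withDensity_apply _ hS, ENNReal.ofReal_mul (by linarith)]
  calc _ ≤ ∫⁻ _ in boundaryLayer Ω (a * ‖z‖), ENNReal.ofReal b ∂(volume.restrict Ω) :=
        lintegral_mono fun x => ENNReal.ofReal_le_ofReal (hb x).2
    _ = ENNReal.ofReal b * (volume.restrict Ω) (boundaryLayer Ω (a * ‖z‖)) :=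
        setLIntegral_const _ _
    _ ≤ _ := by
        gcongr
        exact (Measure.restrict_apply_le _ _).trans (hlayer _ (by positivity))

/-- The boundary layer only contributes at order `h` after averaging over `x`. This is where the
order of integration matters: for fixed `x` near the boundary the bias is of order one. -/
lemma exists_integral_biasWeight_le (hd : 1 ≤ d) (hD : RegularData Ω ρ σ σmin σmax)
    (hη : RegularKernel d η) :
    ∃ C : ℝ, 0 ≤ C ∧ ∀ h, 0 < h → h ≤ 1 →
      Integrable (fun x => ∫ z, biasWeight Ω σmax h x z ∂kernelMeasure d η) (dataMeasure Ω ρ) ∧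
      ∫ x, ∫ z, biasWeight Ω σmax h x z ∂kernelMeasure d η ∂dataMeasure Ω ρ ≤ C * h := by
  have := hη.isProbabilityMeasure
  have := hD.isProbabilityMeasure
  obtain ⟨C, hC, hlayer⟩ := exists_integral_layerIndicator_le hd hD
  set W := ∫ z : Eucl d, (1 + ‖z‖) ^ 4 ∂kernelMeasure d η with hW
  have hW1 : 1 ≤ W := hη.one_le_integral_weight
  have hσ := hD.max_pos
  refine ⟨(1 + C * σmax) * W, by positivity, fun h hh hh1 => ?_⟩
  have hint : Integrable (Function.uncurry (biasWeight Ω σmax h))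
      ((dataMeasure Ω ρ).prod (kernelMeasure d η)) := by
    refine Integrable.mono' ((hη.integrable_weight.comp_snd (dataMeasure Ω ρ)).const_mul 2)
      (measurable_biasWeight hD.isOpen h).aestronglyMeasurable (ae_of_all _ fun p => ?_)
    rw [Real.norm_eq_abs]
    exact (abs_of_nonneg (biasWeight_nonneg hh p.1 p.2)).le.trans (biasWeight_le hh hh1 p.1 p.2)
  refine ⟨hint.integral_prod_left, ?_⟩
  rw [integral_integral_swap hint]
  have hinner : ∀ z : Eucl d, ∫ x, biasWeight Ω σmax h x z ∂dataMeasure Ω ρ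
      ≤ (1 + C * σmax) * h * (1 + ‖z‖) ^ 4 := by
    intro z
    have hz := norm_nonneg z
    unfold biasWeight
    rw [integral_const_mul, integral_add (integrable_const _)
      (integrable_layerIndicator hD.isOpen _ _ z)]
    simp only [integral_const, probReal_univ, smul_eq_mul, one_mul]
    calc _ ≤ (1 + ‖z‖) ^ 3 * (h + C * (h * σmax * ‖z‖)) := by
          gcongr
          exact hlayer _ (by positivity) z
      _ ≤ (1 + ‖z‖) ^ 3 * ((1 + C * σmax) * h * (1 + ‖z‖)) := by
          have h1 : 0 ≤ C * σmax * h := by positivity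
          have h2 : 0 ≤ h * ‖z‖ := by positivity
          refine mul_le_mul_of_nonneg_left ?_ (by positivity)
          linarith
      _ = _ := by ring
  refine (integral_mono hint.integral_prod_right (hη.integrable_weight.const_mul _) hinner).trans
    (le_of_eq ?_)
  rw [integral_const_mul, ← hW]
  ring

end Bias

section PointwiseBias

variable {d m : ℕ} {η : ℝ → ℝ} {Ω : Set (Eucl d)} {ρ σ : Eucl d → ℝ} {σmin σmax : ℝ}
  {T : Eucl d → Eucl m} {L M h b Lρ : ℝ}

-- keeps unification from unfolding the logarithms when measurable maps are composed
attribute [local irreducible] logTerm logDeriv biasWeight layerIndicator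

lemma pow_three_le_biasWeight (hh : 0 < h) {x z : Eucl d}
    (hx : x ∈ boundaryLayer Ω (h * σmax * ‖z‖)) : (1 + ‖z‖) ^ 3 ≤ biasWeight Ω σmax h x z := by
  have h1 : layerIndicator Ω (h * σmax) x z = 1 := by
    unfold layerIndicator
    exact Set.indicator_of_mem hx _
  rw [biasWeight, h1]
  exact le_mul_of_one_le_right (by positivity) (by linarith)

lemma mul_pow_three_le_biasWeight (x z : Eucl d) :
    h * (1 + ‖z‖) ^ 3 ≤ biasWeight Ω σmax h x z := by
  rw [biasWeight, mul_comm]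
  have := layerIndicator_nonneg (Ω := Ω) (h * σmax) x z
  gcongr
  linarith

lemma norm_pow_le_weight (z : Eucl d) {k : ℕ} (hk : k ≤ 3) : ‖z‖ ^ k ≤ (1 + ‖z‖) ^ 3 := by
  have hz := norm_nonneg z
  calc ‖z‖ ^ k ≤ (1 + ‖z‖) ^ k := by gcongr; linarith
    _ ≤ _ := pow_le_pow_right₀ (by linarith) hk

lemma mem_of_notMem_boundaryLayer (hD : RegularData Ω ρ σ σmin σmax) (hh : 0 < h) {x z : Eucl d}
    (hx : x ∈ Ω) (hz : x ∉ boundaryLayer Ω (h * σmax * ‖z‖)) : x + (σ x * h) • z ∈ Ω := by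
  refine closedBall_subset_of_notMem_boundaryLayer hx hz ?_
  rw [Metric.mem_closedBall, dist_eq_norm, add_sub_cancel_left]
  exact hD.norm_smul_le hh x z

lemma RegularData.abs_density_sub_le (hD : RegularData Ω ρ σ σmin σmax) (hh : 0 < h) (hLρ : 0 ≤ Lρ)
    (hl : ∀ x ∈ Ω, ∀ y ∈ Ω, |ρ x - ρ y| ≤ Lρ * ‖x - y‖) (hb : ∀ x, 0 ≤ ρ x ∧ ρ x ≤ b)
    {x : Eucl d} (hx : x ∈ Ω) (z : Eucl d) :
    |ρ (x + (σ x * h) • z) - ρ x| ≤ (Lρ * σmax + b) * biasWeight Ω σmax h x z := by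
  have hσ := hD.max_pos
  have hb0 : 0 ≤ b := (hb x).1.trans (hb x).2
  have hw := biasWeight_nonneg (Ω := Ω) (σmax := σmax) hh x z
  rw [add_mul]
  by_cases hz : x ∈ boundaryLayer Ω (h * σmax * ‖z‖)
  · have h1 := pow_three_le_biasWeight hh hz
    have h2 : 1 ≤ (1 + ‖z‖) ^ 3 := one_le_pow₀ (by linarith [norm_nonneg z])
    have h3 : |ρ (x + (σ x * h) • z) - ρ x| ≤ b := by
      obtain ⟨a1, a2⟩ := hb x
      obtain ⟨a3, a4⟩ := hb (x + (σ x * h) • z)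
      rw [abs_le]; constructor <;> linarith
    have h4 : b * 1 ≤ b * biasWeight Ω σmax h x z := by gcongr; linarith
    have h5 : 0 ≤ Lρ * σmax * biasWeight Ω σmax h x z := by positivity
    linarith
  · have hy := mem_of_notMem_boundaryLayer hD hh hx hz
    have h1 := hl _ hy x hx
    rw [add_sub_cancel_left] at h1
    have h2 : 0 ≤ b * biasWeight Ω σmax h x z := by positivity
    calc _ ≤ Lρ * (h * σmax * ‖z‖) := h1.trans (by gcongr; exact hD.norm_smul_le hh x z)
      _ = Lρ * σmax * (h * ‖z‖ ^ 1) := by ring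
      _ ≤ Lρ * σmax * (h * (1 + ‖z‖) ^ 3) := by
          gcongr
          exact norm_pow_le_weight z (by norm_num)
      _ ≤ Lρ * σmax * biasWeight Ω σmax h x z := by
          gcongr
          exact mul_pow_three_le_biasWeight x z
      _ ≤ _ := by linarith

lemma RegularMap.logTerm_mul_density_le (hT : RegularMap Ω T L M)
    (hD : RegularData Ω ρ σ σmin σmax) (hh : 0 < h) (hb : ∀ x, 0 ≤ ρ x ∧ ρ x ≤ b) {x : Eucl d}
    (hx : x ∈ Ω) (z : Eucl d) :
    logTerm T h x (x + (σ x * h) • z) * ρ (x + (σ x * h) • z)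
      ≤ L ^ 2 * (σmax ^ 2 * ‖z‖ ^ 2) * b := by
  obtain ⟨a1, a2⟩ := hb (x + (σ x * h) • z)
  by_cases hz : x + (σ x * h) • z ∈ Ω
  · have := hT.logTerm_smul_le hD hh hx hz
    gcongr
  · rw [hD.density_eq_zero _ hz, mul_zero]
    have : 0 ≤ b := a1.trans a2
    positivity

lemma RegularMap.abs_logTerm_mul_density_sub_le (hT : RegularMap Ω T L M)
    (hD : RegularData Ω ρ σ σmin σmax) (hh : 0 < h) (hLρ : 0 ≤ Lρ)
    (hl : ∀ x ∈ Ω, ∀ y ∈ Ω, |ρ x - ρ y| ≤ Lρ * ‖x - y‖) (hb : ∀ x, 0 ≤ ρ x ∧ ρ x ≤ b)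
    {x : Eucl d} (hx : x ∈ Ω) (z : Eucl d) :
    |logTerm T h x (x + (σ x * h) • z) * ρ (x + (σ x * h) • z) - logDeriv σ T x z * ρ x|
      ≤ (L ^ 2 + M ^ 2) * (b * σmax ^ 3 + Lρ * σmax ^ 3 + b * σmax ^ 2)
        * biasWeight Ω σmax h x z := by
  have hσ := hD.max_pos
  have hb0 : 0 ≤ b := (hb x).1.trans (hb x).2
  have hw := biasWeight_nonneg (Ω := Ω) (σmax := σmax) hh x z
  have hLM : L ^ 2 ≤ L ^ 2 + M ^ 2 := by linarith [sq_nonneg M]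
  have hκ : 0 ≤ L ^ 2 + M ^ 2 := by positivity
  have hq0 := logDeriv_nonneg σ T x z
  have hq := hT.logDeriv_le hD hx z
  have hG0 := logTerm_nonneg T h x (x + (σ x * h) • z)
  have hGρ := hT.logTerm_mul_density_le hD hh hb hx z
  set G := logTerm T h x (x + (σ x * h) • z)
  set q := logDeriv σ T x z
  obtain ⟨a1, a2⟩ := hb x
  have hy := hb (x + (σ x * h) • z)
  have e1 : 0 ≤ (L ^ 2 + M ^ 2) * (b * σmax ^ 3) * biasWeight Ω σmax h x z := by positivity
  have e2 : 0 ≤ (L ^ 2 + M ^ 2) * (Lρ * σmax ^ 3) * biasWeight Ω σmax h x z := by positivity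
  have e3 : 0 ≤ (L ^ 2 + M ^ 2) * (b * σmax ^ 2) * biasWeight Ω σmax h x z := by positivity
  by_cases hz : x ∈ boundaryLayer Ω (h * σmax * ‖z‖)
  · -- in the boundary layer, both terms are bounded separately
    have hqρ : q * ρ x ≤ L ^ 2 * (σmax ^ 2 * ‖z‖ ^ 2) * b := by gcongr
    have h1 : |G * ρ (x + (σ x * h) • z) - q * ρ x| ≤ L ^ 2 * (σmax ^ 2 * ‖z‖ ^ 2) * b := by
      have g0 : 0 ≤ G * ρ (x + (σ x * h) • z) := mul_nonneg hG0 hy.1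
      have g1 : 0 ≤ q * ρ x := mul_nonneg hq0 a1
      rw [abs_le]; constructor <;> linarith
    have h2 : L ^ 2 * (σmax ^ 2 * ‖z‖ ^ 2) * b
        ≤ (L ^ 2 + M ^ 2) * (b * σmax ^ 2) * biasWeight Ω σmax h x z := by
      calc L ^ 2 * (σmax ^ 2 * ‖z‖ ^ 2) * b = L ^ 2 * (b * σmax ^ 2) * ‖z‖ ^ 2 := by ring
        _ ≤ _ := by
          gcongr
          exact (norm_pow_le_weight z (by norm_num)).trans (pow_three_le_biasWeight hh hz)
    linarith
  · have hyΩ := mem_of_notMem_boundaryLayer hD hh hx hz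
    have h1 := hT.abs_logTerm_sub_logDeriv_le hD hh hx hz
    have h2 := hl _ hyΩ x hx
    rw [add_sub_cancel_left] at h2
    have h3 : h * ‖z‖ ^ 3 ≤ biasWeight Ω σmax h x z :=
      (mul_le_mul_of_nonneg_left (norm_pow_le_weight z le_rfl) hh.le).trans
        (mul_pow_three_le_biasWeight x z)
    have h4 : |G - q| * ρ (x + (σ x * h) • z)
        ≤ (L ^ 2 + M ^ 2) * (b * σmax ^ 3) * biasWeight Ω σmax h x z := by
      calc _ ≤ (L ^ 2 + M ^ 2) * (h * (σmax ^ 3 * ‖z‖ ^ 3)) * b := by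
            gcongr
            · exact hy.1
            · exact hy.2
        _ = (L ^ 2 + M ^ 2) * (b * σmax ^ 3) * (h * ‖z‖ ^ 3) := by ring
        _ ≤ _ := by gcongr
    have h5 : q * |ρ (x + (σ x * h) • z) - ρ x|
        ≤ (L ^ 2 + M ^ 2) * (Lρ * σmax ^ 3) * biasWeight Ω σmax h x z := by
      calc _ ≤ (L ^ 2 + M ^ 2) * (σmax ^ 2 * ‖z‖ ^ 2) * (Lρ * (h * σmax * ‖z‖)) := by
            refine mul_le_mul (hq.trans (by gcongr)) (h2.trans ?_) (abs_nonneg _) (by positivity)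
            gcongr
            exact hD.norm_smul_le hh x z
        _ = (L ^ 2 + M ^ 2) * (Lρ * σmax ^ 3) * (h * ‖z‖ ^ 3) := by ring
        _ ≤ _ := by gcongr
    have e : G * ρ (x + (σ x * h) • z) - q * ρ x
        = (G - q) * ρ (x + (σ x * h) • z) + q * (ρ (x + (σ x * h) • z) - ρ x) := by ring
    rw [e]
    refine (abs_add_le _ _).trans ?_
    rw [abs_mul, abs_mul, abs_of_nonneg hy.1, abs_of_nonneg hq0]
    linarith

lemma measurable_translate (hD : RegularData Ω ρ σ σmin σmax) (h : ℝ) :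
    Measurable fun p : Eucl d × Eucl d => p.1 + (σ p.1 * h) • p.2 :=
  measurable_fst.add (((hD.measurable_bandwidth.comp measurable_fst).mul_const h).smul
    measurable_snd)

lemma measurable_logTerm_translate (hD : RegularData Ω ρ σ σmin σmax) (hT : Measurable T) (h : ℝ) :
    Measurable fun p : Eucl d × Eucl d => logTerm T h p.1 (p.1 + (σ p.1 * h) • p.2) :=
  (measurable_logTerm hT h).comp (measurable_fst.prodMk (measurable_translate hD h))

lemma RegularMap.integrable_logDeriv (hT : RegularMap Ω T L M)
    (hD : RegularData Ω ρ σ σmin σmax) (hη : RegularKernel d η) {x : Eucl d} (hx : x ∈ Ω) :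
    Integrable (fun z => logDeriv σ T x z) (kernelMeasure d η) ∧
      |∫ z, logDeriv σ T x z ∂kernelMeasure d η|
        ≤ L ^ 2 * σmax ^ 2 * ∫ z : Eucl d, (1 + ‖z‖) ^ 4 ∂kernelMeasure d η := by
  have hqb : ∀ z, |logDeriv σ T x z| ≤ L ^ 2 * σmax ^ 2 * (1 + ‖z‖) ^ 4 := by
    intro z
    rw [abs_of_nonneg (logDeriv_nonneg _ _ _ _), mul_assoc]
    refine (hT.logDeriv_le hD hx z).trans ?_
    gcongr
    exact (norm_pow_le_weight z (by norm_num)).trans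
      (pow_le_pow_right₀ (by linarith [norm_nonneg z]) (by norm_num))
  exact ⟨hη.integrable_of_bound ((measurable_logDeriv T hD.measurable_bandwidth).comp
    measurable_prodMk_left) hqb, hη.abs_integral_le hqb⟩

/-- The bias at a point, in terms of the weight that measures the proximity to the boundary. -/
lemma exists_abs_localAttraction_sub_le (hd : 1 ≤ d) (hD : RegularData Ω ρ σ σmin σmax)
    (hη : RegularKernel d η) :
    ∃ C h₀ : ℝ, 0 ≤ C ∧ 0 < h₀ ∧ h₀ ≤ 1 ∧
      ∀ {m : ℕ} (T : Eucl d → Eucl m) (L M : ℝ), RegularMap Ω T L M →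
      ∀ h, 0 < h → h ≤ h₀ → ∀ x ∈ Ω,
      |localAttraction η ρ σ T h x - ∫ z, logDeriv σ T x z ∂kernelMeasure d η|
        ≤ C * (L ^ 2 + M ^ 2) * ∫ z, biasWeight Ω σmax h x z ∂kernelMeasure d η := by
  have := hη.isProbabilityMeasure
  obtain ⟨_, b, _, hb1, -, hb⟩ := hD.exists_bounds
  obtain ⟨⟨Lρ, hLρ⟩, hlip⟩ := hD.lipschitz
  have hl : ∀ x ∈ Ω, ∀ y ∈ Ω, |ρ x - ρ y| ≤ Lρ * ‖x - y‖ := by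
    intro x hx y hy
    have := hlip.dist_le_mul x hx y hy
    rwa [dist_eq_norm, dist_eq_norm, Real.norm_eq_abs] at this
  obtain ⟨c₀, h₀, hc₀, hh₀, hlow⟩ := hD.exists_le_integral_density hd hη
  set W := ∫ z : Eucl d, (1 + ‖z‖) ^ 4 ∂kernelMeasure d η with hW
  have hW1 : 1 ≤ W := hη.one_le_integral_weight
  have hσ := hD.max_pos
  set C₁ := b * σmax ^ 3 + Lρ * σmax ^ 3 + b * σmax ^ 2 with hC₁
  refine ⟨(C₁ + σmax ^ 2 * W * (Lρ * σmax + b)) / c₀, min h₀ 1, by positivity,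
    lt_min hh₀ one_pos, min_le_right _ _, ?_⟩
  intro m T L M hT h hh hhh x hx
  have hh1 : h ≤ 1 := hhh.trans (min_le_right _ _)
  set K := ∫ z, biasWeight Ω σmax h x z ∂kernelMeasure d η with hK
  have hbw0 := fun z => biasWeight_nonneg (Ω := Ω) (σmax := σmax) hh x z
  have hK0 : 0 ≤ K := integral_nonneg hbw0
  have hbwi : Integrable (fun z => biasWeight Ω σmax h x z) (kernelMeasure d η) :=
    hη.integrable_of_bound ((measurable_biasWeight hD.isOpen h).comp measurable_prodMk_left)
      (c := 2) fun z => by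
        rw [abs_of_nonneg (hbw0 z)]; exact biasWeight_le hh hh1 x z
  have hz4 : ∀ z : Eucl d, ‖z‖ ^ 2 ≤ (1 + ‖z‖) ^ 4 := fun z =>
    (norm_pow_le_weight z (by norm_num)).trans
      (pow_le_pow_right₀ (by linarith [norm_nonneg z]) (by norm_num))
  obtain ⟨hqi, hΦb⟩ := hT.integrable_logDeriv hD hη hx
  have hρm : Measurable fun z => ρ (x + (σ x * h) • z) :=
    hD.measurable_density.comp ((measurable_translate hD h).comp measurable_prodMk_left)
  have hρi : Integrable (fun z => ρ (x + (σ x * h) • z)) (kernelMeasure d η) := by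
    refine Integrable.of_bound hρm.aestronglyMeasurable b (ae_of_all _ fun z => ?_)
    rw [Real.norm_eq_abs, abs_of_nonneg (hb _).1]
    exact (hb _).2
  have hGi : Integrable (fun z => logTerm T h x (x + (σ x * h) • z) * ρ (x + (σ x * h) • z))
      (kernelMeasure d η) := by
    refine hη.integrable_of_bound (((measurable_logTerm_translate hD hT.measurable h).comp
      measurable_prodMk_left).mul hρm) (c := L ^ 2 * σmax ^ 2 * b) fun z => ?_
    rw [abs_of_nonneg (mul_nonneg (logTerm_nonneg _ _ _ _) (hb _).1)]
    calc _ ≤ L ^ 2 * (σmax ^ 2 * ‖z‖ ^ 2) * b := hT.logTerm_mul_density_le hD hh hb hx z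
      _ = L ^ 2 * σmax ^ 2 * b * ‖z‖ ^ 2 := by ring
      _ ≤ _ := mul_le_mul_of_nonneg_left (hz4 z) (by positivity)
  have hDlow := hlow x hx h hh (hhh.trans (min_le_left _ _))
  unfold localAttraction
  set N := ∫ z, logTerm T h x (x + (σ x * h) • z) * ρ (x + (σ x * h) • z) ∂kernelMeasure d η
    with hN
  set D := ∫ z, ρ (x + (σ x * h) • z) ∂kernelMeasure d η with hDdef
  set Φ := ∫ z, logDeriv σ T x z ∂kernelMeasure d η with hΦ
  have hD0 : 0 < D := hc₀.trans_le hDlow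
  have b1 : |N - Φ * ρ x| ≤ (L ^ 2 + M ^ 2) * C₁ * K := by
    have e : N - Φ * ρ x = ∫ z, (logTerm T h x (x + (σ x * h) • z) * ρ (x + (σ x * h) • z)
        - logDeriv σ T x z * ρ x) ∂kernelMeasure d η := by
      rw [integral_sub hGi (hqi.mul_const _), integral_mul_const]
    rw [e, hK, ← integral_const_mul, ← Real.norm_eq_abs]
    refine norm_integral_le_of_norm_le (hbwi.const_mul _) (ae_of_all _ fun z => ?_)
    rw [Real.norm_eq_abs]
    exact hT.abs_logTerm_mul_density_sub_le hD hh hLρ hl hb hx z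
  have b2 : |D - ρ x| ≤ (Lρ * σmax + b) * K := by
    have e : D - ρ x = ∫ z, (ρ (x + (σ x * h) • z) - ρ x) ∂kernelMeasure d η := by
      rw [integral_sub hρi (integrable_const _)]
      simp [hDdef]
    rw [e, hK, ← integral_const_mul, ← Real.norm_eq_abs]
    refine norm_integral_le_of_norm_le (hbwi.const_mul _) (ae_of_all _ fun z => ?_)
    rw [Real.norm_eq_abs]
    exact hD.abs_density_sub_le hh hLρ hl hb hx z
  have e : N / D - Φ = ((N - Φ * ρ x) - Φ * (D - ρ x)) / D := by
    field_simp
    ring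
  rw [e, abs_div, abs_of_pos hD0, div_le_iff₀ hD0]
  have hκ : 0 ≤ L ^ 2 + M ^ 2 := by positivity
  calc |N - Φ * ρ x - Φ * (D - ρ x)| ≤ |N - Φ * ρ x| + |Φ| * |D - ρ x| := by
        rw [← abs_mul]; exact abs_sub _ _
    _ ≤ (L ^ 2 + M ^ 2) * C₁ * K + (L ^ 2 * σmax ^ 2 * W) * ((Lρ * σmax + b) * K) := by gcongr
    _ ≤ (L ^ 2 + M ^ 2) * C₁ * K + ((L ^ 2 + M ^ 2) * σmax ^ 2 * W) * ((Lρ * σmax + b) * K) := by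
        gcongr
        linarith [sq_nonneg M]
    _ = (C₁ + σmax ^ 2 * W * (Lρ * σmax + b)) / c₀ * (L ^ 2 + M ^ 2) * K * c₀ := by
        field_simp
    _ ≤ _ := by gcongr

lemma RegularMap.integrable_integral_logDeriv (hT : RegularMap Ω T L M)
    (hD : RegularData Ω ρ σ σmin σmax) (hη : RegularKernel d η) :
    Integrable (fun x => ∫ z, logDeriv σ T x z ∂kernelMeasure d η) (dataMeasure Ω ρ) := by
  have := hη.isProbabilityMeasure
  have := hD.isProbabilityMeasure
  have hm := (measurable_logDeriv T hD.measurable_bandwidth).stronglyMeasurable.integral_prod_right'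
    (ν := kernelMeasure d η)
  refine Integrable.of_bound hm.aestronglyMeasurable
    (L ^ 2 * σmax ^ 2 * ∫ z : Eucl d, (1 + ‖z‖) ^ 4 ∂kernelMeasure d η) ?_
  filter_upwards [RegularData.ae_mem hD.toDataAssumption] with x hx
  exact (hT.integrable_logDeriv hD hη hx).2

/-- The deterministic part of the error: the averaged bias is of order `h`. -/
theorem exists_bias_le (hd : 1 ≤ d) (hD : RegularData Ω ρ σ σmin σmax) (hη : RegularKernel d η) :
    ∃ C h₀ : ℝ, 0 ≤ C ∧ 0 < h₀ ∧ h₀ ≤ 1 ∧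
      ∀ {m : ℕ} (T : Eucl d → Eucl m) (L M : ℝ), RegularMap Ω T L M → ∀ h, 0 < h → h ≤ h₀ →
      |∫ x, localAttraction η ρ σ T h x ∂dataMeasure Ω ρ
        - ∫ x, ∫ z, logDeriv σ T x z ∂kernelMeasure d η ∂dataMeasure Ω ρ|
        ≤ C * (L ^ 2 + M ^ 2) * h := by
  have := hη.isProbabilityMeasure
  have := hD.isProbabilityMeasure
  obtain ⟨C₁, h₀, hC₁, hh₀, hh₀1, hpt⟩ := exists_abs_localAttraction_sub_le hd hD hη
  obtain ⟨C₂, hC₂, hw⟩ := exists_integral_biasWeight_le hd hD hη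
  refine ⟨C₁ * C₂, h₀, by positivity, hh₀, hh₀1, fun {m} T L M hT h hh hhh => ?_⟩
  obtain ⟨hwi, hwle⟩ := hw h hh (hhh.trans hh₀1)
  have hΦi := hT.integrable_integral_logDeriv hD hη
  have hdom : ∀ᵐ x ∂dataMeasure Ω ρ,
      ‖localAttraction η ρ σ T h x - ∫ z, logDeriv σ T x z ∂kernelMeasure d η‖
        ≤ C₁ * (L ^ 2 + M ^ 2) * ∫ z, biasWeight Ω σmax h x z ∂kernelMeasure d η := by
    filter_upwards [RegularData.ae_mem hD.toDataAssumption] with x hx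
    exact hpt T L M hT h hh hhh x hx
  have hlm : Measurable fun x => localAttraction η ρ σ T h x := by
    have h1 := hD.measurable_density.comp (measurable_translate hD h)
    have h2 := (measurable_logTerm_translate hD hT.measurable h).mul h1
    exact (h2.stronglyMeasurable.integral_prod_right' (ν := kernelMeasure d η)).measurable.div
      (h1.stronglyMeasurable.integral_prod_right' (ν := kernelMeasure d η)).measurable
  have hdi : Integrable (fun x => localAttraction η ρ σ T h x
      - ∫ z, logDeriv σ T x z ∂kernelMeasure d η) (dataMeasure Ω ρ) :=
    (hwi.const_mul _).mono' (hlm.aestronglyMeasurable.sub hΦi.aestronglyMeasurable) hdom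
  have hli : Integrable (fun x => localAttraction η ρ σ T h x) (dataMeasure Ω ρ) := by
    refine (hdi.add hΦi).congr (ae_of_all _ fun x => ?_)
    simp
  rw [← integral_sub hli hΦi]
  refine (norm_integral_le_of_norm_le (hwi.const_mul _) hdom).trans ?_
  rw [integral_const_mul]
  calc _ ≤ C₁ * (L ^ 2 + M ^ 2) * (C₂ * h) := by gcongr
    _ = _ := by ring

end PointwiseBias

/-! ### Extended-real integrals and the continuum attraction -/

section ExtendedIntegral

variable {α : Type*} [MeasurableSpace α] {μ : Measure α}

lemma eintegral_congr_ae {f g : α → EReal} (h : f =ᵐ[μ] g) : eintegral μ f = eintegral μ g := by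
  have h1 : ∫⁻ x, (f x).toENNReal ∂μ = ∫⁻ x, (g x).toENNReal ∂μ :=
    lintegral_congr_ae (h.mono fun x hx => by simp only [hx])
  have h2 : ∫⁻ x, (-f x).toENNReal ∂μ = ∫⁻ x, (-g x).toENNReal ∂μ :=
    lintegral_congr_ae (h.mono fun x hx => by simp only [hx])
  rw [eintegral, eintegral, h1, h2]

lemma eintegral_coe {f : α → ℝ} (hf : Integrable f μ) :
    eintegral μ (fun x => (f x : EReal)) = ((∫ x, f x ∂μ : ℝ) : EReal) := by
  rw [integral_eq_lintegral_pos_part_sub_lintegral_neg_part hf, EReal.coe_sub,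
    EReal.coe_ennreal_toReal hf.lintegral_lt_top.ne,
    EReal.coe_ennreal_toReal (x := ∫⁻ x, ENNReal.ofReal (-f x) ∂μ) hf.neg.lintegral_lt_top.ne]
  rfl

/-- Monotone convergence for a nonincreasing sequence of integrable functions whose limit may take
the value `-∞` and may have integral `-∞`. -/
lemma tendsto_integral_eintegral {f : ℕ → α → ℝ} {F : α → EReal} (hf : ∀ k, Integrable (f k) μ)
    (hanti : ∀ᵐ x ∂μ, Antitone fun k => f k x)
    (hlim : ∀ᵐ x ∂μ, Tendsto (fun k => (f k x : EReal)) atTop (𝓝 (F x))) :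
    Tendsto (fun k => ((∫ x, f k x ∂μ : ℝ) : EReal)) atTop (𝓝 (eintegral μ F)) := by
  have h1 : Tendsto (fun k => ∫⁻ x, ENNReal.ofReal (f k x) ∂μ) atTop
      (𝓝 (∫⁻ x, (F x).toENNReal ∂μ)) := by
    refine lintegral_tendsto_of_tendsto_of_antitone
      (fun k => (hf k).aestronglyMeasurable.aemeasurable.ennreal_ofReal) ?_
      (hf 0).lintegral_lt_top.ne ?_
    · filter_upwards [hanti] with x hx i j hij
      exact ENNReal.ofReal_le_ofReal (hx hij)
    · filter_upwards [hlim] with x hx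
      exact (EReal.continuous_toENNReal.tendsto _).comp hx
  have h2 : Tendsto (fun k => ∫⁻ x, ENNReal.ofReal (-f k x) ∂μ) atTop
      (𝓝 (∫⁻ x, (-F x).toENNReal ∂μ)) := by
    refine lintegral_tendsto_of_tendsto_of_monotone
      (fun k => (hf k).aestronglyMeasurable.aemeasurable.neg.ennreal_ofReal) ?_ ?_
    · filter_upwards [hanti] with x hx i j hij
      exact ENNReal.ofReal_le_ofReal (neg_le_neg (hx hij))
    · filter_upwards [hlim] with x hx
      exact (EReal.continuous_toENNReal.tendsto _).comp ((continuous_neg.tendsto _).comp hx)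
  have hfin : ∫⁻ x, (F x).toENNReal ∂μ ≠ ∞ := by
    refine ne_top_of_le_ne_top (hf 0).lintegral_lt_top.ne (lintegral_mono_ae ?_)
    filter_upwards [hanti, hlim] with x hx hx'
    refine EReal.toENNReal_le_toENNReal (y := (f 0 x : EReal)) ?_
    exact le_of_tendsto' hx' fun k => EReal.coe_le_coe_iff.2 (hx (Nat.zero_le k))
  have h3 : Tendsto (fun k => ((∫⁻ x, ENNReal.ofReal (f k x) ∂μ : ℝ≥0∞) : EReal)
      + -((∫⁻ x, ENNReal.ofReal (-f k x) ∂μ : ℝ≥0∞) : EReal)) atTop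
      (𝓝 (((∫⁻ x, (F x).toENNReal ∂μ : ℝ≥0∞) : EReal)
        + -((∫⁻ x, (-F x).toENNReal ∂μ : ℝ≥0∞) : EReal))) := by
    have hc := EReal.continuousAt_add
      (p := (((∫⁻ x, (F x).toENNReal ∂μ : ℝ≥0∞) : EReal),
        -((∫⁻ x, (-F x).toENNReal ∂μ : ℝ≥0∞) : EReal)))
      (Or.inl (by simpa using hfin)) (Or.inl (EReal.coe_ennreal_ne_bot _))
    exact hc.tendsto.comp (((continuous_coe_ennreal_ereal.tendsto _).comp h1).prodMk_nhds
      ((continuous_neg.tendsto _).comp ((continuous_coe_ennreal_ereal.tendsto _).comp h2)))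
  rw [← sub_eq_add_neg] at h3
  refine h3.congr fun k => ?_
  rw [← sub_eq_add_neg]
  exact eintegral_coe (hf k)

end ExtendedIntegral

section Continuum

variable {d m : ℕ} {η : ℝ → ℝ} {Ω : Set (Eucl d)} {ρ σ : Eucl d → ℝ} {σmin σmax : ℝ}
  {T : Eucl d → Eucl m} {L M : ℝ}

lemma RegularMap.const_smul (hT : RegularMap Ω T L M) {s : ℝ} (hs : 0 < s) :
    RegularMap Ω (fun x => s • T x) (s * L) (s * M) where
  measurable := hT.measurable.const_smul s
  differentiableAt x hx := (hT.differentiableAt x hx).const_smul s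
  nonneg := mul_nonneg hs.le hT.nonneg
  nonneg_fderiv := mul_nonneg hs.le hT.nonneg_fderiv
  lipschitz x hx y hy := by
    rw [← smul_sub, norm_smul, Real.norm_eq_abs, abs_of_pos hs, mul_assoc]
    have := hT.lipschitz x hx y hy
    gcongr
  lipschitz_fderiv x hx y hy := by
    have e : s • fderiv ℝ T x - s • fderiv ℝ T y = s • (fderiv ℝ T x - fderiv ℝ T y) :=
      (smul_sub _ _ _).symm
    rw [fderiv_fun_const_smul (hT.differentiableAt x hx),
      fderiv_fun_const_smul (hT.differentiableAt y hy), e, norm_smul, Real.norm_eq_abs,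
      abs_of_pos hs, mul_assoc]
    have := hT.lipschitz_fderiv x hx y hy
    gcongr

lemma RegularMap.logDeriv_const_smul (hT : RegularMap Ω T L M) {x : Eucl d} (hx : x ∈ Ω) (s : ℝ)
    (z : Eucl d) : logDeriv σ (fun y => s • T y) x z
      = Real.log (1 + s ^ 2 * ‖(σ x • fderiv ℝ T x) z‖ ^ 2) := by
  unfold logDeriv
  rw [fderiv_fun_const_smul (hT.differentiableAt x hx), smul_comm, smul_apply, norm_smul, mul_pow,
    Real.norm_eq_abs, sq_abs]

/-- `log (s⁻² + u²) = log (1 + s² u²) - 2 log s`. -/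
lemma log_inv_sq_add_enorm_sq {E : Type*} [NormedAddCommGroup E] {s : ℝ} (hs : 0 < s) (v : E) :
    ENNReal.log ((ENNReal.ofReal s)⁻¹ ^ 2 + ‖v‖ₑ ^ 2)
      = ((Real.log (1 + s ^ 2 * ‖v‖ ^ 2) - 2 * Real.log s : ℝ) : EReal) := by
  have e : (ENNReal.ofReal s)⁻¹ ^ 2 + ‖v‖ₑ ^ 2 = ENNReal.ofReal (s⁻¹ ^ 2 + ‖v‖ ^ 2) := by
    rw [ENNReal.ofReal_add (by positivity) (by positivity), ENNReal.ofReal_pow (by positivity),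
      ENNReal.ofReal_pow (by positivity), ENNReal.ofReal_inv_of_pos hs, ofReal_norm]
  have hpos : 0 < s⁻¹ ^ 2 + ‖v‖ ^ 2 := by positivity
  rw [e, ENNReal.log_ofReal, if_neg (not_le.2 hpos)]
  congr 1
  have e2 : s⁻¹ ^ 2 + ‖v‖ ^ 2 = (1 + s ^ 2 * ‖v‖ ^ 2) / s ^ 2 := by field_simp
  rw [e2, Real.log_div (by positivity) (by positivity), Real.log_pow]
  norm_num

lemma logDeriv_const_smul_mono (hT : RegularMap Ω T L M) {x : Eucl d} (hx : x ∈ Ω) {a b : ℝ}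
    (ha : 0 < a) (hab : a ≤ b) (z : Eucl d) :
    logDeriv σ (fun y => a • T y) x z ≤ logDeriv σ (fun y => b • T y) x z ∧
    logDeriv σ (fun y => b • T y) x z
      ≤ logDeriv σ (fun y => a • T y) x z + 2 * (Real.log b - Real.log a) := by
  have hb : 0 < b := ha.trans_le hab
  rw [hT.logDeriv_const_smul hx, hT.logDeriv_const_smul hx]
  set v := ‖(σ x • fderiv ℝ T x) z‖ with hv
  refine ⟨Real.log_le_log (by positivity) (by gcongr), ?_⟩
  have h1 : Real.log (1 + b ^ 2 * v ^ 2) ≤ Real.log ((1 + a ^ 2 * v ^ 2) * (b ^ 2 / a ^ 2)) := by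
    refine Real.log_le_log (by positivity) ?_
    rw [mul_div_assoc', le_div_iff₀ (by positivity)]
    have : a ^ 2 ≤ b ^ 2 := by gcongr
    nlinarith
  refine h1.trans (le_of_eq ?_)
  rw [Real.log_mul (by positivity) (by positivity), Real.log_div (by positivity) (by positivity),
    Real.log_pow, Real.log_pow]
  push_cast
  ring

/-- The continuum attraction at finite `s`, as a real number. -/
noncomputable def realAttraction (Ω : Set (Eucl d)) (ρ : Eucl d → ℝ) (η : ℝ → ℝ) (σ : Eucl d → ℝ)
    (T : Eucl d → Eucl m) (s : ℝ) : ℝ :=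
  ∫ x, ∫ z, logDeriv σ (fun y => s • T y) x z ∂kernelMeasure d η ∂dataMeasure Ω ρ
    - 2 * Real.log s

attribute [local irreducible] logTerm logDeriv

/-- `Φ_s(σ DT)` for finite `s` is the real integral. -/
lemma RegularMap.Phi_eq (hT : RegularMap Ω T L M) (hD : RegularData Ω ρ σ σmin σmax)
    (hη : RegularKernel d η) {s : ℝ} (hs : 0 < s) {x : Eucl d} (hx : x ∈ Ω) :
    Phi η (ENNReal.ofReal s) (σ x • fderiv ℝ T x)
      = ((∫ z, logDeriv σ (fun y => s • T y) x z ∂kernelMeasure d η - 2 * Real.log s : ℝ) :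
        EReal) := by
  have := hη.isProbabilityMeasure
  have hi := ((hT.const_smul hs).integrable_logDeriv hD hη hx).1
  have e : ∫ z, (logDeriv σ (fun y => s • T y) x z - 2 * Real.log s) ∂kernelMeasure d η
      = ∫ z, logDeriv σ (fun y => s • T y) x z ∂kernelMeasure d η - 2 * Real.log s := by
    rw [integral_sub hi (integrable_const _)]
    simp
  have hi2 : Integrable (fun z => logDeriv σ (fun y => s • T y) x z - 2 * Real.log s)
      (kernelMeasure d η) := hi.sub (integrable_const _)
  rw [← e, ← eintegral_coe hi2]
  unfold Phi
  congr 1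
  ext1 z
  rw [log_inv_sq_add_enorm_sq hs, hT.logDeriv_const_smul hx]

lemma RegularMap.continuumAttraction_eq (hT : RegularMap Ω T L M)
    (hD : RegularData Ω ρ σ σmin σmax) (hη : RegularKernel d η) {s : ℝ} (hs : 0 < s) :
    continuumAttraction Ω ρ η σ (ENNReal.ofReal s) T = (realAttraction Ω ρ η σ T s : EReal) := by
  have := hD.isProbabilityMeasure
  have hi := (hT.const_smul hs).integrable_integral_logDeriv hD hη
  have e : realAttraction Ω ρ η σ T s = ∫ x, (∫ z, logDeriv σ (fun y => s • T y) x z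
      ∂kernelMeasure d η - 2 * Real.log s) ∂dataMeasure Ω ρ := by
    rw [integral_sub hi (integrable_const _)]
    simp [realAttraction]
  have hi2 : Integrable (fun x => ∫ z, logDeriv σ (fun y => s • T y) x z ∂kernelMeasure d η
      - 2 * Real.log s) (dataMeasure Ω ρ) := hi.sub (integrable_const _)
  rw [e, ← eintegral_coe hi2]
  refine eintegral_congr_ae ?_
  filter_upwards [RegularData.ae_mem hD.toDataAssumption] with x hx
  exact hT.Phi_eq hD hη hs hx

lemma RegularMap.integral_logDeriv_mono (hT : RegularMap Ω T L M)
    (hD : RegularData Ω ρ σ σmin σmax) (hη : RegularKernel d η) {a b : ℝ} (ha : 0 < a)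
    (hab : a ≤ b) {x : Eucl d} (hx : x ∈ Ω) :
    ∫ z, logDeriv σ (fun y => a • T y) x z ∂kernelMeasure d η
      ≤ ∫ z, logDeriv σ (fun y => b • T y) x z ∂kernelMeasure d η ∧
    ∫ z, logDeriv σ (fun y => b • T y) x z ∂kernelMeasure d η
      ≤ ∫ z, logDeriv σ (fun y => a • T y) x z ∂kernelMeasure d η
        + 2 * (Real.log b - Real.log a) := by
  have := hη.isProbabilityMeasure
  have hia := ((hT.const_smul ha).integrable_logDeriv hD hη hx).1
  have hib := ((hT.const_smul (ha.trans_le hab)).integrable_logDeriv hD hη hx).1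
  refine ⟨integral_mono hia hib fun z => (logDeriv_const_smul_mono hT hx ha hab z).1, ?_⟩
  refine (integral_mono hib (hia.add (integrable_const (2 * (Real.log b - Real.log a))))
    fun z => (logDeriv_const_smul_mono hT hx ha hab z).2).trans (le_of_eq ?_)
  simp only [Pi.add_apply]
  rw [integral_add hia (integrable_const _)]
  simp

/-- As a function of `s`, the attraction is nonincreasing, while it becomes nondecreasing after
adding `2 log s`. This gives continuity in `s` without any dominated convergence. -/
lemma RegularMap.realAttraction_mono (hT : RegularMap Ω T L M)
    (hD : RegularData Ω ρ σ σmin σmax) (hη : RegularKernel d η) {a b : ℝ} (ha : 0 < a)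
    (hab : a ≤ b) :
    realAttraction Ω ρ η σ T b ≤ realAttraction Ω ρ η σ T a ∧
    realAttraction Ω ρ η σ T a + 2 * Real.log a ≤ realAttraction Ω ρ η σ T b + 2 * Real.log b := by
  have := hD.isProbabilityMeasure
  have hia := (hT.const_smul ha).integrable_integral_logDeriv hD hη
  have hib := (hT.const_smul (ha.trans_le hab)).integrable_integral_logDeriv hD hη
  have hmem := RegularData.ae_mem hD.toDataAssumption
  have h1 := integral_mono_ae hia hib (hmem.mono fun x hx =>
    (hT.integral_logDeriv_mono hD hη ha hab hx).1)
  have h2 := integral_mono_ae hib (hia.add (integrable_const (2 * (Real.log b - Real.log a))))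
    (hmem.mono fun x hx => (hT.integral_logDeriv_mono hD hη ha hab hx).2)
  simp only [Pi.add_apply] at h2
  rw [integral_add hia (integrable_const _)] at h2
  simp only [integral_const, probReal_univ, smul_eq_mul, one_mul] at h2
  unfold realAttraction
  constructor <;> linarith

lemma RegularMap.tendsto_realAttraction (hT : RegularMap Ω T L M)
    (hD : RegularData Ω ρ σ σmin σmax) (hη : RegularKernel d η) {s : ℝ} (hs : 0 < s)
    {sc : ℕ → ℝ} (hsc : ∀ n, 0 < sc n) (hlim : Tendsto sc atTop (𝓝 s)) :
    Tendsto (fun n => realAttraction Ω ρ η σ T (sc n)) atTop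
      (𝓝 (realAttraction Ω ρ η σ T s)) := by
  rw [tendsto_iff_norm_sub_tendsto_zero]
  have hlog : Tendsto (fun n => 2 * |Real.log (sc n) - Real.log s|) atTop (𝓝 0) := by
    have h1 := (hlim.log hs.ne').sub_const (Real.log s)
    rw [sub_self] at h1
    simpa using (h1.abs).const_mul 2
  refine squeeze_zero (fun _ => norm_nonneg _) (fun n => ?_) hlog
  rw [Real.norm_eq_abs]
  rcases le_total (sc n) s with h | h
  · obtain ⟨h1, h2⟩ := hT.realAttraction_mono hD hη (hsc n) h
    have h3 := Real.log_le_log (hsc n) h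
    rw [abs_of_nonneg (by linarith), abs_of_nonpos (by linarith)]
    linarith
  · obtain ⟨h1, h2⟩ := hT.realAttraction_mono hD hη hs h
    have h3 := Real.log_le_log hs h
    rw [abs_of_nonpos (by linarith), abs_of_nonneg (by linarith)]
    linarith

/-- Along the integers `s = 1, 2, …` the attraction decreases to its value at `s = ∞`. -/
lemma RegularMap.tendsto_realAttraction_top (hT : RegularMap Ω T L M)
    (hD : RegularData Ω ρ σ σmin σmax) (hη : RegularKernel d η) :
    Tendsto (fun k : ℕ => (realAttraction Ω ρ η σ T (k + 1) : EReal)) atTop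
      (𝓝 (continuumAttraction Ω ρ η σ ∞ T)) := by
  have := hη.isProbabilityMeasure
  have := hD.isProbabilityMeasure
  have hpos : ∀ k : ℕ, (0 : ℝ) < k + 1 := fun k => by positivity
  have hle : ∀ {i j : ℕ}, i ≤ j → (i : ℝ) + 1 ≤ j + 1 := fun h => by
    have : ((_ : ℕ) : ℝ) ≤ _ := Nat.cast_le.2 h
    linarith
  have htop : Tendsto (fun k : ℕ => ENNReal.ofReal ((k : ℝ) + 1)) atTop (𝓝 ∞) :=
    ENNReal.tendsto_ofReal_atTop.comp
      (tendsto_natCast_atTop_atTop.atTop_add tendsto_const_nhds)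
  have hinner : ∀ x ∈ Ω, Tendsto (fun k : ℕ => ((∫ z, logDeriv σ (fun y => ((k : ℝ) + 1) • T y) x z
      ∂kernelMeasure d η - 2 * Real.log (k + 1) : ℝ) : EReal)) atTop
      (𝓝 (Phi η ∞ (σ x • fderiv ℝ T x))) := by
    intro x hx
    have hi := fun k : ℕ =>
      ((hT.const_smul (hpos k)).integrable_logDeriv hD hη hx).1
    have e : ∀ k : ℕ, ∫ z, (logDeriv σ (fun y => ((k : ℝ) + 1) • T y) x z - 2 * Real.log (k + 1))
        ∂kernelMeasure d η = ∫ z, logDeriv σ (fun y => ((k : ℝ) + 1) • T y) x z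
        ∂kernelMeasure d η - 2 * Real.log (k + 1) := by
      intro k
      rw [integral_sub (hi k) (integrable_const _)]
      simp
    simp_rw [← e]
    refine tendsto_integral_eintegral (fun k => (hi k).sub (integrable_const _))
      (ae_of_all _ fun z => ?_) (ae_of_all _ fun z => ?_)
    · intro i j hij
      have := (logDeriv_const_smul_mono (σ := σ) hT hx (hpos i) (hle hij) z).2
      show logDeriv σ (fun y => ((j : ℝ) + 1) • T y) x z - 2 * Real.log (j + 1)
        ≤ logDeriv σ (fun y => ((i : ℝ) + 1) • T y) x z - 2 * Real.log (i + 1)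
      linarith
    · have hc : Continuous fun t : ℝ≥0∞ => ENNReal.log (t⁻¹ ^ 2 + ‖(σ x • fderiv ℝ T x) z‖ₑ ^ 2) :=
        ENNReal.continuous_log.comp
          (((ENNReal.continuous_pow 2).comp continuous_inv).add continuous_const)
      refine ((hc.tendsto ∞).comp htop).congr fun k => ?_
      rw [Function.comp_apply, log_inv_sq_add_enorm_sq (hpos k), hT.logDeriv_const_smul hx]
  have hi := fun k : ℕ =>
    (hT.const_smul (hpos k)).integrable_integral_logDeriv hD hη
  have e : ∀ k : ℕ, realAttraction Ω ρ η σ T (k + 1)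
      = ∫ x, (∫ z, logDeriv σ (fun y => ((k : ℝ) + 1) • T y) x z
        ∂kernelMeasure d η - 2 * Real.log (k + 1)) ∂dataMeasure Ω ρ := by
    intro k
    rw [integral_sub (hi k) (integrable_const _)]
    simp [realAttraction]
  simp_rw [e]
  have hmem := RegularData.ae_mem hD.toDataAssumption
  refine tendsto_integral_eintegral (fun k => (hi k).sub (integrable_const _)) ?_ ?_
  · filter_upwards [hmem] with x hx i j hij
    have := (hT.integral_logDeriv_mono hD hη (hpos i) (hle hij) hx).2
    show _ - 2 * Real.log (j + 1) ≤ _ - 2 * Real.log (i + 1)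
    linarith
  · filter_upwards [hmem] with x hx using hinner x hx

/-- Continuity of `s ↦ 𝒜[T; Φ_s]` on `(0, ∞]` along sequences of positive reals. -/
theorem RegularMap.tendsto_continuumAttraction (hT : RegularMap Ω T L M)
    (hD : RegularData Ω ρ σ σmin σmax) (hη : RegularKernel d η) {s : ℝ≥0∞} (hs : s ≠ 0)
    {sc : ℕ → ℝ} (hsc : ∀ n, 0 < sc n)
    (hlim : Tendsto (fun n => ENNReal.ofReal (sc n)) atTop (𝓝 s)) :
    Tendsto (fun n => (realAttraction Ω ρ η σ T (sc n) : EReal)) atTop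
      (𝓝 (continuumAttraction Ω ρ η σ s T)) := by
  rcases eq_or_ne s ∞ with rfl | hst
  · have htop := hT.tendsto_realAttraction_top hD hη
    have hpos : ∀ k : ℕ, (0 : ℝ) < k + 1 := fun k => by positivity
    rw [tendsto_order]
    refine ⟨fun a ha => Eventually.of_forall fun n => ha.trans_le ?_, fun a ha => ?_⟩
    · refine le_of_tendsto htop ?_
      filter_upwards [eventually_ge_atTop ⌈sc n⌉₊] with k hk
      have h1 : sc n ≤ k + 1 := by
        have := Nat.le_of_ceil_le hk
        linarith
      exact EReal.coe_le_coe_iff.2 (hT.realAttraction_mono hD hη (hsc n) h1).1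
    · obtain ⟨k, hk⟩ := ((tendsto_order.1 htop).2 a ha).exists
      have hev := (tendsto_order.1 hlim).1 (ENNReal.ofReal (k + 1)) ENNReal.ofReal_lt_top
      filter_upwards [hev] with n hn
      have h1 : (k : ℝ) + 1 ≤ sc n := ((ENNReal.ofReal_lt_ofReal_iff (hsc n)).1 hn).le
      exact lt_of_le_of_lt
        (EReal.coe_le_coe_iff.2 (hT.realAttraction_mono hD hη (hpos k) h1).1) hk
  · have hs0 : 0 < s.toReal := ENNReal.toReal_pos hs hst
    have h1 : Tendsto sc atTop (𝓝 s.toReal) := by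
      refine ((ENNReal.tendsto_toReal hst).comp hlim).congr fun n => ?_
      exact ENNReal.toReal_ofReal (hsc n).le
    have h2 := hT.continuumAttraction_eq hD hη hs0
    rw [ENNReal.ofReal_toReal hst] at h2
    rw [h2]
    exact (continuous_coe_real_ereal.tendsto _).comp (hT.tendsto_realAttraction hD hη hs0 hsc h1)

end Continuum

/-! ### Regularisation of the data and the finite-sample estimate -/

section Combine

variable {d m : ℕ} {η : ℝ → ℝ} {Ω : Set (Eucl d)} {ρ σ : Eucl d → ℝ} {σmin σmax : ℝ}

/-- Stochastic and deterministic error combined, for regularised data. -/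
lemma exists_concentration_of_regular (hd : 1 ≤ d) (hD : RegularData Ω ρ σ σmin σmax)
    (hη : RegularKernel d η) :
    ∃ C c : ℝ, 1 ≤ C ∧ 0 < c ∧ c ≤ 1 ∧
    ∀ {m : ℕ} (T : Eucl d → Eucl m) (L M : ℝ), RegularMap Ω T L M →
    ∀ (n : ℕ) (h lam : ℝ), 2 ≤ n → 0 < h → h ≤ c → C ≤ n * h ^ d → 0 ≤ lam →
      lam ^ 2 ≤ c * (n * h ^ d) →
      (Measure.pi fun _ : Fin n => dataMeasure Ω ρ)
        {x | C * (L ^ 2 + M ^ 2) * (lam / Real.sqrt (n * h ^ d) + h) <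
          |discreteAttraction η σ h T x
            - ∫ x, ∫ z, logDeriv σ T x z ∂kernelMeasure d η ∂dataMeasure Ω ρ|}
        ≤ ENNReal.ofReal (3 * n * Real.exp (-lam ^ 2)) := by
  obtain ⟨C₁, c₁, hC₁, hc₁, hc₁1, key₁⟩ := exists_discreteAttraction_concentration hd hD hη
  obtain ⟨C₂, h₀, hC₂, hh₀, hh₀1, key₂⟩ := exists_bias_le hd hD hη
  refine ⟨C₁ + C₂, min c₁ h₀, by linarith, lt_min hc₁ hh₀, (min_le_left _ _).trans hc₁1, ?_⟩
  intro m T L M hT n h lam hn hh hhc hnh hlam hlamc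
  have hnh0 : 0 ≤ n * h ^ d := by positivity
  refine (measure_mono fun x hx => ?_).trans (key₁ T L M hT n h lam hn hh
    (hhc.trans (min_le_left _ _)) (by linarith) hlam
    (hlamc.trans (mul_le_mul_of_nonneg_right (min_le_left _ _) hnh0)))
  have hbias := key₂ T L M hT h hh (hhc.trans (min_le_right _ _))
  rw [Set.mem_ofPred_eq] at hx ⊢
  by_contra hcon
  rw [not_lt] at hcon
  refine absurd hx (not_lt.2 ?_)
  refine (abs_sub_le _ (∫ x, localAttraction η ρ σ T h x ∂dataMeasure Ω ρ) _).trans ?_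
  set δ := lam / Real.sqrt (n * h ^ d) with hδ
  have hδ0 : 0 ≤ δ := by positivity
  have h1 : 0 ≤ C₁ * M ^ 2 * δ := by positivity
  have h2 : 0 ≤ C₁ * (L ^ 2 + M ^ 2) * h := by positivity
  have h3 : 0 ≤ C₂ * (L ^ 2 + M ^ 2) * δ := by positivity
  linarith

end Combine

section Regularise

variable {d m : ℕ} {η : ℝ → ℝ} {Ω : Set (Eucl d)} {ρ σ : Eucl d → ℝ} {σmin σmax : ℝ}
  {T : Eucl d → Eucl m}

lemma DataAssumption.nonempty (h : DataAssumption Ω ρ) : Ω.Nonempty := by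
  by_contra hne
  rw [Set.not_nonempty_iff_eq_empty] at hne
  have := h.unit_mass
  simp [hne] at this

lemma BandwidthAssumption.max_pos (hσ : BandwidthAssumption Ω σ σmin σmax)
    (hΩ : Ω.Nonempty) : 0 < σmax := by
  obtain ⟨x, hx⟩ := hΩ
  exact hσ.min_pos.trans_le ((hσ.bounds x hx).1.trans (hσ.bounds x hx).2)

lemma RegularKernel.of_kernelAssumption (hη : KernelAssumption d η) :
    RegularKernel d fun t => η (max t 0) := by
  have e : ∀ z : Eucl d, max ‖z‖ 0 = ‖z‖ := fun z => max_eq_left (norm_nonneg z)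
  exact
    { nonneg := fun t _ => hη.nonneg _ (le_max_right _ _)
      antitone := fun a _ b _ hab => hη.antitone (Set.mem_Ici.2 (le_max_right _ _))
        (Set.mem_Ici.2 (le_max_right _ _)) (max_le_max_right 0 hab)
      pos_zero := by simpa using hη.pos_zero
      unit_mass := by simpa only [e] using hη.unit_mass
      moments := fun k h1 h4 => by simpa only [e] using hη.moments k h1 h4
      antitone_univ := fun a b hab => hη.antitone (Set.mem_Ici.2 (le_max_right _ _))
        (Set.mem_Ici.2 (le_max_right _ _)) (max_le_max_right 0 hab) }

open Classical in
lemma RegularData.of_assumptions (hdata : DataAssumption Ω ρ)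
    (hσ : BandwidthAssumption Ω σ σmin σmax) :
    RegularData Ω (Ω.piecewise ρ fun _ => 0) (Ω.piecewise σ fun _ => σmin) σmin σmax := by
  have hm := hdata.isOpen.measurableSet
  have e : Set.EqOn (Ω.piecewise ρ fun _ => 0) ρ Ω := Set.piecewise_eqOn _ _ _
  obtain ⟨x₀, hx₀⟩ := hdata.nonempty
  obtain ⟨L, hL⟩ := hdata.lipschitz
  exact
    { isOpen := hdata.isOpen
      isBounded := hdata.isBounded
      lipschitzBoundary := hdata.lipschitzBoundary
      lipschitz := ⟨L, fun x hx y hy => by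
        rw [e hx, e hy]; exact hL hx hy⟩
      bounds := by
        obtain ⟨a, b, ha, hab⟩ := hdata.bounds
        exact ⟨a, b, ha, fun x hx => by rw [e hx]; exact hab x hx⟩
      unit_mass := by
        rw [setIntegral_congr_fun hm e]; exact hdata.unit_mass
      measurable_density := hL.continuousOn.measurable_piecewise continuousOn_const hm
      density_eq_zero := fun x hx => Set.piecewise_eq_of_notMem _ _ _ hx
      measurable_bandwidth := hσ.continuousOn.measurable_piecewise continuousOn_const hm
      min_pos := hσ.min_pos
      bandwidth_bounds := fun x => by
        by_cases hx : x ∈ Ω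
        · rw [Set.piecewise_eq_of_mem _ _ _ hx]; exact hσ.bounds x hx
        · rw [Set.piecewise_eq_of_notMem _ _ _ hx]
          exact ⟨le_rfl, (hσ.bounds x₀ hx₀).1.trans (hσ.bounds x₀ hx₀).2⟩ }

lemma lipConst_nonneg {α β : Type*} [PseudoMetricSpace α] [PseudoMetricSpace β] (f : α → β)
    (S : Set α) : 0 ≤ lipConst f S :=
  Real.sInf_nonneg fun _ h => h.1

/-- The infimum defining the smallest Lipschitz constant is attained. -/
lemma dist_le_lipConst_mul {α β : Type*} [PseudoMetricSpace α] [PseudoMetricSpace β] {f : α → β}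
    {S : Set α} (h : ∃ K : ℝ≥0, LipschitzOnWith K f S) {x y : α} (hx : x ∈ S) (hy : y ∈ S) :
    dist (f x) (f y) ≤ lipConst f S * dist x y := by
  obtain ⟨K, hK⟩ := h
  have hmem : (K : ℝ) ∈ {K : ℝ | 0 ≤ K ∧ ∀ x ∈ S, ∀ y ∈ S, dist (f x) (f y) ≤ K * dist x y} :=
    ⟨K.2, fun x hx y hy => hK.dist_le_mul x hx y hy⟩
  rcases (dist_nonneg (x := x) (y := y)).eq_or_lt with h0 | hpos
  · have := hK.dist_le_mul x hx y hy
    rw [← h0] at this ⊢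
    simpa using this
  · rw [← div_le_iff₀ hpos]
    refine le_csInf ⟨_, hmem⟩ fun b hb => ?_
    rw [div_le_iff₀ hpos]
    exact hb.2 x hx y hy

lemma fderiv_eq_of_eqOn {T' : Eucl d → Eucl m} (ho : IsOpen Ω) (h : Set.EqOn T' T Ω) {x : Eucl d}
    (hx : x ∈ Ω) : fderiv ℝ T' x = fderiv ℝ T x :=
  (h.eventuallyEq_of_mem (ho.mem_nhds hx)).fderiv_eq

open Classical in
lemma RegularMap.of_lipschitzEmbedding (ho : IsOpen Ω) (hT : LipschitzEmbedding Ω T) :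
    RegularMap Ω (Ω.piecewise T fun _ => 0) (lipConst T Ω) (lipConst (fderiv ℝ T) Ω) := by
  have e : Set.EqOn (Ω.piecewise T fun _ => 0) T Ω := Set.piecewise_eqOn _ _ _
  obtain ⟨L, hL⟩ := hT.lipschitz
  exact
    { measurable := hL.continuousOn.measurable_piecewise continuousOn_const ho.measurableSet
      differentiableAt := fun x hx => (hT.differentiableAt x hx).congr_of_eventuallyEq
        (e.eventuallyEq_of_mem (ho.mem_nhds hx))
      nonneg := lipConst_nonneg _ _
      nonneg_fderiv := lipConst_nonneg _ _
      lipschitz := fun x hx y hy => by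
        rw [e hx, e hy, ← dist_eq_norm, ← dist_eq_norm]
        exact dist_le_lipConst_mul hT.lipschitz hx hy
      lipschitz_fderiv := fun x hx y hy => by
        rw [fderiv_eq_of_eqOn ho e hx, fderiv_eq_of_eqOn ho e hy, ← dist_eq_norm, ← dist_eq_norm]
        exact dist_le_lipConst_mul hT.lipschitz_fderiv hx hy }

lemma dataMeasure_congr {ρ' : Eucl d → ℝ} (hm : MeasurableSet Ω) (h : Set.EqOn ρ' ρ Ω) :
    dataMeasure Ω ρ' = dataMeasure Ω ρ := by
  unfold dataMeasure
  refine withDensity_congr_ae ?_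
  filter_upwards [ae_restrict_mem hm] with x hx
  rw [h hx]

lemma kernelMeasure_max (d : ℕ) (η : ℝ → ℝ) :
    kernelMeasure d (fun t => η (max t 0)) = kernelMeasure d η := by
  unfold kernelMeasure
  simp only [max_eq_left (norm_nonneg _)]

lemma discreteAttraction_congr {n : ℕ} {h : ℝ} (hh : 0 ≤ h) {σ' : Eucl d → ℝ}
    {T' : Eucl d → Eucl m} (hσ0 : ∀ x ∈ Ω, 0 ≤ σ x) (hσ : Set.EqOn σ' σ Ω) (hT : Set.EqOn T' T Ω)
    {x : Fin n → Eucl d} (hx : ∀ i, x i ∈ Ω) :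
    discreteAttraction (fun t => η (max t 0)) σ' h T' x = discreteAttraction η σ h T x := by
  have e : ∀ i j, scaledKernel d (fun t => η (max t 0)) (σ' (x i) * h) ‖x i - x j‖
      = scaledKernel d η (σ (x i) * h) ‖x i - x j‖ := by
    intro i j
    have : 0 ≤ ‖x i - x j‖ / (σ (x i) * h) :=
      div_nonneg (norm_nonneg _) (mul_nonneg (hσ0 _ (hx i)) hh)
    rw [scaledKernel, scaledKernel, hσ (hx i), max_eq_left this]
  unfold discreteAttraction degree
  simp only [e, hT (hx _)]

lemma continuumAttraction_congr {ρ' σ' : Eucl d → ℝ} {T' : Eucl d → Eucl m} {s : ℝ≥0∞}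
    (hdata : DataAssumption Ω ρ) (hρ : Set.EqOn ρ' ρ Ω) (hσ : Set.EqOn σ' σ Ω)
    (hT : Set.EqOn T' T Ω) :
    continuumAttraction Ω ρ' (fun t => η (max t 0)) σ' s T'
      = continuumAttraction Ω ρ η σ s T := by
  unfold continuumAttraction
  rw [dataMeasure_congr hdata.isOpen.measurableSet hρ]
  refine eintegral_congr_ae ?_
  filter_upwards [RegularData.ae_mem hdata] with x hx
  rw [hσ hx, fderiv_eq_of_eqOn hdata.isOpen hT hx]
  unfold Phi
  rw [kernelMeasure_max]

open Classical in
/-- The finite-sample estimate under the original assumptions, for the product measure. The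
function `F` is `s ↦ 𝒜[T; Φ_s]` on `(0, ∞)`. The estimate has `h` where `γ(r / (h σ_max)) + r` would
suffice. -/
theorem exists_concentration (hd : 1 ≤ d) (hdata : DataAssumption Ω ρ)
    (hη : KernelAssumption d η) (hσ : BandwidthAssumption Ω σ σmin σmax) (m : ℕ) :
    ∃ C c : ℝ, 1 ≤ C ∧ 0 < c ∧ c ≤ 1 ∧
    ∀ T : Eucl d → Eucl m, LipschitzEmbedding Ω T → ∃ F : ℝ → ℝ,
      (∀ s, 0 < s → continuumAttraction Ω ρ η σ (ENNReal.ofReal s) T = (F s : EReal)) ∧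
      (∀ s : ℝ≥0∞, s ≠ 0 → ∀ sc : ℕ → ℝ, (∀ n, 0 < sc n) →
        Tendsto (fun n => ENNReal.ofReal (sc n)) atTop (𝓝 s) →
        Tendsto (fun n => (F (sc n) : EReal)) atTop (𝓝 (continuumAttraction Ω ρ η σ s T))) ∧
      ∀ (n : ℕ) (h lam s : ℝ), 2 ≤ n → 0 < h → h ≤ c → C ≤ n * h ^ d → 0 ≤ lam →
        lam ^ 2 ≤ c * (n * h ^ d) → 0 < s →
        (Measure.pi fun _ : Fin n => dataMeasure Ω ρ)
          {x | C * s ^ 2 * (lipConst T Ω ^ 2 + lipConst (fderiv ℝ T) Ω ^ 2)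
              * (lam / Real.sqrt (n * h ^ d) + h) <
            |discreteAttraction η σ h (fun x => s • T x) x - 2 * Real.log s - F s|}
          ≤ ENNReal.ofReal (3 * n * Real.exp (-lam ^ 2)) := by
  set ρ' := Ω.piecewise ρ fun _ => 0 with hρ'
  set σ' := Ω.piecewise σ fun _ => σmin with hσ'
  have eρ : Set.EqOn ρ' ρ Ω := Set.piecewise_eqOn _ _ _
  have eσ : Set.EqOn σ' σ Ω := Set.piecewise_eqOn _ _ _
  have hD : RegularData Ω ρ' σ' σmin σmax := RegularData.of_assumptions hdata hσ
  have hη' := RegularKernel.of_kernelAssumption hη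
  have eμ := dataMeasure_congr hdata.isOpen.measurableSet eρ
  obtain ⟨C, c, hC, hc, hc1, key⟩ := exists_concentration_of_regular hd hD hη'
  refine ⟨C, c, hC, hc, hc1, fun T hT => ?_⟩
  set T' := Ω.piecewise T fun _ => 0 with hT'def
  have eT : Set.EqOn T' T Ω := Set.piecewise_eqOn _ _ _
  have hT' := RegularMap.of_lipschitzEmbedding hdata.isOpen hT
  refine ⟨realAttraction Ω ρ' (fun t => η (max t 0)) σ' T', fun s hs => ?_,
    fun s hs sc hsc hlim => ?_, ?_⟩
  · rw [← hT'.continuumAttraction_eq hD hη' hs]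
    exact (continuumAttraction_congr hdata eρ eσ eT).symm
  · rw [← continuumAttraction_congr hdata eρ eσ eT]
    exact hT'.tendsto_continuumAttraction hD hη' hs hsc hlim
  · intro n h lam s hn hh hhc hnh hlam hlamc hs
    have hmain := key (fun x => s • T' x) _ _ (hT'.const_smul hs) n h lam hn hh hhc hnh hlam
      hlamc
    rw [eμ] at hmain
    have := hD.isProbabilityMeasure
    rw [eμ] at this
    have hmem : ∀ᵐ x ∂(Measure.pi fun _ : Fin n => dataMeasure Ω ρ), ∀ i, x i ∈ Ω := by
      rw [ae_all_iff]
      intro i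
      exact (measurePreserving_eval (fun _ : Fin n => dataMeasure Ω ρ) i).quasiMeasurePreserving.ae
        (RegularData.ae_mem hdata)
    refine (measure_mono_ae ?_).trans hmain
    filter_upwards [hmem] with x hx hbad
    have e1 : discreteAttraction (fun t => η (max t 0)) σ' h (fun x => s • T' x) x
        = discreteAttraction η σ h (fun x => s • T x) x :=
      discreteAttraction_congr hh.le (fun y hy => hσ.min_pos.le.trans (hσ.bounds y hy).1) eσ
        (fun y hy => by simp only [eT hy]) hx
    show C * ((s * lipConst T Ω) ^ 2 + (s * lipConst (fderiv ℝ T) Ω) ^ 2) *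
      (lam / Real.sqrt (n * h ^ d) + h) < |_ - _|
    rw [e1]
    have hbad' : C * s ^ 2 * (lipConst T Ω ^ 2 + lipConst (fderiv ℝ T) Ω ^ 2)
        * (lam / Real.sqrt (n * h ^ d) + h) <
      |discreteAttraction η σ h (fun x => s • T x) x - 2 * Real.log s
        - realAttraction Ω ρ' (fun t => η (max t 0)) σ' T' s| := hbad
    rw [realAttraction, eμ] at hbad'
    refine lt_of_eq_of_lt (by ring) (lt_of_lt_of_eq hbad' ?_)
    congr 1
    ring

end Regularise

/-- An i.i.d. sample falls into a set with at most the probability given by the product measure;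
no measurability of the set is needed. -/
lemma measure_preimage_le_pi {S α : Type*} [MeasurableSpace S] [MeasurableSpace α] {P : Measure S}
    [IsProbabilityMeasure P] {μ : Measure α} {n : ℕ} {X : Fin n → S → α} (hX : iIndepFun X P)
    (hlaw : ∀ i, HasLaw (X i) μ P) (B : Set (Fin n → α)) :
    P {ω | (fun i => X i ω) ∈ B} ≤ (Measure.pi fun _ : Fin n => μ) B := by
  have hm : ∀ i, AEMeasurable (X i) P := fun i => (hlaw i).aemeasurable
  have h1 := (iIndepFun_iff_map_fun_eq_pi_map hm).1 hX
  simp only [(hlaw _).map_eq] at h1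
  rw [← h1]
  exact Measure.le_map_apply (aemeasurable_pi_lambda _ hm) B

/-! ### Scaling limits -/

section Scaling

variable {d : ℕ} {η : ℝ → ℝ} {σmax : ℝ}

lemma KernelAssumption.integrable (hη : KernelAssumption d η) :
    Integrable fun z : Eucl d => η ‖z‖ := by
  by_contra h
  have := hη.unit_mass
  rw [integral_undef h] at this
  exact zero_ne_one this

lemma kernelTail_nonneg (hη : KernelAssumption d η) (R : ℝ) : 0 ≤ kernelTail d η R :=
  integral_nonneg fun z => hη.nonneg _ (norm_nonneg z)

lemma tendsto_kernelTail (hη : KernelAssumption d η) :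
    Tendsto (kernelTail d η) atTop (𝓝 0) := by
  have hi := hη.moments 1 le_rfl (by norm_num)
  have hlim : Tendsto (fun R : ℝ => (∫ z : Eucl d, η ‖z‖ * ‖z‖ ^ 1) / R) atTop (𝓝 0) :=
    tendsto_const_nhds.div_atTop tendsto_id
  refine tendsto_of_tendsto_of_tendsto_of_le_of_le' tendsto_const_nhds hlim
    (Eventually.of_forall fun R => kernelTail_nonneg hη R) ?_
  filter_upwards [eventually_gt_atTop 0] with R hR
  rw [le_div_iff₀ hR, kernelTail, ← integral_mul_const]
  have hm : MeasurableSet {z : Eucl d | R ≤ ‖z‖} := measurableSet_le measurable_const measurable_norm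
  have h0 : ∀ z : Eucl d, 0 ≤ η ‖z‖ * ‖z‖ ^ 1 := fun z =>
    mul_nonneg (hη.nonneg _ (norm_nonneg z)) (by positivity)
  refine (setIntegral_mono_on (hη.integrable.mul_const R).integrableOn hi.integrableOn hm
    fun z hz => ?_).trans (setIntegral_le_integral hi (ae_of_all _ h0))
  rw [pow_one]
  exact mul_le_mul_of_nonneg_left hz (hη.nonneg _ (norm_nonneg z))

lemma tendsto_div_log_mul_pow (d : ℕ) :
    Tendsto (fun n : ℕ => n * (Real.log (n + 3))⁻¹ ^ d / Real.log n) atTop atTop := by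
  have hcast : Tendsto (fun n : ℕ => (n : ℝ) + 3) atTop atTop :=
    tendsto_natCast_atTop_atTop.atTop_add tendsto_const_nhds
  have h1 : Tendsto (fun n : ℕ => Real.log (n + 3) ^ (d + 1) / (1 * ((n : ℝ) + 3) + -3)) atTop
      (𝓝 0) := (Real.tendsto_pow_log_div_mul_add_atTop 1 (-3) (d + 1) one_ne_zero).comp hcast
  have hpos : ∀ᶠ n : ℕ in atTop, 0 < Real.log (n + 3) ^ (d + 1) / (1 * ((n : ℝ) + 3) + -3) := by
    filter_upwards [eventually_ge_atTop 2] with n hn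
    have hn' : (2 : ℝ) ≤ n := by exact_mod_cast hn
    have : 0 < Real.log (n + 3) := Real.log_pos (by linarith)
    have : 0 < 1 * ((n : ℝ) + 3) + -3 := by linarith
    positivity
  have h2 := (tendsto_nhdsWithin_iff.2 ⟨h1, hpos⟩).inv_tendsto_nhdsGT_zero
  refine tendsto_atTop_mono' _ ?_ h2
  filter_upwards [eventually_ge_atTop 2] with n hn
  have hn' : (2 : ℝ) ≤ n := by exact_mod_cast hn
  have hl : 0 < Real.log n := Real.log_pos (by linarith)
  have hl3 : 0 < Real.log (n + 3) := Real.log_pos (by linarith)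
  have hle : Real.log n ≤ Real.log (n + 3) := Real.log_le_log (by linarith) (by linarith)
  have e1 : (Real.log (n + 3) ^ (d + 1) / (1 * ((n : ℝ) + 3) + -3))⁻¹
      = n * (Real.log (n + 3))⁻¹ ^ d / Real.log (n + 3) := by
    have : 1 * ((n : ℝ) + 3) + -3 = n := by ring
    rw [this, inv_pow, inv_div, pow_succ]
    field_simp
  rw [Pi.inv_apply, e1]
  gcongr

lemma sqrt_log_div_eq {x y : ℝ} (hx : 0 ≤ x) :
    Real.sqrt x / Real.sqrt y = Real.sqrt (y / x)⁻¹ := by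
  rw [inv_div, Real.sqrt_div hx]

/-- Admissible scalings exist for every `s ∈ (0, ∞]`. With logarithmically small `h` and
`r = √h`, the attraction error tends to zero; for `s = ∞` the factor `s_n = err_n ^ (-1/4)` tends
to infinity slowly enough. -/
theorem exists_admissibleScaling (hη : KernelAssumption d η) (hσ : 0 < σmax) {s : ℝ≥0∞}
    (hs : s ≠ 0) : ∃ h r sc : ℕ → ℝ, AdmissibleScaling d η σmax h r sc s := by
  set l : ℕ → ℝ := fun n => Real.log (n + 3) with hl
  have hl0 : ∀ n, 0 < l n := fun n => Real.log_pos (by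
    have : (0 : ℝ) ≤ n := n.cast_nonneg
    linarith)
  have hlt : Tendsto l atTop atTop := Real.tendsto_log_atTop.comp
    (tendsto_natCast_atTop_atTop.atTop_add tendsto_const_nhds)
  set h : ℕ → ℝ := fun n => (l n)⁻¹ with hh
  set r : ℕ → ℝ := fun n => Real.sqrt (h n) with hr
  have hh0 : ∀ n, 0 < h n := fun n => inv_pos.2 (hl0 n)
  have hr0 : ∀ n, 0 < r n := fun n => Real.sqrt_pos.2 (hh0 n)
  have hht : Tendsto h atTop (𝓝 0) := tendsto_inv_atTop_zero.comp hlt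
  have hrt : Tendsto r atTop (𝓝 0) := by
    have := (Real.continuous_sqrt.tendsto 0).comp hht
    rwa [Real.sqrt_zero] at this
  have hsample : Tendsto (fun n : ℕ => n * h n ^ d / Real.log n) atTop atTop :=
    tendsto_div_log_mul_pow d
  have hratio : Tendsto (fun n => r n / h n) atTop atTop := by
    refine (Real.tendsto_sqrt_atTop.comp hlt).congr fun n => ?_
    rw [hr, Function.comp_apply]
    simp only
    rw [Real.sqrt_div_self', hh, one_div, Real.sqrt_inv, inv_inv]
  set err : ℕ → ℝ := fun n =>
    attractionError d η σmax n (h n) (r n) (Real.sqrt (Real.log n)) with herr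
  have herr0 : ∀ n, 0 < err n := fun n => by
    have h1 : 0 ≤ Real.sqrt (Real.log n) / Real.sqrt (n * h n ^ d) := by positivity
    have h2 := kernelTail_nonneg hη (r n / (h n * σmax))
    have h3 := hr0 n
    rw [herr]
    simp only [attractionError]
    linarith
  have herrt : Tendsto err atTop (𝓝 0) := by
    have t1 : Tendsto (fun n : ℕ => Real.sqrt (Real.log n) / Real.sqrt (n * h n ^ d)) atTop
        (𝓝 0) := by
      have := (Real.continuous_sqrt.tendsto 0).comp (tendsto_inv_atTop_zero.comp hsample)
      rw [Real.sqrt_zero] at this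
      refine this.congr fun n => ?_
      exact (sqrt_log_div_eq (Real.log_natCast_nonneg n)).symm
    have t2 : Tendsto (fun n => kernelTail d η (r n / (h n * σmax))) atTop (𝓝 0) := by
      refine (tendsto_kernelTail hη).comp ((hratio.atTop_div_const hσ).congr fun n => ?_)
      rw [div_div]
    have := (t1.add t2).add hrt
    simpa [herr, attractionError] using this
  rcases eq_or_ne s ∞ with rfl | hst
  · have hsq : Tendsto (fun n => Real.sqrt (err n)) atTop (𝓝 0) := by
      have := (Real.continuous_sqrt.tendsto 0).comp herrt
      rwa [Real.sqrt_zero] at this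
    have hsq2 : Tendsto (fun n => Real.sqrt (Real.sqrt (err n))) atTop (𝓝[>] 0) := by
      refine tendsto_nhdsWithin_iff.2 ⟨?_, Eventually.of_forall fun n =>
        Set.mem_Ioi.2 (Real.sqrt_pos.2 (Real.sqrt_pos.2 (herr0 n)))⟩
      have := (Real.continuous_sqrt.tendsto 0).comp hsq
      rwa [Real.sqrt_zero] at this
    refine ⟨h, r, fun n => (Real.sqrt (Real.sqrt (err n)))⁻¹, hh0, fun n =>
      inv_pos.2 (Real.sqrt_pos.2 (Real.sqrt_pos.2 (herr0 n))), hht, hrt, hsample, hratio,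
      ENNReal.tendsto_ofReal_atTop.comp hsq2.inv_tendsto_nhdsGT_zero, ?_⟩
    refine hsq.congr fun n => ?_
    have h1 : 0 < Real.sqrt (err n) := Real.sqrt_pos.2 (herr0 n)
    rw [inv_pow, Real.sq_sqrt h1.le]
    have h2 := Real.sq_sqrt (herr0 n).le
    show Real.sqrt (err n) = (Real.sqrt (err n))⁻¹ * err n
    rw [eq_inv_mul_iff_mul_eq₀ h1.ne', ← sq, h2]
  · have hs0 : 0 < s.toReal := ENNReal.toReal_pos hs hst
    refine ⟨h, r, fun _ => s.toReal, hh0, fun _ => hs0, hht, hrt, hsample, hratio, ?_, ?_⟩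
    · rw [ENNReal.ofReal_toReal hst]
      exact tendsto_const_nhds
    · have := herrt.const_mul (s.toReal ^ 2)
      rwa [mul_zero] at this

lemma le_attractionError (hη : KernelAssumption d η) {n : ℕ} {h r lam : ℝ} (hhr : h ≤ r) :
    lam / Real.sqrt (n * h ^ d) + h ≤ attractionError d η σmax n h r lam := by
  have := kernelTail_nonneg hη (r / (h * σmax))
  unfold attractionError
  linarith

/-- If a family of statistics concentrates around `F (sc n)` at the rate of the attraction error,
then along an admissible scaling it converges almost surely to the limit of `F (sc n)`:
Borel–Cantelli with `λ² = 3 log n`, for which the exceptional probabilities are `3 / n²`. -/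
lemma ae_tendsto_of_concentration (hη : KernelAssumption d η) {S : Type*} [MeasurableSpace S]
    {P : Measure S} {Y : ℕ → S → ℝ} {F : ℝ → ℝ} {h r sc : ℕ → ℝ} {s : ℝ≥0∞} {C c κ : ℝ}
    {ℓ : EReal} (hc : 0 < c) (hC : 0 ≤ C) (hκ : 0 ≤ κ)
    (hadm : AdmissibleScaling d η σmax h r sc s)
    (hF : Tendsto (fun n => (F (sc n) : EReal)) atTop (𝓝 ℓ))
    (hconc : ∀ (n : ℕ) (lam : ℝ), 2 ≤ n → h n ≤ c → C ≤ n * h n ^ d → 0 ≤ lam →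
      lam ^ 2 ≤ c * (n * h n ^ d) →
      P {ω | C * sc n ^ 2 * κ * (lam / Real.sqrt (n * h n ^ d) + h n) < |Y n ω - F (sc n)|}
        ≤ ENNReal.ofReal (3 * n * Real.exp (-lam ^ 2))) :
    ∀ᵐ ω ∂P, Tendsto (fun n => (Y n ω : EReal)) atTop (𝓝 ℓ) := by
  set lam : ℕ → ℝ := fun n => Real.sqrt 3 * Real.sqrt (Real.log n) with hlam
  have hlam0 : ∀ n, 0 ≤ lam n := fun n => by positivity
  have hlam2 : ∀ n, lam n ^ 2 = 3 * Real.log n := fun n => by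
    rw [hlam]
    simp only
    rw [mul_pow, Real.sq_sqrt (by norm_num), Real.sq_sqrt (Real.log_natCast_nonneg n)]
  have hlogt : Tendsto (fun n : ℕ => Real.log n) atTop atTop :=
    Real.tendsto_log_atTop.comp tendsto_natCast_atTop_atTop
  have hlog1 : ∀ᶠ n : ℕ in atTop, 1 ≤ Real.log n := hlogt.eventually_ge_atTop 1
  have hbig : ∀ K : ℝ, ∀ᶠ n : ℕ in atTop, K * Real.log n ≤ n * h n ^ d := by
    intro K
    filter_upwards [hlog1, hadm.sample_size.eventually_ge_atTop K] with n h1 h2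
    rwa [le_div_iff₀ (by linarith)] at h2
  have hev : ∀ᶠ n : ℕ in atTop, 2 ≤ n ∧ h n ≤ c ∧ C ≤ n * h n ^ d ∧
      lam n ^ 2 ≤ c * (n * h n ^ d) := by
    filter_upwards [eventually_ge_atTop 2, hadm.h_tendsto.eventually_le_const hc, hlog1, hbig C,
      hbig (3 / c)] with n h1 h2 h3 h4 h5
    refine ⟨h1, h2, ?_, ?_⟩
    · nlinarith
    · rw [hlam2]
      rw [div_mul_eq_mul_div, div_le_iff₀ hc] at h5
      linarith
  obtain ⟨N, hN⟩ := eventually_atTop.1 hev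
  set bad : ℕ → Set S := fun n =>
    {ω | C * sc n ^ 2 * κ * (lam n / Real.sqrt (n * h n ^ d) + h n) < |Y n ω - F (sc n)|}
  have hprob : ∀ n, P (bad (n + N)) ≤ ENNReal.ofReal (3 * (1 / ((n + N : ℕ) : ℝ) ^ 2)) := by
    intro n
    obtain ⟨a1, a2, a3, a4⟩ := hN (n + N) (by omega)
    refine (hconc (n + N) (lam (n + N)) a1 a2 a3 (hlam0 _) a4).trans
      (ENNReal.ofReal_le_ofReal (le_of_eq ?_))
    have hpos : (0 : ℝ) < ((n + N : ℕ) : ℝ) := by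
      have : 0 < n + N := by omega
      exact_mod_cast this
    have e : Real.exp (-lam (n + N) ^ 2) = (((n + N : ℕ) : ℝ) ^ 3)⁻¹ := by
      rw [hlam2, Real.exp_neg, show (3 : ℝ) * Real.log ((n + N : ℕ) : ℝ)
        = Real.log (((n + N : ℕ) : ℝ) ^ 3) by rw [Real.log_pow]; norm_num,
        Real.exp_log (by positivity)]
    rw [e]
    field_simp
  have hsum : ∑' n, P (bad (n + N)) ≠ ∞ := by
    have hs : Summable fun n : ℕ => 3 * (1 / ((n + N : ℕ) : ℝ) ^ 2) :=
      ((summable_nat_add_iff N).2 (Real.summable_one_div_nat_pow.2 one_lt_two)).mul_left 3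
    refine ne_top_of_le_ne_top ?_ (ENNReal.tsum_le_tsum hprob)
    rw [← ENNReal.ofReal_tsum_of_nonneg (fun n => by positivity) hs]
    exact ENNReal.ofReal_ne_top
  -- the error bound tends to zero along the scaling
  have hrate : Tendsto (fun n : ℕ => C * sc n ^ 2 * κ * (lam n / Real.sqrt (n * h n ^ d) + h n))
      atTop (𝓝 0) := by
    have h1 := hadm.error_tendsto.const_mul (C * κ * Real.sqrt 3)
    rw [mul_zero] at h1
    have hhr : ∀ᶠ n in atTop, h n ≤ r n := by
      filter_upwards [hadm.ratio.eventually_ge_atTop 1] with n hn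
      rwa [one_le_div (hadm.h_pos n)] at hn
    refine tendsto_of_tendsto_of_tendsto_of_le_of_le' tendsto_const_nhds h1
      (Eventually.of_forall fun n => ?_) ?_
    · have := (hadm.h_pos n).le
      have := hlam0 n
      positivity
    · filter_upwards [hhr] with n hn
      have h3 : (1 : ℝ) ≤ Real.sqrt 3 := Real.one_le_sqrt.2 (by norm_num)
      have h4 := le_attractionError (σmax := σmax) hη (n := n)
        (lam := Real.sqrt (Real.log n)) hn
      have h5 := (hadm.h_pos n).le
      calc C * sc n ^ 2 * κ * (lam n / Real.sqrt (n * h n ^ d) + h n)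
          ≤ C * sc n ^ 2 * κ * (Real.sqrt 3 *
            (Real.sqrt (Real.log n) / Real.sqrt (n * h n ^ d) + h n)) := by
            refine mul_le_mul_of_nonneg_left ?_ (by positivity)
            rw [hlam, mul_add, mul_div_assoc]
            have := le_mul_of_one_le_left h5 h3
            linarith
        _ ≤ C * sc n ^ 2 * κ * (Real.sqrt 3 *
            attractionError d η σmax n (h n) (r n) (Real.sqrt (Real.log n))) := by gcongr
        _ = _ := by ring
  filter_upwards [ae_eventually_notMem hsum] with ω hω
  have hω' : ∀ᶠ n in atTop, ω ∉ bad n := by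
    obtain ⟨k, hk⟩ := eventually_atTop.1 hω
    refine eventually_atTop.2 ⟨k + N, fun n hn => ?_⟩
    have := hk (n - N) (by omega)
    rwa [Nat.sub_add_cancel (by omega)] at this
  have hdiff : Tendsto (fun n => Y n ω - F (sc n)) atTop (𝓝 0) := by
    rw [tendsto_zero_iff_abs_tendsto_zero]
    refine tendsto_of_tendsto_of_tendsto_of_le_of_le' tendsto_const_nhds hrate
      (Eventually.of_forall fun n => abs_nonneg _) ?_
    filter_upwards [hω'] with n hn
    exact not_lt.1 fun hlt => hn hlt
  have hadd := (EReal.continuousAt_add (p := (ℓ, ((0 : ℝ) : EReal)))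
    (Or.inr (EReal.coe_ne_bot 0)) (Or.inr (EReal.coe_ne_top 0))).tendsto.comp
    (hF.prodMk_nhds ((continuous_coe_real_ereal.tendsto 0).comp hdiff))
  simp only [EReal.coe_zero, add_zero] at hadd
  refine hadd.congr fun n => ?_
  simp only [Function.comp_apply]
  rw [← EReal.coe_add]
  congr 1
  ring

end Scaling

end TSNE

theorem theorem2p6 {d m : ℕ} (hd : 1 ≤ d) (hm : 1 ≤ m)
    (Ω : Set (TSNE.Eucl d)) (ρ : TSNE.Eucl d → ℝ) (η : ℝ → ℝ) (σ : TSNE.Eucl d → ℝ)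
    (σmin σmax : ℝ)
    (hdata : TSNE.DataAssumption Ω ρ) (hη : TSNE.KernelAssumption d η)
    (hσ : TSNE.BandwidthAssumption Ω σ σmin σmax) :
    -- quantitative estimate
    (∃ C c : ℝ, 1 ≤ C ∧ 0 < c ∧ c ≤ 1 ∧
      ∀ T : TSNE.Eucl d → TSNE.Eucl m, TSNE.LipschitzEmbedding Ω T →
      ∀ (n : ℕ) (h r lam s : ℝ), 2 ≤ n → 0 < h → h ≤ c → C ≤ n * h ^ d → h ≤ r →
        0 ≤ lam → lam ^ 2 ≤ c * (n * h ^ d) → 0 < s →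
      ∀ (S : Type*) [MeasurableSpace S] (P : Measure S) [IsProbabilityMeasure P]
        (X : Fin n → S → TSNE.Eucl d),
        iIndepFun X P → (∀ i, HasLaw (X i) (TSNE.dataMeasure Ω ρ) P) →
        1 - 3 * n * Real.exp (-lam ^ 2) ≤ P.real {ω |
          (((TSNE.discreteAttraction η σ h (fun x => s • T x) (fun i => X i ω)
              - 2 * Real.log s : ℝ) : EReal)
            - TSNE.continuumAttraction Ω ρ η σ (ENNReal.ofReal s) T).abs
          ≤ ENNReal.ofReal (C * s ^ 2 *
              (TSNE.lipConst T Ω ^ 2 + TSNE.lipConst (fderiv ℝ T) Ω ^ 2) *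
              TSNE.attractionError d η σmax n h r lam)}) ∧
    -- almost sure scaling limits
    (∀ T : TSNE.Eucl d → TSNE.Eucl m, TSNE.LipschitzEmbedding Ω T →
      ∀ (s : ℝ≥0∞), s ≠ 0 → ∀ h r sc : ℕ → ℝ, TSNE.AdmissibleScaling d η σmax h r sc s →
      ∀ (S : Type*) [MeasurableSpace S] (P : Measure S) [IsProbabilityMeasure P]
        (X : ℕ → S → TSNE.Eucl d),
        iIndepFun X P → (∀ i, HasLaw (X i) (TSNE.dataMeasure Ω ρ) P) →
        ∀ᵐ ω ∂P, Tendsto (fun n : ℕ =>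
            ((TSNE.discreteAttraction η σ (h n) (fun x => sc n • T x)
              (fun i : Fin n => X i ω) - 2 * Real.log (sc n) : ℝ) : EReal))
          atTop (𝓝 (TSNE.continuumAttraction Ω ρ η σ s T))) ∧
    -- every limit parameter, including infinity, is attained by admissible scalings
    (∀ s : ℝ≥0∞, s ≠ 0 → ∃ h r sc : ℕ → ℝ, TSNE.AdmissibleScaling d η σmax h r sc s) := by
  have hσmax := hσ.max_pos hdata.nonempty
  refine ⟨?_, ?_, fun s hs => TSNE.exists_admissibleScaling hη hσmax hs⟩
  · obtain ⟨C, c, hC, hc, hc1, key⟩ := TSNE.exists_concentration hd hdata hη hσ m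
    refine ⟨C, c, hC, hc, hc1, ?_⟩
    intro T hT n h r lam s hn hh hhc hnh hhr hlam hlamc hs S _ P _ X hX hlaw
    obtain ⟨F, hF, -, hconc⟩ := key T hT
    have hbad := (TSNE.measure_preimage_le_pi hX hlaw _).trans
      (hconc n h lam s hn hh hhc hnh hlam hlamc hs)
    rw [hF s hs]
    set good := {ω |
          (((TSNE.discreteAttraction η σ h (fun x => s • T x) (fun i => X i ω)
              - 2 * Real.log s : ℝ) : EReal) - (F s : EReal)).abs
          ≤ ENNReal.ofReal (C * s ^ 2 *
              (TSNE.lipConst T Ω ^ 2 + TSNE.lipConst (fderiv ℝ T) Ω ^ 2) *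
              TSNE.attractionError d η σmax n h r lam)} with hgood
    set bad := {ω | (fun i => X i ω) ∈ {x : Fin n → TSNE.Eucl d |
      C * s ^ 2 * (TSNE.lipConst T Ω ^ 2 + TSNE.lipConst (fderiv ℝ T) Ω ^ 2)
        * (lam / Real.sqrt (n * h ^ d) + h) <
      |TSNE.discreteAttraction η σ h (fun x => s • T x) x - 2 * Real.log s - F s|}}
    have hcover : Set.univ ⊆ good ∪ bad := by
      intro ω _
      by_cases hω : ω ∈ bad
      · exact Or.inr hω
      · left
        have h1 := not_lt.1 (show ¬ (C * s ^ 2 *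
          (TSNE.lipConst T Ω ^ 2 + TSNE.lipConst (fderiv ℝ T) Ω ^ 2)
          * (lam / Real.sqrt (n * h ^ d) + h) < |TSNE.discreteAttraction η σ h
            (fun x => s • T x) (fun i => X i ω) - 2 * Real.log s - F s|) from hω)
        rw [hgood, Set.mem_ofPred_eq, ← EReal.coe_sub, EReal.abs_def]
        refine ENNReal.ofReal_le_ofReal (h1.trans ?_)
        refine mul_le_mul_of_nonneg_left (TSNE.le_attractionError hη hhr) (by positivity)
    -- only subadditivity is used, since the good event need not be measurable
    have h1 : P.real Set.univ ≤ P.real good + P.real bad :=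
      (measureReal_mono hcover).trans (measureReal_union_le _ _)
    have h2 : P.real bad ≤ 3 * n * Real.exp (-lam ^ 2) :=
      ENNReal.toReal_le_of_le_ofReal (by positivity) hbad
    rw [probReal_univ] at h1
    linarith
  · obtain ⟨C, c, hC, hc, hc1, key⟩ := TSNE.exists_concentration hd hdata hη hσ m
    intro T hT s hs h r sc hadm S _ P _ X hX hlaw
    obtain ⟨F, -, hlim, hconc⟩ := key T hT
    refine TSNE.ae_tendsto_of_concentration
      (C := C) (Y := fun n ω => TSNE.discreteAttraction η σ (h n) (fun x => sc n • T x)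
        (fun i : Fin n => X i ω) - 2 * Real.log (sc n)) hη hc (by linarith)
      (by positivity : 0 ≤ TSNE.lipConst T Ω ^ 2 + TSNE.lipConst (fderiv ℝ T) Ω ^ 2) hadm
      (hlim s hs sc hadm.sc_pos hadm.sc_tendsto) ?_
    intro n lam hn hhc hnh hlam hlamc
    exact (TSNE.measure_preimage_le_pi (X := fun i : Fin n => X i)
      (hX.precomp Fin.val_injective) (fun i => hlaw i) _).trans
      (hconc n (h n) lam (sc n) hn (hadm.h_pos n) hhc hnh hlam hlamc (hadm.sc_pos n))
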